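/- All functions are real-valued Lebesgue measurable functions on $(0,\infty)$ with Lebesgue measure, identified when equal almost everywhere. For such $f$ let $\tilde f(x)=\operatorname{ess\,sup}\{|f(y)|:y\ge x\}$ be its least decreasing majorant, and let $\widetilde{L^1}$ be the Banach space of all $f$ with $\|f\|_{\widetilde{L^1}}=\|\tilde f\|_{L^1}<\infty$. For a compatible couple $(X_0,X_1)$ of Banach spaces, let $K(t,x;X_0,X_1)=\inf\{\|x_0\|_{X_0}+t\|x_1\|_{X_1}:x_0\in X_0,\ x_1\in X_1,\ x_0+x_1=x\}$ for $x\in X_0+X_1$ and $t>0$. Write $T:(X_0,X_1)\to(Y_0,Y_1)$ if $T:X_0+X_1\to Y_0+Y_1$ is linear and restricts to a bounded map $X_j\to Y_j$ for $j=0,1$; its norm is the maximum of the norms of these two restrictions. For compatible couples, $[(X_0,X_1),(Y_0,Y_1)]$ is a $c$-uniform relative Calderón–Mityagin pair if, whenever $x\in X_0+X_1$ and $y\in Y_0+Y_1$ satisfy $K(t,y;Y_0,Y_1)\le K(t,x;X_0,X_1)$ for all $t>0$, there is $T:(X_0,X_1)\to(Y_0,Y_1)$ of norm at most $c$ with $Tx=y$.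 It is exact if $c=1$, and $(X_0,X_1)$ is an exact Calderón–Mityagin couple if $[(X_0,X_1),(X_0,X_1)]$ is an exact relative Calderón–Mityagin pair. Call $m\ge 0$ admissible if for each $g\in\widetilde{L^1}+L^\infty$ there is a linear operator $M:(L^1,L^\infty)\to(\widetilde{L^1},L^\infty)$ of norm at most $m$ with $M\tilde g=g$. **Theorem.** The constant $m=4$ is admissible. Let $m$ be any admissible constant. Then: (a) $(\widetilde{L^1},L^\infty)$ is an exact Calderón–Mityagin couple. (b) $[(\widetilde{L^1},L^\infty),(L^1,L^\infty)]$ is an exact relative Calderón–Mityagin pair. (c) $[(L^1,L^\infty),(\widetilde{L^1},L^\infty)]$ is an $m$-uniform relative Calderón–Mityagin pair. (d) $[(L^1,L^\infty),(\widetilde{L^1},L^\infty)]$ is not an exact relative Calderón–Mityagin pair. Moreover, there is $g\in\widetilde{L^1}\cap L^\infty$ such that every $M:(L^1,L^\infty)\to(\widetilde{L^1},L^\infty)$ with $M\tilde g=g$ has norm at least $9/8$. -/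

import Mathlib

open MeasureTheory Filter Topology Set
open scoped ENNReal NNReal

namespace CalderonMityagin

noncomputable section

/-! ### Compatible couples of Banach spaces, the `K`-functional, operators between couples -/

/-- A Banach space contained in the real vector space `V` as a linear subspace. It is given by an
extended norm on `V`: the underlying subspace is `{x | nrm x < ∞}`, and it is complete. -/
structure BanachSubspace (V : Type*) [AddCommGroup V] [Module ℝ V] where
  /-- the norm, with value `∞` off the space -/
  nrm : V → ℝ≥0∞
  eq_zero_of_nrm : ∀ x, nrm x = 0 → x = 0
  nrm_add_le : ∀ x y, nrm (x + y) ≤ nrm x + nrm y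
  nrm_smul : ∀ (a : ℝ) (x : V), nrm (a • x) = ‖a‖ₑ * nrm x
  complete : ∀ u : ℕ → V, (∀ n, nrm (u n) < ∞) →
    (∀ ε : ℝ≥0∞, 0 < ε → ∃ N, ∀ m ≥ N, ∀ n ≥ N, nrm (u m - u n) ≤ ε) →
    ∃ x, nrm x < ∞ ∧ Tendsto (fun n => nrm (u n - x)) atTop (𝓝 0)

/-- The underlying linear subspace. -/
def BanachSubspace.carrier {V : Type*} [AddCommGroup V] [Module ℝ V] (X : BanachSubspace V) :
    Submodule ℝ V where
  carrier := {x | X.nrm x < ∞}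
  zero_mem' := by
    have h := X.nrm_smul 0 0
    simp only [zero_smul, enorm_zero, zero_mul] at h
    simp [h]
  add_mem' := fun {x y} hx hy =>
    (X.nrm_add_le x y).trans_lt (ENNReal.add_lt_top.2 ⟨hx, hy⟩)
  smul_mem' := fun a x hx => by
    have hx' : X.nrm x < ∞ := hx
    show X.nrm (a • x) < ∞
    rw [X.nrm_smul]
    exact ENNReal.mul_lt_top enorm_lt_top hx'

/-- `K(t, x; X₀, X₁) = inf {‖x₀‖ + t ‖x₁‖ : x₀ ∈ X₀, x₁ ∈ X₁, x₀ + x₁ = x}`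
(decompositions with `x₀ ∉ X₀` or `x₁ ∉ X₁` would contribute the value `∞`, for `t > 0`). -/
def Kfun {V : Type*} [AddCommGroup V] [Module ℝ V] (X₀ X₁ : BanachSubspace V) (t : ℝ≥0) (x : V) :
    ℝ≥0∞ :=
  ⨅ (x₀ : V) (x₁ : V) (_ : x₀ ∈ X₀.carrier) (_ : x₁ ∈ X₁.carrier) (_ : x₀ + x₁ = x),
    X₀.nrm x₀ + t * X₁.nrm x₁

/-- A compatible couple of Banach spaces inside the vector space `V`. That `X₀` and `X₁` embed
continuously into a common Hausdorff topological vector space is expressed by saying that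
`X₀ + X₁`, with the seminorm `K(1, ·; X₀, X₁)`, is such a space. -/
structure BanachCouple (V : Type*) [AddCommGroup V] [Module ℝ V] where
  X₀ : BanachSubspace V
  X₁ : BanachSubspace V
  hausdorff : ∀ x, Kfun X₀ X₁ 1 x = 0 → x = 0

section Couples

variable {V W : Type*} [AddCommGroup V] [Module ℝ V] [AddCommGroup W] [Module ℝ W]

/-- The sum `X₀ + X₁`. -/
def BanachCouple.sum (X : BanachCouple V) : Submodule ℝ V := X.X₀.carrier ⊔ X.X₁.carrier

/-- The `K`-functional of the couple. -/
def BanachCouple.K (X : BanachCouple V) (t : ℝ≥0) (x : V) : ℝ≥0∞ := Kfun X.X₀ X.X₁ t x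

/-- `x ∈ X₀` as an element of `X₀ + X₁`. -/
def BanachCouple.incl₀ (X : BanachCouple V) (x : X.X₀.carrier) : X.sum :=
  ⟨x, Submodule.mem_sup_left x.2⟩

/-- `x ∈ X₁` as an element of `X₀ + X₁`. -/
def BanachCouple.incl₁ (X : BanachCouple V) (x : X.X₁.carrier) : X.sum :=
  ⟨x, Submodule.mem_sup_right x.2⟩

/-- `T : (X₀, X₁) → (Y₀, Y₁)`: a linear operator `T : X₀ + X₁ → Y₀ + Y₁` whose restriction to
`X_j` is a bounded map into `Y_j`, `j = 0, 1`. -/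
structure CoupleMap (X : BanachCouple V) (Y : BanachCouple W) where
  toLin : X.sum →ₗ[ℝ] Y.sum
  bounded₀ : ∃ C : ℝ≥0, ∀ x : X.X₀.carrier, Y.X₀.nrm (toLin (X.incl₀ x)) ≤ C * X.X₀.nrm x
  bounded₁ : ∃ C : ℝ≥0, ∀ x : X.X₁.carrier, Y.X₁.nrm (toLin (X.incl₁ x)) ≤ C * X.X₁.nrm x

/-- The norm of `T : (X₀, X₁) → (Y₀, Y₁)`: the maximum of the operator norms of `T : X₀ → Y₀` and
`T : X₁ → Y₁` (with `0 / 0 = 0` in the quotients). -/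
def CoupleMap.norm {X : BanachCouple V} {Y : BanachCouple W} (T : CoupleMap X Y) : ℝ≥0∞ :=
  max (⨆ x : X.X₀.carrier, Y.X₀.nrm (T.toLin (X.incl₀ x)) / X.X₀.nrm x)
    (⨆ x : X.X₁.carrier, Y.X₁.nrm (T.toLin (X.incl₁ x)) / X.X₁.nrm x)

/-- `[(X₀, X₁), (Y₀, Y₁)]` is a `c`-uniform relative Calderón–Mityagin pair. -/
def IsUniformRelativePair (c : ℝ≥0) (X : BanachCouple V) (Y : BanachCouple W) : Prop :=
  ∀ (x : X.sum) (y : Y.sum), (∀ t : ℝ≥0, 0 < t → Y.K t y ≤ X.K t x) →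
    ∃ T : CoupleMap X Y, T.norm ≤ c ∧ T.toLin x = y

/-- An exact relative Calderón–Mityagin pair. -/
def IsExactRelativePair (X : BanachCouple V) (Y : BanachCouple W) : Prop :=
  IsUniformRelativePair 1 X Y

/-- An exact Calderón–Mityagin couple. -/
def IsExactCouple (X : BanachCouple V) : Prop := IsExactRelativePair X X

end Couples

/-! ### The spaces `L¹`, `L^∞` and `L̃¹` on the half line -/

/-- Lebesgue measure on `(0, ∞)`. -/
abbrev halfLine : Measure ℝ := volume.restrict (Ioi 0)

/-- Real-valued Lebesgue measurable functions on `(0, ∞)`, modulo equality almost everywhere. -/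
abbrev L0 : Type := ℝ →ₘ[halfLine] ℝ

theorem nrm_sub_congr (p : ℝ≥0∞) (f g : L0) :
    eLpNorm (f - g : L0) p halfLine = eLpNorm (⇑f - ⇑g) p halfLine :=
  eLpNorm_congr_ae (AEEqFun.coeFn_sub f g)

/-- The Lebesgue space `L^p` on `(0, ∞)`, `1 ≤ p ≤ ∞`. -/
def lebesgue (p : ℝ≥0∞) [hp : Fact (1 ≤ p)] : BanachSubspace L0 where
  nrm f := eLpNorm f p halfLine
  eq_zero_of_nrm f hf := by
    have hp0 : p ≠ 0 := (zero_lt_one.trans_le hp.out).ne'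
    rw [eLpNorm_eq_zero_iff f.aestronglyMeasurable hp0] at hf
    exact AEEqFun.ext (hf.trans AEEqFun.coeFn_zero.symm)
  nrm_add_le f g := by
    rw [eLpNorm_congr_ae (AEEqFun.coeFn_add f g)]
    exact eLpNorm_add_le f.aestronglyMeasurable g.aestronglyMeasurable hp.out
  nrm_smul a f := by
    rw [eLpNorm_congr_ae (AEEqFun.coeFn_smul a f)]
    exact eLpNorm_const_smul a _ p _
  complete u hu hc := by
    let v : ℕ → Lp ℝ p halfLine := fun n => ⟨u n, hu n⟩
    have hv : CauchySeq v := by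
      rw [EMetric.cauchySeq_iff]
      intro ε hε
      obtain ⟨δ, hδ0, hδ⟩ := exists_between hε
      obtain ⟨N, hN⟩ := hc δ hδ0
      refine ⟨N, fun m hm n hn => ?_⟩
      rw [Lp.edist_def, ← nrm_sub_congr]
      exact (hN m hm n hn).trans_lt hδ
    obtain ⟨x, hx⟩ := cauchySeq_tendsto_of_complete hv
    refine ⟨x.1, x.2, ?_⟩
    rw [tendsto_iff_edist_tendsto_0] at hx
    refine hx.congr fun n => ?_
    rw [Lp.edist_def, ← nrm_sub_congr]

/-- The least decreasing majorant `f̃(x) = ess sup {|f(y)| : y ≥ x}` of `f`, with values in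
`[0, ∞]`; only its values at `x > 0` matter. -/
def ldmE (f : L0) (x : ℝ) : ℝ≥0∞ := essSup (fun y => ‖f y‖ₑ) (halfLine.restrict (Ici x))

theorem ldmE_eq (f : L0) (x : ℝ) : ldmE f x = eLpNorm f ∞ (halfLine.restrict (Ici x)) := by
  simp [ldmE, eLpNorm_exponent_top, eLpNormEssSup]

theorem ldmE_antitone (f : L0) : Antitone (ldmE f) := by
  intro x y hxy
  rw [ldmE_eq, ldmE_eq]
  exact eLpNorm_mono_measure _ (Measure.restrict_mono (Ici_subset_Ici.2 hxy) le_rfl)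

theorem measurable_ldmE (f : L0) : Measurable (ldmE f) := (ldmE_antitone f).measurable

theorem ldmE_add_le (f g : L0) (x : ℝ) : ldmE (f + g) x ≤ ldmE f x + ldmE g x := by
  simp only [ldmE_eq]
  rw [eLpNorm_congr_ae (ae_restrict_of_ae (AEEqFun.coeFn_add f g))]
  exact eLpNorm_add_le f.aestronglyMeasurable.restrict g.aestronglyMeasurable.restrict le_top

theorem ldmE_smul (a : ℝ) (f : L0) (x : ℝ) : ldmE (a • f) x = ‖a‖ₑ * ldmE f x := by
  simp only [ldmE_eq]
  rw [eLpNorm_congr_ae (ae_restrict_of_ae (AEEqFun.coeFn_smul a f))]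
  exact eLpNorm_const_smul a _ _ _

theorem ldmE_le_nrm_top (f : L0) (x : ℝ) : ldmE f x ≤ eLpNorm f ∞ halfLine := by
  rw [ldmE_eq]
  exact eLpNorm_mono_measure _ Measure.restrict_le_self

/-- `|f| ≤ f̃` almost everywhere. -/
theorem ae_le_ldmE (f : L0) : ∀ᵐ y ∂halfLine, ‖f y‖ₑ ≤ ldmE f y := by
  have h1 : ∀ᵐ y ∂halfLine, ∀ q : ℚ, (q : ℝ) ≤ y → ‖f y‖ₑ ≤ ldmE f q := by
    rw [ae_all_iff]
    intro q
    have := ENNReal.ae_le_essSup (μ := halfLine.restrict (Ici (q : ℝ))) (fun y => ‖f y‖ₑ)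
    rw [ae_restrict_iff' measurableSet_Ici] at this
    exact this
  have h2 : ∀ᵐ y ∂halfLine, ContinuousAt (ldmE f) y := by
    have : {y | ¬ ContinuousAt (ldmE f) y}.Countable := (ldmE_antitone f).countable_not_continuousAt
    exact this.measure_zero _
  filter_upwards [h1, h2] with y hy hc
  have hl : Tendsto (ldmE f) (𝓝[<] y) (𝓝 (ldmE f y)) := hc.tendsto.mono_left inf_le_left
  refine ge_of_tendsto hl ?_
  filter_upwards [self_mem_nhdsWithin] with z hz
  obtain ⟨q, hzq, hqy⟩ := exists_rat_btwn (show z < y from hz)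
  exact (hy q hqy.le).trans (ldmE_antitone f hzq.le)

/-- The norm of `L̃¹`: `‖f‖ = ‖f̃‖_{L¹}`. -/
def tildeNorm (f : L0) : ℝ≥0∞ := ∫⁻ x, ldmE f x ∂halfLine

theorem nrm_one_le_tildeNorm (f : L0) : eLpNorm f 1 halfLine ≤ tildeNorm f := by
  rw [eLpNorm_one_eq_lintegral_enorm]
  exact lintegral_mono_ae (ae_le_ldmE f)

theorem tildeNorm_le_liminf (f : ℕ → L0) (g : L0)
    (h : ∀ᵐ y ∂halfLine, Tendsto (fun n => f n y) atTop (𝓝 (g y))) :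
    tildeNorm g ≤ liminf (fun n => tildeNorm (f n)) atTop := by
  refine le_trans (lintegral_mono fun x => ?_) (lintegral_liminf_le fun n => measurable_ldmE (f n))
  refine essSup_le_of_ae_le _ ?_
  have h1 : ∀ᵐ y ∂(halfLine.restrict (Ici x)), ∀ n, ‖f n y‖ₑ ≤ ldmE (f n) x :=
    ae_all_iff.2 fun n => ENNReal.ae_le_essSup _
  filter_upwards [h1, ae_restrict_of_ae h] with y hy hlim
  rw [← (hlim.enorm).liminf_eq]
  exact liminf_le_liminf (Eventually.of_forall hy)

/-- `L̃¹`, the space of functions whose least decreasing majorant is integrable. -/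
def tildeL1 : BanachSubspace L0 where
  nrm := tildeNorm
  eq_zero_of_nrm f hf := (lebesgue 1).eq_zero_of_nrm f
    (le_antisymm ((nrm_one_le_tildeNorm f).trans hf.le) zero_le)
  nrm_add_le f g := by
    unfold tildeNorm
    rw [← lintegral_add_left (measurable_ldmE f)]
    exact lintegral_mono (ldmE_add_le f g)
  nrm_smul a f := by
    unfold tildeNorm
    simp only [ldmE_smul]
    exact lintegral_const_mul _ (measurable_ldmE f)
  complete u hu hc := by
    obtain ⟨x, -, hx⟩ := (lebesgue 1).complete u
      (fun n => (nrm_one_le_tildeNorm _).trans_lt (hu n))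
      (fun ε hε => (hc ε hε).imp fun N h m hm n hn =>
        (nrm_one_le_tildeNorm _).trans (h m hm n hn))
    have hx' : Tendsto (fun n => eLpNorm (⇑(u n) - ⇑x) 1 halfLine) atTop (𝓝 0) :=
      hx.congr fun n => nrm_sub_congr 1 (u n) x
    obtain ⟨ns, hns, hae⟩ := (tendstoInMeasure_of_tendsto_eLpNorm one_ne_zero
      (fun n => (u n).aestronglyMeasurable) x.aestronglyMeasurable hx').exists_seq_tendsto_ae
    have key : ∀ ε : ℝ≥0∞, 0 < ε → ∃ N, ∀ m ≥ N, tildeNorm (u m - x) ≤ ε := by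
      intro ε hε
      obtain ⟨N, hN⟩ := hc ε hε
      refine ⟨N, fun m hm => ?_⟩
      refine (tildeNorm_le_liminf (fun n => u m - u (ns n)) (u m - x) ?_).trans ?_
      · have h1 : ∀ᵐ y ∂halfLine, ∀ n, (u m - u (ns n) : L0) y = u m y - u (ns n) y :=
          ae_all_iff.2 fun n => AEEqFun.coeFn_sub _ _
        filter_upwards [h1, AEEqFun.coeFn_sub (u m) x, hae] with y h1 h2 h3
        simp only [h1, h2, Pi.sub_apply]
        exact tendsto_const_nhds.sub h3
      · refine liminf_le_of_le (by isBoundedDefault) fun b hb => ?_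
        obtain ⟨n, hn1, hn2⟩ := (hb.and (hns.tendsto_atTop.eventually_ge_atTop N)).exists
        exact hn1.trans (hN m hm _ hn2)
    refine ⟨x, ?_, ?_⟩
    · obtain ⟨N, hN⟩ := key 1 one_pos
      have h : x = u N + (-1 : ℝ) • (u N - x) := by simp
      rw [h]
      calc tildeNorm (u N + (-1 : ℝ) • (u N - x))
          ≤ tildeNorm (u N) + tildeNorm ((-1 : ℝ) • (u N - x)) := by
            unfold tildeNorm
            rw [← lintegral_add_left (measurable_ldmE _)]
            exact lintegral_mono (ldmE_add_le _ _)
        _ = tildeNorm (u N) + tildeNorm (u N - x) := by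
            congr 1
            unfold tildeNorm
            simp only [ldmE_smul]
            simp
        _ < ∞ := ENNReal.add_lt_top.2 ⟨hu N, (hN N le_rfl).trans_lt ENNReal.one_lt_top⟩
    · exact ENNReal.tendsto_atTop_zero.2 key

theorem hausdorff_lebesgue (x : L0) (h : Kfun (lebesgue 1) (lebesgue ∞) 1 x = 0) : x = 0 := by
  have key : ∀ k : ℕ, eLpNorm x 1 (halfLine.restrict (Iic (k : ℝ))) = 0 := by
    intro k
    have hle : eLpNorm x 1 (halfLine.restrict (Iic (k : ℝ))) ≤
        ((k : ℝ≥0∞) + 1) * Kfun (lebesgue 1) (lebesgue ∞) 1 x := by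
      unfold Kfun
      have hk0 : ((k : ℝ≥0∞) + 1) ≠ 0 := by simp
      have hkt : ((k : ℝ≥0∞) + 1) ≠ ∞ := by simp
      rw [mul_comm, ← ENNReal.div_le_iff hk0 hkt]
      refine le_iInf fun x₀ => le_iInf fun x₁ => le_iInf fun _ => le_iInf fun _ =>
        le_iInf fun hs => ?_
      rw [ENNReal.div_le_iff hk0 hkt]
      subst hs
      rw [eLpNorm_congr_ae (ae_restrict_of_ae (AEEqFun.coeFn_add x₀ x₁))]
      refine (eLpNorm_add_le x₀.aestronglyMeasurable.restrict x₁.aestronglyMeasurable.restrict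
        le_rfl).trans ?_
      have h0 : eLpNorm x₀ 1 (halfLine.restrict (Iic (k : ℝ))) ≤ (lebesgue 1).nrm x₀ :=
        eLpNorm_mono_measure _ Measure.restrict_le_self
      have h1 : eLpNorm x₁ 1 (halfLine.restrict (Iic (k : ℝ))) ≤ (lebesgue ∞).nrm x₁ * k := by
        rw [eLpNorm_one_eq_lintegral_enorm]
        have hb : ∀ᵐ y ∂(halfLine.restrict (Iic (k : ℝ))), ‖x₁ y‖ₑ ≤ (lebesgue ∞).nrm x₁ := by
          refine ae_restrict_of_ae ?_
          have := ae_le_eLpNormEssSup (f := x₁) (μ := halfLine)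
          simpa [lebesgue, eLpNorm_exponent_top] using this
        refine (lintegral_mono_ae hb).trans ?_
        rw [lintegral_const]
        gcongr
        rw [Measure.restrict_apply_univ, Measure.restrict_apply measurableSet_Iic, inter_comm,
          Ioi_inter_Iic, Real.volume_Ioc]
        simp
      calc _ ≤ (lebesgue 1).nrm x₀ + (lebesgue ∞).nrm x₁ * k := add_le_add h0 h1
        _ ≤ (lebesgue 1).nrm x₀ * (k + 1) + (lebesgue ∞).nrm x₁ * (k + 1) := by
            gcongr
            · exact le_mul_of_one_le_right zero_le (by simp)
            · simp
        _ = _ := by simp [add_mul]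
    rw [h, mul_zero] at hle
    exact le_antisymm hle zero_le
  refine AEEqFun.ext (EventuallyEq.trans ?_ AEEqFun.coeFn_zero.symm)
  have h2 : ∀ k : ℕ, ∀ᵐ y ∂halfLine, y ∈ Iic (k : ℝ) → x y = 0 := by
    intro k
    have := (eLpNorm_eq_zero_iff x.aestronglyMeasurable.restrict one_ne_zero).1 (key k)
    exact (ae_restrict_iff' measurableSet_Iic).1 this
  filter_upwards [ae_all_iff.2 h2] with y hy
  obtain ⟨k, hk⟩ := exists_nat_ge y
  exact hy k hk

/-- The couple `(L¹, L^∞)`. -/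
def coupleL : BanachCouple L0 where
  X₀ := lebesgue 1
  X₁ := lebesgue ∞
  hausdorff := hausdorff_lebesgue

/-- The couple `(L̃¹, L^∞)`. -/
def coupleTildeL : BanachCouple L0 where
  X₀ := tildeL1
  X₁ := lebesgue ∞
  hausdorff x h := by
    refine hausdorff_lebesgue x (le_antisymm (le_trans ?_ h.le) zero_le)
    refine le_iInf fun x₀ => le_iInf fun x₁ => le_iInf fun h₀ => le_iInf fun h₁ =>
      le_iInf fun hs => ?_
    refine (iInf_le_of_le x₀ <| iInf_le_of_le x₁ <|
      iInf_le_of_le ((nrm_one_le_tildeNorm x₀).trans_lt h₀) <| iInf_le_of_le h₁ <|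
      iInf_le_of_le hs ?_)
    gcongr
    exact nrm_one_le_tildeNorm x₀

/-- The least decreasing majorant as a real-valued function modulo equality almost everywhere.
It is finite on `(0, ∞)` whenever `f ∈ L̃¹ + L^∞`. -/
def ldm (f : L0) : L0 :=
  AEEqFun.mk (fun x => (ldmE f x).toReal) (measurable_ldmE f).ennreal_toReal.aestronglyMeasurable

theorem ldmE_lt_top_of_tildeNorm {f : L0} (hf : tildeNorm f < ∞) {x : ℝ} (hx : 0 < x) :
    ldmE f x < ∞ := by
  by_contra hc
  have hc' : ldmE f x = ∞ := not_lt_top_iff.1 hc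
  have h1 : ∫⁻ y in Iic x, ldmE f y ∂halfLine ≤ tildeNorm f :=
    lintegral_mono' Measure.restrict_le_self le_rfl
  have h2 : ∫⁻ _ in Iic x, (∞ : ℝ≥0∞) ∂halfLine ≤ ∫⁻ y in Iic x, ldmE f y ∂halfLine := by
    refine setLIntegral_mono (measurable_ldmE f) fun y hy => ?_
    rw [← hc']
    exact ldmE_antitone f hy
  have h3 : ∫⁻ _ in Iic x, (∞ : ℝ≥0∞) ∂halfLine = ∞ := by
    rw [setLIntegral_const, Measure.restrict_apply measurableSet_Iic, inter_comm, Ioi_inter_Iic,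
      Real.volume_Ioc]
    exact ENNReal.top_mul (by simpa using hx)
  rw [h3] at h2
  exact (not_lt_of_ge (h2.trans h1)) hf

theorem ldmE_lt_top {f : L0} (hf : f ∈ coupleTildeL.sum) {x : ℝ} (hx : 0 < x) :
    ldmE f x < ∞ := by
  obtain ⟨f₀, h₀, f₁, h₁, rfl⟩ := Submodule.mem_sup.1 hf
  exact (ldmE_add_le f₀ f₁ x).trans_lt (ENNReal.add_lt_top.2
    ⟨ldmE_lt_top_of_tildeNorm h₀ hx, (ldmE_le_nrm_top f₁ x).trans_lt h₁⟩)

/-- If `f ∈ L̃¹ + L^∞` then `f̃ ∈ L¹ + L^∞`. -/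
theorem ldm_mem_sum {f : L0} (hf : f ∈ coupleTildeL.sum) : ldm f ∈ coupleL.sum := by
  have hfin : ∀ᵐ x ∂halfLine, ldmE f x < ∞ :=
    (ae_restrict_iff' measurableSet_Ioi).2 (Eventually.of_forall fun x hx => ldmE_lt_top hf hx)
  obtain ⟨f₀, h₀, f₁, h₁, rfl⟩ := Submodule.mem_sup.1 hf
  have h₁' : eLpNorm f₁ ∞ halfLine < ∞ := h₁
  set C : ℝ≥0∞ := eLpNorm f₁ ∞ halfLine with hC
  set F := ldmE (f₀ + f₁) with hF
  have hmF : Measurable F := measurable_ldmE _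
  have m0 : Measurable fun x => (F x - C).toReal := (hmF.sub_const C).ennreal_toReal
  have m1 : Measurable fun x => (min (F x) C).toReal := (hmF.min measurable_const).ennreal_toReal
  refine Submodule.mem_sup.2 ⟨AEEqFun.mk _ m0.aestronglyMeasurable, ?_,
    AEEqFun.mk _ m1.aestronglyMeasurable, ?_, ?_⟩
  · show eLpNorm _ 1 halfLine < ∞
    rw [eLpNorm_congr_ae (AEEqFun.coeFn_mk _ _), eLpNorm_one_eq_lintegral_enorm]
    refine lt_of_le_of_lt (lintegral_mono fun x => ?_) (show tildeNorm f₀ < ∞ from h₀)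
    have hle : F x - C ≤ ldmE f₀ x := by
      rw [tsub_le_iff_right]
      exact (ldmE_add_le f₀ f₁ x).trans (by gcongr; exact ldmE_le_nrm_top f₁ x)
    refine le_trans ?_ hle
    rw [Real.enorm_eq_ofReal ENNReal.toReal_nonneg]
    exact ENNReal.ofReal_toReal_le
  · show eLpNorm _ ∞ halfLine < ∞
    rw [eLpNorm_congr_ae (AEEqFun.coeFn_mk _ _), eLpNorm_exponent_top]
    refine lt_of_le_of_lt (essSup_le_of_ae_le C (Eventually.of_forall fun x => ?_)) h₁'
    show ‖(min (F x) C).toReal‖ₑ ≤ C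
    rw [Real.enorm_eq_ofReal ENNReal.toReal_nonneg]
    exact ENNReal.ofReal_toReal_le.trans (min_le_right _ _)
  · unfold ldm
    rw [AEEqFun.mk_add_mk]
    refine AEEqFun.mk_eq_mk.2 ?_
    filter_upwards [hfin] with x hx
    show (F x - C).toReal + (min (F x) C).toReal = (F x).toReal
    rw [← ENNReal.toReal_add (tsub_le_self.trans_lt hx).ne ((min_le_left _ _).trans_lt hx).ne]
    congr 1
    rcases le_total (F x) C with h | h
    · rw [min_eq_left h, tsub_eq_zero_of_le h, zero_add]
    · rw [min_eq_right h, tsub_add_cancel_of_le h]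

/-- `g̃`, as an element of `L¹ + L^∞`, for `g ∈ L̃¹ + L^∞`. -/
def majorant (g : coupleTildeL.sum) : coupleL.sum := ⟨ldm g, ldm_mem_sum g.2⟩

/-- `m` is a constant such that for each `g ∈ L̃¹ + L^∞` there is a linear operator
`M : (L¹, L^∞) → (L̃¹, L^∞)`, of norm at most `m`, with `M g̃ = g`. -/
def IsMajorantConstant (m : ℝ≥0) : Prop :=
  ∀ g : coupleTildeL.sum, ∃ M : CoupleMap coupleL coupleTildeL,
    M.norm ≤ m ∧ M.toLin (majorant g) = g

end

end CalderonMityagin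

open CalderonMityagin

/-! Write x* for the decreasing rearrangement and f̃ for the least decreasing majorant. Truncating
at height x*(t), respectively x̃(t), shows that K(t, x) is ∫₀ᵗ x* for (L¹, L^∞) and ∫₀ᵗ x̃ for (L̃¹,
L^∞). An inequality between K-functionals thus compares primitives of decreasing functions, and
operators are built by composing a few kinds of contraction.

Each f is carried to f̃ on (L̃¹, L^∞) by averaging over distant sets on which |f| is nearly f̃
(`orbit_ldm`). If p, q are decreasing and ∫₀ᵗ q ≤ ∫₀ᵗ p for all t, then p is carried to q on both
couples, because finitely many interval averages push p above step approximations of q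
(`orbit_of_antitone`). On (L¹, L^∞), x can be carried to any y with a smaller distribution function
(`orbit_of_distribution_le`). Multiplication by y/x carries x to y when |y| ≤ |x|.

These constructions only reach approximations of the target. The passage to the limit is
`orbit_of_approx`: a sequence of contractions has a limit, obtained by taking primitives, passing to
the limit along an ultrafilter and differentiating. Differentiation may lose a singular part, but
this only lowers norms, and lower bounds on increments survive it.

Then (a) is f → f̃ → g̃ → g; (b) is f → f̃ → g* → g; (c) is x → x* → ỹ → y, whose last arrow is the
operator M of norm at most m. For m = 4, averaging over the preceding dyadic interval takes g̃ above
|g| (`tildeNorm_dyadicShift_le`). For (d), g = 2·1_(0,1] + 1_(1,3] equals g̃, and five linear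
relations between integrals of M1_(0,1] and M1_(1,3] force norm at least 9/8
(`nine_eighths_le_norm`). -/

namespace CalderonMityagin

noncomputable section

/-! ### Contractions between couples of function spaces -/

section Contractions

/-- A linear map on `X₀ + X₁` that is a contraction from `X_j` to `Y_j`, `j = 0, 1`. -/
def IsContraction (X Y : BanachCouple L0) (T : X.sum →ₗ[ℝ] L0) : Prop :=
  (∀ h : X.sum, Y.X₀.nrm (T h) ≤ X.X₀.nrm h) ∧ ∀ h : X.sum, Y.X₁.nrm (T h) ≤ X.X₁.nrm h

variable {X Y Z : BanachCouple L0}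

theorem exists_decomposition (h : X.sum) : ∃ h₀ h₁ : X.sum, h₀ + h₁ = h ∧
    X.X₀.nrm h₀ < ∞ ∧ X.X₁.nrm h₁ < ∞ := by
  obtain ⟨h₀, hh₀, h₁, hh₁, e⟩ := Submodule.mem_sup.1 h.2
  exact ⟨⟨h₀, Submodule.mem_sup_left hh₀⟩, ⟨h₁, Submodule.mem_sup_right hh₁⟩, Subtype.ext e,
    hh₀, hh₁⟩

theorem mem_sum_of_bounded {c : ℝ≥0} {T : X.sum →ₗ[ℝ] L0}
    (h₀ : ∀ h : X.sum, X.X₀.nrm h < ∞ → Y.X₀.nrm (T h) ≤ c * X.X₀.nrm h)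
    (h₁ : ∀ h : X.sum, X.X₁.nrm h < ∞ → Y.X₁.nrm (T h) ≤ c * X.X₁.nrm h) (h : X.sum) :
    T h ∈ Y.sum := by
  obtain ⟨a, b, e, ha, hb⟩ := exists_decomposition h
  rw [← e, map_add]
  exact Submodule.add_mem_sup
    (show Y.X₀.nrm (T a) < ∞ from (h₀ a ha).trans_lt (ENNReal.mul_lt_top ENNReal.coe_lt_top ha))
    (show Y.X₁.nrm (T b) < ∞ from (h₁ b hb).trans_lt (ENNReal.mul_lt_top ENNReal.coe_lt_top hb))

/-- A bounded operator between couples from bounds for a linear map into `L0`. -/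
theorem exists_coupleMap {c : ℝ≥0} {T : X.sum →ₗ[ℝ] L0}
    (h₀ : ∀ h : X.sum, X.X₀.nrm h < ∞ → Y.X₀.nrm (T h) ≤ c * X.X₀.nrm h)
    (h₁ : ∀ h : X.sum, X.X₁.nrm h < ∞ → Y.X₁.nrm (T h) ≤ c * X.X₁.nrm h) :
    ∃ S : CoupleMap X Y, S.norm ≤ c ∧ ∀ h, (S.toLin h : L0) = T h := by
  refine ⟨⟨T.codRestrict Y.sum (mem_sum_of_bounded h₀ h₁), ⟨c, fun x => h₀ (X.incl₀ x) x.2⟩,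
    ⟨c, fun x => h₁ (X.incl₁ x) x.2⟩⟩, ?_, fun h => rfl⟩
  refine max_le (iSup_le fun x => ENNReal.div_le_of_le_mul ?_)
    (iSup_le fun x => ENNReal.div_le_of_le_mul ?_)
  · exact h₀ (X.incl₀ x) x.2
  · exact h₁ (X.incl₁ x) x.2

theorem nrm_zero (E : BanachSubspace L0) : E.nrm 0 = 0 := by
  simpa using E.nrm_smul 0 0

theorem CoupleMap.bound₀ (S : CoupleMap X Y) {c : ℝ≥0∞} (hS : S.norm ≤ c) (h : X.sum)
    (hh : X.X₀.nrm h < ∞) : Y.X₀.nrm (S.toLin h) ≤ c * X.X₀.nrm h := by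
  rcases eq_or_ne (X.X₀.nrm h) 0 with h0 | h0
  · have : h = 0 := Subtype.ext (X.X₀.eq_zero_of_nrm _ h0)
    simp [this, nrm_zero]
  · rw [← ENNReal.div_le_iff h0 hh.ne]
    exact ((le_iSup (fun x : X.X₀.carrier => Y.X₀.nrm (S.toLin (X.incl₀ x)) / X.X₀.nrm x)
      ⟨h, hh⟩).trans (le_max_left _ _)).trans hS

theorem CoupleMap.bound₁ (S : CoupleMap X Y) {c : ℝ≥0∞} (hS : S.norm ≤ c) (h : X.sum)
    (hh : X.X₁.nrm h < ∞) : Y.X₁.nrm (S.toLin h) ≤ c * X.X₁.nrm h := by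
  rcases eq_or_ne (X.X₁.nrm h) 0 with h0 | h0
  · have : h = 0 := Subtype.ext (X.X₁.eq_zero_of_nrm _ h0)
    simp [this, nrm_zero]
  · rw [← ENNReal.div_le_iff h0 hh.ne]
    exact ((le_iSup (fun x : X.X₁.carrier => Y.X₁.nrm (S.toLin (X.incl₁ x)) / X.X₁.nrm x)
      ⟨h, hh⟩).trans (le_max_right _ _)).trans hS

theorem IsContraction.mem_sum {T : X.sum →ₗ[ℝ] L0} (hT : IsContraction X Y T) (h : X.sum) :
    T h ∈ Y.sum :=
  mem_sum_of_bounded (c := 1) (fun h _ => by simpa using hT.1 h) (fun h _ => by simpa using hT.2 h)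
    h

/-- `y` is the image of `x` under a contraction from `X` to `Y`. -/
def Orbit (X Y : BanachCouple L0) (x : X.sum) (y : L0) : Prop :=
  ∃ T : X.sum →ₗ[ℝ] L0, IsContraction X Y T ∧ T x = y

theorem IsContraction.comp {T : X.sum →ₗ[ℝ] L0} (hT : IsContraction X Y T)
    {S : Y.sum →ₗ[ℝ] L0} (hS : IsContraction Y Z S) :
    IsContraction X Z (S.comp (T.codRestrict Y.sum hT.mem_sum)) :=
  ⟨fun h => (hS.1 _).trans (hT.1 h), fun h => (hS.2 _).trans (hT.2 h)⟩

theorem Orbit.trans {x : X.sum} {y : L0} (hy : y ∈ Y.sum) {z : L0} (h₁ : Orbit X Y x y)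
    (h₂ : Orbit Y Z ⟨y, hy⟩ z) : Orbit X Z x z := by
  obtain ⟨T, hT, rfl⟩ := h₁
  obtain ⟨S, hS, rfl⟩ := h₂
  exact ⟨_, hT.comp hS, rfl⟩

theorem Orbit.exists_coupleMap {x : X.sum} {y : Y.sum} (h : Orbit X Y x y) :
    ∃ S : CoupleMap X Y, S.norm ≤ (1 : ℝ≥0) ∧ S.toLin x = y := by
  obtain ⟨T, hT, e⟩ := h
  obtain ⟨S, hS, hST⟩ := CalderonMityagin.exists_coupleMap (X := X) (Y := Y) (c := 1) (T := T)
    (fun h _ => by simpa using hT.1 h) (fun h _ => by simpa using hT.2 h)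
  exact ⟨S, hS, Subtype.ext ((hST x).trans e)⟩

/-- A linear map into `L0` given by representatives. -/
def linOfRep {V : Type*} [AddCommGroup V] [Module ℝ V] (F : V → ℝ → ℝ)
    (hm : ∀ v, AEStronglyMeasurable (F v) halfLine)
    (hadd : ∀ v w, F (v + w) =ᵐ[halfLine] F v + F w)
    (hsmul : ∀ (a : ℝ) v, F (a • v) =ᵐ[halfLine] a • F v) : V →ₗ[ℝ] L0 where
  toFun v := AEEqFun.mk (F v) (hm v)
  map_add' v w := by
    rw [AEEqFun.mk_add_mk]
    exact AEEqFun.mk_eq_mk.2 (hadd v w)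
  map_smul' a v := by
    rw [RingHom.id_apply, AEEqFun.smul_mk]
    exact AEEqFun.mk_eq_mk.2 (hsmul a v)

theorem linOfRep_ae {V : Type*} [AddCommGroup V] [Module ℝ V] (F : V → ℝ → ℝ)
    (hm : ∀ v, AEStronglyMeasurable (F v) halfLine)
    (hadd : ∀ v w, F (v + w) =ᵐ[halfLine] F v + F w)
    (hsmul : ∀ (a : ℝ) v, F (a • v) =ᵐ[halfLine] a • F v) (v : V) :
    linOfRep F hm hadd hsmul v =ᵐ[halfLine] F v :=
  AEEqFun.coeFn_mk _ _

end Contractions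

/-! ### Elementary facts on the spaces -/

theorem ae_le_nrm_top (f : L0) : ∀ᵐ y ∂halfLine, ‖f y‖ₑ ≤ (lebesgue ∞).nrm f := by
  have := ae_le_eLpNormEssSup (f := f) (μ := halfLine)
  simpa [lebesgue, eLpNorm_exponent_top] using this

theorem nrm_top_le {f : L0} {C : ℝ≥0∞} (h : ∀ᵐ y ∂halfLine, ‖f y‖ₑ ≤ C) :
    (lebesgue ∞).nrm f ≤ C := by
  show eLpNorm f ∞ halfLine ≤ C
  rw [eLpNorm_exponent_top]
  exact essSup_le_of_ae_le C h

theorem nrm_one_eq (f : L0) : (lebesgue 1).nrm f = ∫⁻ s, ‖f s‖ₑ ∂halfLine :=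
  eLpNorm_one_eq_lintegral_enorm

theorem ldmE_le_of_antitoneOn {f : L0} {q : ℝ → ℝ≥0∞} (hq : AntitoneOn q (Ioi 0))
    (h : ∀ᵐ s ∂halfLine, ‖f s‖ₑ ≤ q s) {x : ℝ} (hx : 0 < x) : ldmE f x ≤ q x := by
  refine essSup_le_of_ae_le _ ?_
  filter_upwards [ae_restrict_of_ae h, ae_restrict_mem measurableSet_Ici] with s hs hs'
  exact hs.trans (hq hx (hx.trans_le hs') hs')

/-- The function f̃ lies below every decreasing majorant of |f|. Bounds in L̃¹ for the averaging
operators and for limits are obtained by exhibiting such a majorant of the image. -/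
theorem tildeNorm_le_of_antitoneOn {f : L0} {q : ℝ → ℝ≥0∞} (hq : AntitoneOn q (Ioi 0))
    (h : ∀ᵐ s ∂halfLine, ‖f s‖ₑ ≤ q s) : tildeNorm f ≤ ∫⁻ s, q s ∂halfLine := by
  refine lintegral_mono_ae ?_
  filter_upwards [ae_restrict_mem measurableSet_Ioi] with x hx
  exact ldmE_le_of_antitoneOn hq h hx

theorem ldmE_mono {f g : L0} (h : ∀ᵐ s ∂halfLine, ‖f s‖ₑ ≤ ‖g s‖ₑ) (x : ℝ) :
    ldmE f x ≤ ldmE g x :=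
  essSup_mono_ae (ae_restrict_of_ae h)

theorem tilde_sum_le : coupleTildeL.sum ≤ coupleL.sum :=
  sup_le_sup_right (fun x hx => lt_of_le_of_lt (nrm_one_le_tildeNorm x) hx) _

theorem integrableOn_of_mem_sum {h : L0} (hh : h ∈ coupleL.sum) {P : Set ℝ}
    (hP : halfLine P < ∞) : IntegrableOn h P halfLine := by
  obtain ⟨a, ha, b, hb, rfl⟩ := Submodule.mem_sup.1 hh
  have h1 : IntegrableOn a P halfLine :=
    ((memLp_one_iff_integrable).1 ⟨a.aestronglyMeasurable, ha⟩).integrableOn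
  have hb' : MemLp b ∞ halfLine := ⟨b.aestronglyMeasurable, hb⟩
  have : IsFiniteMeasure (halfLine.restrict P) := ⟨by simpa using hP⟩
  have h2 : IntegrableOn b P halfLine := (hb'.restrict P).integrable le_top
  exact (h1.add h2).congr (ae_restrict_of_ae (AEEqFun.coeFn_add a b).symm)

theorem halfLine_Ioc {a : ℝ} (ha : 0 ≤ a) (b : ℝ) : halfLine (Ioc a b) = ENNReal.ofReal (b - a) := by
  rw [Measure.restrict_apply measurableSet_Ioc, inter_eq_left.2, Real.volume_Ioc]
  exact fun x hx => ha.trans_lt hx.1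

theorem halfLine_restrict_Ioc {a : ℝ} (ha : 0 ≤ a) (b : ℝ) :
    halfLine.restrict (Ioc a b) = volume.restrict (Ioc a b) :=
  Measure.restrict_restrict_of_subset fun _ hx => ha.trans_lt hx.1

/-! ### Limits along an ultrafilter of primitives -/

section DerivLimit

/-- The limit of a bounded real sequence along a fixed nonprincipal ultrafilter. -/
def ulim (u : ℕ → ℝ) : ℝ := limUnder (hyperfilter ℕ : Filter ℕ) u

theorem tendsto_ulim {u : ℕ → ℝ} {C : ℝ} (h : ∀ n, |u n| ≤ C) :
    Tendsto u (hyperfilter ℕ : Filter ℕ) (𝓝 (ulim u)) := by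
  obtain ⟨L, -, hL⟩ := (isCompact_Icc (a := -C) (b := C)).ultrafilter_le_nhds
    ((hyperfilter ℕ).map u) (by
      rw [le_principal_iff]
      exact Filter.mem_map.2 (Eventually.of_forall fun n => abs_le.1 (h n)))
  exact tendsto_nhds_limUnder ⟨L, hL⟩

/-- The primitives of the absolute values of the `k n` are bounded uniformly in `n`. -/
def LocBdd (k : ℕ → L0) : Prop :=
  ∀ t : ℝ, ∃ C : ℝ, ∀ n, IntegrableOn (k n) (Iic t) halfLine ∧ ∫ s in Iic t, |k n s| ∂halfLine ≤ C

/-- The limit of the primitives along the ultrafilter. -/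
def limPrim (k : ℕ → L0) (t : ℝ) : ℝ := ulim fun n => ∫ s in Iic t, k n s ∂halfLine

/-- The limit of the primitives of the absolute values along the ultrafilter. -/
def limAbs (k : ℕ → L0) (t : ℝ) : ℝ := ulim fun n => ∫ s in Iic t, |k n s| ∂halfLine

/-- The derivative of the limit of the primitives. -/
def derivLim (k : ℕ → L0) : L0 :=
  AEEqFun.mk (deriv (limPrim k)) (measurable_deriv _).aestronglyMeasurable

variable {k : ℕ → L0}

theorem derivLim_ae (k : ℕ → L0) : derivLim k =ᵐ[halfLine] deriv (limPrim k) :=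
  AEEqFun.coeFn_mk _ _

theorem tendsto_limPrim (hk : LocBdd k) (t : ℝ) :
    Tendsto (fun n => ∫ s in Iic t, k n s ∂halfLine) (hyperfilter ℕ : Filter ℕ)
      (𝓝 (limPrim k t)) := by
  obtain ⟨C, hC⟩ := hk t
  exact tendsto_ulim fun n => abs_integral_le_integral_abs.trans (hC n).2

theorem tendsto_limAbs (hk : LocBdd k) (t : ℝ) :
    Tendsto (fun n => ∫ s in Iic t, |k n s| ∂halfLine) (hyperfilter ℕ : Filter ℕ)
      (𝓝 (limAbs k t)) := by
  obtain ⟨C, hC⟩ := hk t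
  refine tendsto_ulim (C := C) fun n => ?_
  rw [abs_of_nonneg (integral_nonneg fun s => abs_nonneg _)]
  exact (hC n).2

theorem tendsto_limPrim_sub (hk : LocBdd k) (s t : ℝ) :
    Tendsto (fun n => (∫ y in Iic t, k n y ∂halfLine) - ∫ y in Iic s, k n y ∂halfLine)
      (hyperfilter ℕ : Filter ℕ) (𝓝 (limPrim k t - limPrim k s)) :=
  (tendsto_limPrim hk t).sub (tendsto_limPrim hk s)

theorem setIntegral_Iic_sub {f : ℝ → ℝ} {s t : ℝ} (hst : s ≤ t)
    (hf : IntegrableOn f (Iic t) halfLine) :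
    (∫ y in Iic t, f y ∂halfLine) - ∫ y in Iic s, f y ∂halfLine = ∫ y in Ioc s t, f y ∂halfLine := by
  rw [← Iic_union_Ioc_eq_Iic hst, setIntegral_union (Iic_disjoint_Ioc le_rfl) measurableSet_Ioc
    (hf.mono_set (Iic_subset_Iic.2 hst)) (hf.mono_set Ioc_subset_Iic_self)]
  ring

/-- Limit of |∫ k| ≤ ∫ |k| over (s, t]. It makes `limPrim` a difference of monotone functions and
bounds its derivative by that of `limAbs`. -/
theorem abs_limPrim_sub_le (hk : LocBdd k) {s t : ℝ} (hst : s ≤ t) :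
    |limPrim k t - limPrim k s| ≤ limAbs k t - limAbs k s := by
  refine le_of_tendsto_of_tendsto' (tendsto_limPrim_sub hk s t).abs
    ((tendsto_limAbs hk t).sub (tendsto_limAbs hk s)) fun n => ?_
  obtain ⟨C, hC⟩ := hk t
  have h := (hC n).1
  rw [setIntegral_Iic_sub hst h, setIntegral_Iic_sub hst h.abs]
  exact abs_integral_le_integral_abs

theorem monotone_limAbs (hk : LocBdd k) : Monotone (limAbs k) := fun _ _ hst =>
  sub_nonneg.1 ((abs_nonneg _).trans (abs_limPrim_sub_le hk hst))

/-- Both `limAbs` and `limAbs - limPrim` are monotone, so Lebesgue's theorem applies to each.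
Absolute continuity is neither available nor needed. -/
theorem ae_differentiableAt_limPrim (hk : LocBdd k) :
    ∀ᵐ s, DifferentiableAt ℝ (limPrim k) s := by
  have h2 : Monotone fun t => limAbs k t - limPrim k t := fun s t hst => by
    have := (abs_le.1 (abs_limPrim_sub_le hk hst)).2
    show limAbs k s - limPrim k s ≤ limAbs k t - limPrim k t
    linarith
  filter_upwards [(monotone_limAbs hk).ae_differentiableAt, h2.ae_differentiableAt] with s a b
  have := a.sub b
  refine this.congr_of_eventuallyEq (Eventually.of_forall fun t => ?_)
  simp

/-- Comparison of right difference quotients gives comparison of derivatives. -/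
theorem hasDerivAt_le_of_right {f g : ℝ → ℝ} {a b s : ℝ} (hf : HasDerivAt f a s)
    (hg : HasDerivAt g b s) (h : ∀ t, s < t → f t - f s ≤ g t - g s) : a ≤ b := by
  have hf' := (hasDerivWithinAt_iff_tendsto_slope' (self_notMem_Ioi (a := s))).1
    (hf.hasDerivWithinAt (s := Ioi s))
  have hg' := (hasDerivWithinAt_iff_tendsto_slope' (self_notMem_Ioi (a := s))).1
    (hg.hasDerivWithinAt (s := Ioi s))
  refine le_of_tendsto_of_tendsto hf' hg' ?_
  filter_upwards [self_mem_nhdsWithin] with t ht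
  rw [slope_def_field, slope_def_field]
  exact div_le_div_of_nonneg_right (h t ht) (sub_nonneg.2 (le_of_lt ht))

theorem abs_hasDerivAt_le_of_right {f g : ℝ → ℝ} {a b s : ℝ} (hf : HasDerivAt f a s)
    (hg : HasDerivAt g b s) (h : ∀ t, s < t → |f t - f s| ≤ g t - g s) : |a| ≤ b := by
  refine abs_le'.2 ⟨hasDerivAt_le_of_right hf hg fun t ht => (le_abs_self _).trans (h t ht),
    hasDerivAt_le_of_right hf.neg hg fun t ht => ?_⟩
  have := (neg_le_abs _).trans (h t ht)
  simp only [Pi.neg_apply]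
  linarith

theorem ae_abs_derivLim_le (hk : LocBdd k) :
    ∀ᵐ s ∂halfLine, |derivLim k s| ≤ deriv (limAbs k) s := by
  filter_upwards [derivLim_ae k, ae_restrict_of_ae (ae_differentiableAt_limPrim hk),
    ae_restrict_of_ae (monotone_limAbs hk).ae_differentiableAt] with s h1 h2 h3
  rw [h1]
  exact abs_hasDerivAt_le_of_right h2.hasDerivAt h3.hasDerivAt fun t ht =>
    abs_limPrim_sub_le hk ht.le

/-- The derivative of the monotone function `limAbs` integrates to at most its increment, which is
at most `C`. Mass may concentrate in the limit, so equality is not to be expected. -/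
theorem nrm_one_derivLim_le (hk : LocBdd k) {C : ℝ≥0∞} (hC : ∀ n, (lebesgue 1).nrm (k n) ≤ C) :
    (lebesgue 1).nrm (derivLim k) ≤ C := by
  rcases eq_or_ne C ∞ with rfl | hC'
  · exact le_top
  have hA : ∀ t, limAbs k t ≤ C.toReal := fun t => by
    refine le_of_tendsto' (tendsto_limAbs hk t) fun n => ?_
    have : ∫ s in Iic t, |k n s| ∂halfLine = (∫⁻ s in Iic t, ‖k n s‖ₑ ∂halfLine).toReal :=
      integral_norm_eq_lintegral_enorm (k n).aestronglyMeasurable.restrict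
    rw [this]
    refine ENNReal.toReal_mono hC' (le_trans ?_ (hC n))
    rw [nrm_one_eq]
    exact lintegral_mono' Measure.restrict_le_self le_rfl
  have hA0 : ∀ t, 0 ≤ limAbs k t := fun t =>
    ge_of_tendsto' (tendsto_limAbs hk t) fun n => integral_nonneg fun s => abs_nonneg _
  have hmono := monotone_limAbs hk
  have key : ∀ N : ℕ, ∫⁻ s in Ioc (0 : ℝ) N, ENNReal.ofReal (deriv (limAbs k) s) ≤ C := by
    intro N
    have hm : MonotoneOn (limAbs k) (uIcc 0 (N : ℝ)) := hmono.monotoneOn _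
    have hint := hm.intervalIntegrable_deriv
    have hle := hm.intervalIntegral_deriv_mem_uIcc
    have h0 : 0 ≤ limAbs k N - limAbs k 0 := sub_nonneg.2 (hmono N.cast_nonneg)
    rw [uIcc_of_le h0, intervalIntegral.integral_of_le N.cast_nonneg] at hle
    rw [intervalIntegrable_iff_integrableOn_Ioc_of_le N.cast_nonneg] at hint
    rw [← ofReal_integral_eq_lintegral_ofReal hint
      (Eventually.of_forall fun s => hmono.deriv_nonneg)]
    refine ENNReal.ofReal_le_of_le_toReal (hle.2.trans ?_)
    linarith [hA N, hA0 0]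
  rw [nrm_one_eq]
  calc ∫⁻ s, ‖derivLim k s‖ₑ ∂halfLine
      ≤ ∫⁻ s, ENNReal.ofReal (deriv (limAbs k) s) ∂halfLine := by
        refine lintegral_mono_ae ?_
        filter_upwards [ae_abs_derivLim_le hk] with s hs
        rw [Real.enorm_eq_ofReal_abs]
        exact ENNReal.ofReal_le_ofReal hs
    _ ≤ C := by
        have hU : (Ioi 0 : Set ℝ) = ⋃ N : ℕ, Ioc (0 : ℝ) N := by
          ext s
          simp only [mem_Ioi, mem_iUnion, mem_Ioc, exists_and_left, iff_self_and]
          exact fun _ => exists_nat_ge s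
        rw [halfLine, hU, setLIntegral_iUnion_of_directed]
        · exact iSup_le key
        · refine (monotone_nat_of_le_succ fun n => ?_).directed_le
          exact Ioc_subset_Ioc_right (by simp)

/-- Letting the bound `c n` vary with `n` serves both L^∞, with a constant, and L̃¹, with the values
at `s` of the majorants of the `k n`. -/
theorem abs_limPrim_sub_le_of_ae (hk : LocBdd k) {s t : ℝ} (hs : 0 ≤ s) (hst : s ≤ t) {c : ℕ → ℝ}
    {c' : ℝ} (hc : Tendsto c (hyperfilter ℕ : Filter ℕ) (𝓝 c'))
    (h : ∀ n, ∀ᵐ y ∂halfLine, s < y → |k n y| ≤ c n) :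
    |limPrim k t - limPrim k s| ≤ c' * t - c' * s := by
  refine le_of_tendsto_of_tendsto' (tendsto_limPrim_sub hk s t).abs
    ((hc.mul_const t).sub (hc.mul_const s)) fun n => ?_
  obtain ⟨C, hC⟩ := hk t
  rw [setIntegral_Iic_sub hst (hC n).1, ← mul_sub]
  have := norm_setIntegral_le_of_norm_le_const_ae' (μ := halfLine) (s := Ioc s t) (f := k n)
    (C := c n) (by rw [halfLine_Ioc hs]; exact ENNReal.ofReal_lt_top) (by
      filter_upwards [h n] with y hy hy'
      exact hy hy'.1)
  rwa [measureReal_def, halfLine_Ioc hs, ENNReal.toReal_ofReal (sub_nonneg.2 hst)] at this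

theorem nrm_top_derivLim_le (hk : LocBdd k) {C : ℝ≥0∞} (hC : ∀ n, (lebesgue ∞).nrm (k n) ≤ C) :
    (lebesgue ∞).nrm (derivLim k) ≤ C := by
  rcases eq_or_ne C ∞ with rfl | hC'
  · exact le_top
  refine nrm_top_le ?_
  filter_upwards [derivLim_ae k, ae_restrict_of_ae (ae_differentiableAt_limPrim hk),
    ae_restrict_mem measurableSet_Ioi] with s h1 h2 h3
  rw [h1, Real.enorm_eq_ofReal_abs]
  refine ENNReal.ofReal_le_of_le_toReal (abs_hasDerivAt_le_of_right h2.hasDerivAt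
    (by simpa using (hasDerivAt_id s).const_mul C.toReal) fun t ht => ?_)
  refine abs_limPrim_sub_le_of_ae hk (le_of_lt h3) ht.le tendsto_const_nhds fun n => ?_
  filter_upwards [ae_le_nrm_top (k n)] with y hy _
  rw [← ENNReal.ofReal_le_iff_le_toReal hC', ← Real.enorm_eq_ofReal_abs]
  exact hy.trans (hC n)

end DerivLimit

/-! ### Grids and antitone functions -/

section Grid

/-- The least point of the grid `ℕ / n` that is `≥ s`. -/
def gridUp (n : ℕ) (s : ℝ) : ℝ := (⌈s * n⌉₊ : ℝ) / n

theorem le_gridUp {n : ℕ} (hn : 0 < n) (s : ℝ) : s ≤ gridUp n s := by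
  have : (0 : ℝ) < n := by exact_mod_cast hn
  rw [gridUp, le_div_iff₀ this]
  exact Nat.le_ceil _

theorem gridUp_lt {n : ℕ} (hn : 0 < n) {s : ℝ} (hs : 0 ≤ s) : gridUp n s < s + 1 / n := by
  have : (0 : ℝ) < n := by exact_mod_cast hn
  rw [gridUp, div_lt_iff₀ this, add_mul, one_div_mul_cancel this.ne']
  exact Nat.ceil_lt_add_one (by positivity)

theorem tendsto_gridUp {s : ℝ} (hs : 0 ≤ s) : Tendsto (fun n => gridUp n s) atTop (𝓝 s) := by
  have h : Tendsto (fun n : ℕ => s + 1 / (n : ℝ)) atTop (𝓝 (s + 0)) :=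
    tendsto_const_nhds.add tendsto_one_div_atTop_nhds_zero_nat
  rw [add_zero] at h
  refine tendsto_of_tendsto_of_tendsto_of_le_of_le' tendsto_const_nhds h ?_ ?_
  · filter_upwards [eventually_gt_atTop 0] with n hn using le_gridUp hn s
  · filter_upwards [eventually_gt_atTop 0] with n hn using (gridUp_lt hn hs).le

theorem measurable_comp_ceil {β : Type*} [MeasurableSpace β] (n : ℕ) (f : ℕ → β) :
    Measurable fun s : ℝ => f ⌈s * n⌉₊ :=
  (measurable_from_top (f := f)).comp (Nat.measurable_ceil.comp (measurable_id.mul_const _))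

theorem ae_tendsto_comp_gridUp {q : ℝ → ℝ≥0∞} (hq : Antitone q) :
    ∀ᵐ s ∂halfLine, Tendsto (fun n => q (gridUp n s)) atTop (𝓝 (q s)) := by
  have h : ∀ᵐ s ∂halfLine, ContinuousAt q s :=
    hq.countable_not_continuousAt.measure_zero _
  filter_upwards [h, ae_restrict_mem measurableSet_Ioi] with s hs hs'
  exact hs.tendsto.comp (tendsto_gridUp (le_of_lt hs'))

/-- Fatou's lemma for antitone functions, along an arbitrary filter. -/
theorem lintegral_le_of_antitone_tendsto {ι : Type*} {l : Filter ι} [l.NeBot]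
    {q : ι → ℝ → ℝ≥0∞} {p : ℝ → ℝ≥0∞} (hq : ∀ i, Antitone (q i)) (hp : Antitone p)
    (h : ∀ s, 0 < s → Tendsto (fun i => q i s) l (𝓝 (p s))) {C : ℝ≥0∞}
    (hC : ∀ i, ∫⁻ s, q i s ∂halfLine ≤ C) : ∫⁻ s, p s ∂halfLine ≤ C := by
  -- Sampled on the grid, the integrals become countable sums of point values with fixed weights.
  -- Finite partial sums converge along any filter, whereas the usual Fatou lemma is for sequences.
  have key : ∀ n : ℕ, 0 < n → ∫⁻ s, p (gridUp n s) ∂halfLine ≤ C := by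
    intro n hn
    have hn' : (0 : ℝ) < n := by exact_mod_cast hn
    have hm : Measurable fun s : ℝ => ⌈s * n⌉₊ := measurable_comp_ceil n id
    have expand : ∀ r : ℝ → ℝ≥0∞, ∫⁻ s, r (gridUp n s) ∂halfLine =
        ∑' i : ℕ, r ((i : ℝ) / n) * halfLine ((fun s : ℝ => ⌈s * n⌉₊) ⁻¹' {i}) := by
      intro r
      have h1 := lintegral_map (μ := halfLine) (f := fun i : ℕ => r ((i : ℝ) / n))
        measurable_from_top hm
      rw [lintegral_countable'] at h1
      rw [show ∫⁻ s, r (gridUp n s) ∂halfLine = ∫⁻ s, r ((⌈s * n⌉₊ : ℝ) / n) ∂halfLine from rfl,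
        ← h1]
      exact tsum_congr fun i => by rw [Measure.map_apply hm (measurableSet_singleton i)]
    have hfin : ∀ i : ℕ, halfLine ((fun s : ℝ => ⌈s * n⌉₊) ⁻¹' {i}) ≠ ∞ := by
      intro i
      refine ne_top_of_le_ne_top (b := halfLine (Iic ((i : ℝ) / n))) ?_ (measure_mono ?_)
      · rw [Measure.restrict_apply measurableSet_Iic, inter_comm, Ioi_inter_Iic, Real.volume_Ioc]
        exact ENNReal.ofReal_ne_top
      · intro s hs
        have hs' : ⌈s * n⌉₊ = i := hs
        rw [mem_Iic, le_div_iff₀ hn', ← hs']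
        exact Nat.le_ceil _
    -- Convergence is not assumed at 0, but the cell of index 0 does not meet (0, ∞).
    have hzero : halfLine ((fun s : ℝ => ⌈s * n⌉₊) ⁻¹' {0}) = 0 := by
      rw [Measure.restrict_apply (hm (measurableSet_singleton 0))]
      convert measure_empty (μ := (volume : Measure ℝ))
      refine eq_empty_of_forall_notMem fun s hs => ?_
      have h1 : s * n ≤ 0 := by simpa using hs.1
      exact absurd (mul_pos (mem_Ioi.1 hs.2) hn') h1.not_gt
    rw [expand]
    refine ENNReal.tsum_le_of_sum_range_le fun N => ?_
    refine le_of_tendsto' (x := l) (tendsto_finsetSum (f := fun (i : ℕ) (j : ι) => q j ((i : ℝ) / n) *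
      halfLine ((fun s : ℝ => ⌈s * n⌉₊) ⁻¹' {i})) (Finset.range N) fun i _ => ?_) fun j => ?_
    · rcases Nat.eq_zero_or_pos i with rfl | hi
      · simp only [hzero, mul_zero]
        exact tendsto_const_nhds
      · exact ENNReal.Tendsto.mul_const (h _ (by positivity)) (Or.inr (hfin i))
    · refine (ENNReal.sum_le_tsum _).trans ?_
      rw [← expand]
      exact (lintegral_mono fun s => hq j (le_gridUp hn s)).trans (hC j)
  calc ∫⁻ s, p s ∂halfLine
      = ∫⁻ s, liminf (fun n : ℕ => p (gridUp n s)) atTop ∂halfLine := by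
        refine lintegral_congr_ae ?_
        filter_upwards [ae_tendsto_comp_gridUp hp] with s hs
        exact hs.liminf_eq.symm
    _ ≤ liminf (fun n : ℕ => ∫⁻ s, p (gridUp n s) ∂halfLine) atTop :=
        lintegral_liminf_le fun n => measurable_comp_ceil n fun i => p ((i : ℝ) / n)
    _ ≤ C := by
        refine liminf_le_of_le (by isBoundedDefault) fun b hb => ?_
        obtain ⟨n, hn1, hn2⟩ := (hb.and (eventually_gt_atTop 0)).exists
        exact hn1.trans (key n hn2)

end Grid

/-! ### The norm of L̃¹ under limits along the ultrafilter -/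

section TildeLimit

variable {k : ℕ → L0}

theorem ofReal_mul_ldmE_le (f : L0) (s : ℝ) : ENNReal.ofReal s * ldmE f s ≤ tildeNorm f := by
  calc ENNReal.ofReal s * ldmE f s = ∫⁻ _ in Ioc 0 s, ldmE f s ∂halfLine := by
        rw [setLIntegral_const, halfLine_Ioc le_rfl, sub_zero, mul_comm]
    _ ≤ ∫⁻ y in Ioc 0 s, ldmE f y ∂halfLine :=
        setLIntegral_mono (measurable_ldmE f) fun y hy => ldmE_antitone f hy.2
    _ ≤ tildeNorm f := lintegral_mono' Measure.restrict_le_self le_rfl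

/-- The pointwise limit `q` of the majorants of the `k n` is decreasing. Increments of the limiting
primitive to the right of `s` are at most q(s) times the length, so `q` majorizes the derivative,
and Fatou along the ultrafilter bounds ∫ q. -/
theorem tildeNorm_derivLim_le (hk : LocBdd k) {C : ℝ≥0∞} (hC : ∀ n, tildeNorm (k n) ≤ C) :
    tildeNorm (derivLim k) ≤ C := by
  rcases eq_or_ne C ∞ with rfl | hC'
  · exact le_top
  choose q hq using fun s : ℝ => show ∃ L, Tendsto (fun n => ldmE (k n) s)
      (hyperfilter ℕ : Filter ℕ) (𝓝 L) from
    ⟨_, ((hyperfilter ℕ).map fun n => ldmE (k n) s).le_nhds_lim⟩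
  have hqa : Antitone q := fun s t hst =>
    le_of_tendsto_of_tendsto' (hq t) (hq s) fun n => ldmE_antitone _ hst
  refine le_trans (tildeNorm_le_of_antitoneOn (hqa.antitoneOn _) ?_)
    (lintegral_le_of_antitone_tendsto (fun n => ldmE_antitone (k n)) hqa (fun s _ => hq s) hC)
  filter_upwards [derivLim_ae k, ae_restrict_of_ae (ae_differentiableAt_limPrim hk),
    ae_restrict_mem measurableSet_Ioi] with s h1 h2 h3
  have h3' : ENNReal.ofReal s ≠ 0 := by simpa using h3
  -- Chebyshev for a decreasing function keeps q(s) finite, so that real-valued limits can be taken.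
  have hb : ∀ n, ldmE (k n) s ≤ C / ENNReal.ofReal s := fun n => by
    rw [ENNReal.le_div_iff_mul_le (Or.inl h3') (Or.inl ENNReal.ofReal_ne_top), mul_comm]
    exact (ofReal_mul_ldmE_le _ _).trans (hC n)
  have hfin : C / ENNReal.ofReal s ≠ ∞ := ENNReal.div_ne_top hC' h3'
  have hqs : q s ≠ ∞ := ne_top_of_le_ne_top hfin (le_of_tendsto' (hq s) hb)
  rw [h1, Real.enorm_eq_ofReal_abs]
  refine ENNReal.ofReal_le_of_le_toReal (abs_hasDerivAt_le_of_right h2.hasDerivAt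
    (by simpa using (hasDerivAt_id s).const_mul (q s).toReal) fun t ht => ?_)
  refine abs_limPrim_sub_le_of_ae hk (le_of_lt h3) ht.le
    ((ENNReal.tendsto_toReal hqs).comp (hq s)) fun n => ?_
  filter_upwards [ae_le_ldmE (k n)] with y hy hsy
  simp only [Function.comp_apply]
  rw [← ENNReal.ofReal_le_iff_le_toReal (ne_top_of_le_ne_top hfin (hb n)),
    ← Real.enorm_eq_ofReal_abs]
  exact hy.trans (ldmE_antitone _ hsy.le)

end TildeLimit

/-! ### Orbits under contractions are closed and solid -/

section Orbits

/-- The properties of a couple `(Y₀, L^∞)` of function spaces that give weak limits of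
contractions into it. -/
structure IsFunctionCouple (Y : BanachCouple L0) : Prop where
  top : Y.X₁ = lebesgue ∞
  nrm_one_le : ∀ k, (lebesgue 1).nrm k ≤ Y.X₀.nrm k
  mono : ∀ k k' : L0, (∀ᵐ s ∂halfLine, ‖k s‖ₑ ≤ ‖k' s‖ₑ) → Y.X₀.nrm k ≤ Y.X₀.nrm k'
  closed : ∀ k : ℕ → L0, LocBdd k → ∀ C, (∀ n, Y.X₀.nrm (k n) ≤ C) → Y.X₀.nrm (derivLim k) ≤ C

theorem isFunctionCouple_coupleL : IsFunctionCouple coupleL where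
  top := rfl
  nrm_one_le _ := le_rfl
  mono _ _ h := eLpNorm_mono_enorm_ae h
  closed _ hk _ h := nrm_one_derivLim_le hk h

theorem isFunctionCouple_coupleTildeL : IsFunctionCouple coupleTildeL where
  top := rfl
  nrm_one_le := nrm_one_le_tildeNorm
  mono _ _ h := lintegral_mono fun x => ldmE_mono h x
  closed _ hk _ h := tildeNorm_derivLim_le hk h

variable {X Y : BanachCouple L0}

theorem IsFunctionCouple.mono_top (hY : IsFunctionCouple Y) {k k' : L0}
    (h : ∀ᵐ s ∂halfLine, ‖k s‖ₑ ≤ ‖k' s‖ₑ) : Y.X₁.nrm k ≤ Y.X₁.nrm k' := by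
  rw [hY.top]
  show eLpNorm k ∞ halfLine ≤ eLpNorm k' ∞ halfLine
  exact eLpNorm_mono_enorm_ae h

theorem IsFunctionCouple.sum_le (hY : IsFunctionCouple Y) : Y.sum ≤ coupleL.sum := by
  refine sup_le_sup (fun x hx => lt_of_le_of_lt (hY.nrm_one_le x) hx) ?_
  rw [hY.top]
  exact le_rfl

theorem halfLine_Iic (t : ℝ) : halfLine (Iic t) = ENNReal.ofReal t := by
  rw [Measure.restrict_apply measurableSet_Iic, inter_comm, Ioi_inter_Iic, Real.volume_Ioc,
    sub_zero]

theorem halfLine_Iic_lt_top (t : ℝ) : halfLine (Iic t) < ∞ := by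
  rw [halfLine_Iic]
  exact ENNReal.ofReal_lt_top

theorem lintegral_add_le_of_mem {a b : L0} (P : Set ℝ) :
    ∫⁻ s in P, ‖(a + b : L0) s‖ₑ ∂halfLine ≤
      (lebesgue 1).nrm a + (lebesgue ∞).nrm b * halfLine P := by
  calc ∫⁻ s in P, ‖(a + b : L0) s‖ₑ ∂halfLine
      ≤ ∫⁻ s in P, (‖a s‖ₑ + (lebesgue ∞).nrm b) ∂halfLine := by
        refine lintegral_mono_ae (ae_restrict_of_ae ?_)
        filter_upwards [AEEqFun.coeFn_add a b, ae_le_nrm_top b] with s h1 h2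
        rw [h1, Pi.add_apply]
        exact (enorm_add_le _ _).trans (by gcongr)
    _ ≤ _ := by
        rw [lintegral_add_right _ measurable_const, setLIntegral_const, nrm_one_eq]
        gcongr
        exact Measure.restrict_le_self

/-- Decompose `h` once; since all the maps are contractions, the resulting bound on primitives does
not depend on `n`. -/
theorem locBdd_of_isContraction (hY : IsFunctionCouple Y) {T : ℕ → X.sum →ₗ[ℝ] L0}
    (hT : ∀ n, IsContraction X Y (T n)) (h : X.sum) : LocBdd fun n => T n h := by
  intro t
  obtain ⟨a, b, e, ha, hb⟩ := exists_decomposition h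
  refine ⟨(X.X₀.nrm a + X.X₁.nrm b * halfLine (Iic t)).toReal, fun n => ⟨?_, ?_⟩⟩
  · exact integrableOn_of_mem_sum (hY.sum_le ((hT n).mem_sum h)) (halfLine_Iic_lt_top t)
  · have h1 : ∫ s in Iic t, |T n h s| ∂halfLine = (∫⁻ s in Iic t, ‖T n h s‖ₑ ∂halfLine).toReal :=
      integral_norm_eq_lintegral_enorm (T n h).aestronglyMeasurable.restrict
    rw [h1]
    refine ENNReal.toReal_mono (ENNReal.add_lt_top.2
      ⟨ha, ENNReal.mul_lt_top hb (halfLine_Iic_lt_top t)⟩).ne ?_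
    rw [← e, map_add]
    refine (lintegral_add_le_of_mem _).trans ?_
    have h2 := (hT n).2 b
    rw [hY.top] at h2
    gcongr
    exact (hY.nrm_one_le _).trans ((hT n).1 a)

theorem limPrim_add {k k' : ℕ → L0} (hk : LocBdd k) (hk' : LocBdd k') (t : ℝ) :
    limPrim (fun n => k n + k' n) t = limPrim k t + limPrim k' t := by
  refine Tendsto.limUnder_eq (((tendsto_limPrim hk t).add (tendsto_limPrim hk' t)).congr fun n => ?_)
  obtain ⟨C, hC⟩ := hk t
  obtain ⟨C', hC'⟩ := hk' t
  rw [← integral_add (hC n).1 (hC' n).1]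
  exact integral_congr_ae (ae_restrict_of_ae (AEEqFun.coeFn_add (k n) (k' n)).symm)

theorem limPrim_smul {k : ℕ → L0} (hk : LocBdd k) (c t : ℝ) :
    limPrim (fun n => c • k n) t = c * limPrim k t := by
  refine Tendsto.limUnder_eq (((tendsto_limPrim hk t).const_mul c).congr fun n => ?_)
  rw [← integral_const_mul]
  exact integral_congr_ae (ae_restrict_of_ae (AEEqFun.coeFn_smul c (k n)).symm)

/-- The weak limit of a sequence of contractions. -/
theorem exists_limit_isContraction (hY : IsFunctionCouple Y) {T : ℕ → X.sum →ₗ[ℝ] L0}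
    (hT : ∀ n, IsContraction X Y (T n)) :
    ∃ S : X.sum →ₗ[ℝ] L0, IsContraction X Y S ∧ ∀ h, S h = derivLim fun n => T n h := by
  have hb := locBdd_of_isContraction hY hT
  refine ⟨{ toFun := fun h => derivLim fun n => T n h, map_add' := ?_, map_smul' := ?_ },
    ⟨fun h => hY.closed _ (hb h) _ fun n => (hT n).1 h, fun h => ?_⟩, fun h => rfl⟩
  · intro a b
    refine AEEqFun.ext ?_
    filter_upwards [derivLim_ae fun n => T n (a + b), derivLim_ae fun n => T n a,
      derivLim_ae fun n => T n b, AEEqFun.coeFn_add (derivLim fun n => T n a)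
      (derivLim fun n => T n b), ae_restrict_of_ae (ae_differentiableAt_limPrim (hb a)),
      ae_restrict_of_ae (ae_differentiableAt_limPrim (hb b))] with s h1 h2 h3 h4 h5 h6
    rw [h1, h4, Pi.add_apply, h2, h3, ← deriv_add h5 h6]
    congr 1
    funext t
    simp only [map_add, Pi.add_apply]
    exact limPrim_add (hb a) (hb b) t
  · intro c a
    refine AEEqFun.ext ?_
    filter_upwards [derivLim_ae fun n => T n (c • a), derivLim_ae fun n => T n a,
      AEEqFun.coeFn_smul c (derivLim fun n => T n a),
      ae_restrict_of_ae (ae_differentiableAt_limPrim (hb a))] with s h1 h2 h3 h4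
    rw [h1, RingHom.id_apply, h3, Pi.smul_apply, h2, smul_eq_mul, ← deriv_const_mul c h4]
    congr 1
    funext t
    simp only [map_smul]
    exact limPrim_smul (hb a) c t
  · have h2 := fun n => (hT n).2 h
    rw [hY.top] at h2 ⊢
    exact nrm_top_derivLim_le (hb h) h2

/-- Multiplication by a function of modulus at most one that takes `x` to `y`. -/
theorem exists_mul_eq {x y : L0} (h : ∀ᵐ s ∂halfLine, ‖y s‖ₑ ≤ ‖x s‖ₑ) :
    ∃ S : L0 →ₗ[ℝ] L0, S x = y ∧ ∀ v, ∀ᵐ s ∂halfLine, ‖S v s‖ₑ ≤ ‖v s‖ₑ := by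
  -- Where x vanishes the quotient is 0 by convention, which is harmless because y vanishes there as
  -- well.
  let S := linOfRep (V := L0) (fun v s => y s / x s * v s)
    (fun v => ((y.aestronglyMeasurable.aemeasurable.div x.aestronglyMeasurable.aemeasurable).mul
      v.aestronglyMeasurable.aemeasurable).aestronglyMeasurable)
    (fun v w => by
      filter_upwards [AEEqFun.coeFn_add v w] with s hs
      simp only [hs, Pi.add_apply, mul_add])
    (fun a v => by
      filter_upwards [AEEqFun.coeFn_smul a v] with s hs
      simp only [hs, Pi.smul_apply, smul_eq_mul]
      ring)
  have hS : ∀ v : L0, S v =ᵐ[halfLine] fun s => y s / x s * v s := fun v => linOfRep_ae _ _ _ _ v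
  refine ⟨S, AEEqFun.ext ?_, fun v => ?_⟩
  · filter_upwards [hS x, h] with s h1 h2
    rw [h1]
    rcases eq_or_ne (x s) 0 with h0 | h0
    · have : y s = 0 := by simpa [h0] using h2
      simp [h0, this]
    · field_simp
  · filter_upwards [hS v, h] with s h1 h2
    rw [h1, enorm_mul]
    refine mul_le_of_le_one_left zero_le ?_
    rw [Real.enorm_eq_ofReal_abs, Real.enorm_eq_ofReal_abs,
      ENNReal.ofReal_le_ofReal_iff (abs_nonneg _)] at h2
    rw [Real.enorm_eq_ofReal_abs, ENNReal.ofReal_le_one, abs_div]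
    exact div_le_one_of_le₀ h2 (abs_nonneg _)

theorem IsContraction.mul (hY : IsFunctionCouple Y) {T : X.sum →ₗ[ℝ] L0}
    (hT : IsContraction X Y T) {S : L0 →ₗ[ℝ] L0}
    (hS : ∀ v, ∀ᵐ s ∂halfLine, ‖S v s‖ₑ ≤ ‖v s‖ₑ) : IsContraction X Y (S.comp T) :=
  ⟨fun h => (hY.mono _ _ (hS _)).trans (hT.1 h), fun h => (hY.mono_top (hS _)).trans (hT.2 h)⟩

theorem orbit_of_ae_le (hY : IsFunctionCouple Y) (x : Y.sum) {y : L0}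
    (h : ∀ᵐ s ∂halfLine, ‖y s‖ₑ ≤ ‖(x : L0) s‖ₑ) : Orbit Y Y x y := by
  obtain ⟨S, hS, hle⟩ := exists_mul_eq h
  exact ⟨_, IsContraction.mul hY (T := Y.sum.subtype) ⟨fun _ => le_rfl, fun _ => le_rfl⟩ hle, hS⟩

/-- If contractions map `x` above functions that increase to `|y|`, then some contraction maps
`x` to `y`. -/
theorem orbit_of_approx (hY : IsFunctionCouple Y) {T : ℕ → X.sum →ₗ[ℝ] L0}
    (hT : ∀ n, IsContraction X Y (T n)) {x : X.sum} {y : L0} (hy : y ∈ Y.sum) {w : ℕ → ℝ → ℝ}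
    (hwm : ∀ n, AEStronglyMeasurable (w n) halfLine)
    (hw : ∀ n, ∀ᵐ s ∂halfLine, w n s ≤ T n x s)
    (hwy : ∀ n, ∀ᵐ s ∂halfLine, |w n s| ≤ |y s|)
    (hlim : ∀ᵐ s ∂halfLine, Tendsto (fun n => w n s) atTop (𝓝 |y s|)) : Orbit X Y x y := by
  obtain ⟨S, hS, hSd⟩ := exists_limit_isContraction hY hT
  have hb := locBdd_of_isContraction hY hT x
  have hyi : ∀ t, IntegrableOn (fun s => |y s|) (Iic t) halfLine := fun t =>
    (integrableOn_of_mem_sum (hY.sum_le hy) (halfLine_Iic_lt_top t)).abs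
  -- Integrate w ≤ T x over (s, t] and let n grow: the left side converges by dominated convergence,
  -- the right side by definition of `limPrim`.
  have hle : ∀ s t : ℝ, s ≤ t →
      ∫ r in Ioc s t, |y r| ∂halfLine ≤
        limPrim (fun n => T n x) t - limPrim (fun n => T n x) s := by
    intro s t hst
    have h1 : Tendsto (fun n => ∫ r in Ioc s t, w n r ∂halfLine) atTop
        (𝓝 (∫ r in Ioc s t, |y r| ∂halfLine)) :=
      tendsto_integral_of_dominated_convergence (fun r => |y r|) (fun n => (hwm n).restrict)
        ((hyi t).mono_set Ioc_subset_Iic_self) (fun n => ae_restrict_of_ae (hwy n))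
        (ae_restrict_of_ae hlim)
    refine le_of_tendsto_of_tendsto' (h1.mono_left Nat.hyperfilter_le_atTop)
      (tendsto_limPrim_sub hb s t) fun n => ?_
    obtain ⟨C, hC⟩ := hb t
    rw [setIntegral_Iic_sub hst (hC n).1]
    refine integral_mono_ae ?_ ((hC n).1.mono_set Ioc_subset_Iic_self) (ae_restrict_of_ae (hw n))
    exact Integrable.mono' ((hyi t).mono_set Ioc_subset_Iic_self) (hwm n).restrict
      (ae_restrict_of_ae (hwy n))
  -- Lebesgue differentiation of the increments. The indicator removes the arbitrary values of the
  -- representative off (0, ∞), so that the primitive from 0 makes sense on the whole line.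
  have hge : ∀ᵐ s ∂halfLine, |y s| ≤ S x s := by
    have hli : LocallyIntegrable ((Ioi (0 : ℝ)).indicator fun s => |y s|) volume := by
      rw [locallyIntegrable_iff]
      intro K hK
      obtain ⟨t, ht⟩ := hK.bddAbove
      have h1 := hyi t
      rw [IntegrableOn, Measure.restrict_restrict measurableSet_Iic, inter_comm,
        ← Measure.restrict_restrict measurableSet_Ioi] at h1
      have h2 := (integrable_indicator_iff measurableSet_Ioi).2 h1
      exact h2.mono_measure (Measure.restrict_mono (fun s hs => ht hs) le_rfl)
    have hii : ∀ a b, IntervalIntegrable ((Ioi (0 : ℝ)).indicator fun s => |y s|) volume a b :=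
      fun a b => intervalIntegrable_iff.2
        ((LocallyIntegrable.integrableOn_isCompact hli isCompact_uIcc).mono_set uIoc_subset_uIcc)
    filter_upwards [ae_restrict_of_ae (_root_.LocallyIntegrable.ae_hasDerivAt_integral hli),
      derivLim_ae fun n => T n x, ae_restrict_of_ae (ae_differentiableAt_limPrim hb), ae_restrict_mem measurableSet_Ioi]
      with s h1 h2 h3 h4
    rw [hSd x, h2]
    have h5 := h1 0
    rw [indicator_of_mem h4] at h5
    refine hasDerivAt_le_of_right h5 h3.hasDerivAt fun t ht => ?_
    refine le_trans (le_of_eq ?_) (hle s t ht.le)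
    rw [intervalIntegral.integral_interval_sub_left (hii _ _) (hii _ _),
      intervalIntegral.integral_of_le ht.le,
      halfLine_restrict_Ioc (le_of_lt h4)]
    refine setIntegral_congr_fun measurableSet_Ioc fun r hr => ?_
    exact indicator_of_mem (lt_trans h4 hr.1) _
  -- The limit operator only takes `x` above |y|; multiplication by a factor of modulus at most one
  -- gives `y` itself.
  obtain ⟨M, hM, hMle⟩ := exists_mul_eq (x := S x) (y := y) (by
    filter_upwards [hge] with s hs
    rw [Real.enorm_eq_ofReal_abs, Real.enorm_eq_ofReal_abs]
    exact ENNReal.ofReal_le_ofReal (hs.trans (le_abs_self _)))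
  exact ⟨_, IsContraction.mul hY hS hMle, hM⟩

end Orbits

/-! ### Operators of the form `h ↦ ∑ᵢ (average of σ h over Pᵢ) 1_{Qᵢ}` -/

section StepOperators

/-- The average of `σ h` over `P`. -/
def avgOn (σ : ℝ → ℝ) (P : Set ℝ) (h : L0) : ℝ :=
  (halfLine P).toReal⁻¹ * ∫ s in P, σ s * h s ∂halfLine

variable {σ : ℝ → ℝ} {P : Set ℝ}

theorem integrableOn_mul (hσ : AEStronglyMeasurable σ halfLine) (hσ1 : ∀ s, |σ s| ≤ 1) {h : L0}
    (hh : h ∈ coupleL.sum) (hP : halfLine P < ∞) :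
    IntegrableOn (fun s => σ s * h s) P halfLine :=
  (integrableOn_of_mem_sum hh hP).bdd_mul hσ.restrict (c := 1) (Eventually.of_forall hσ1)

theorem avgOn_add (hσ : AEStronglyMeasurable σ halfLine) (hσ1 : ∀ s, |σ s| ≤ 1) {h k : L0}
    (hh : h ∈ coupleL.sum) (hk : k ∈ coupleL.sum) (hP : halfLine P < ∞) :
    avgOn σ P (h + k) = avgOn σ P h + avgOn σ P k := by
  rw [avgOn, avgOn, avgOn, ← mul_add,
    ← integral_add (integrableOn_mul hσ hσ1 hh hP) (integrableOn_mul hσ hσ1 hk hP)]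
  congr 1
  refine integral_congr_ae (ae_restrict_of_ae ?_)
  filter_upwards [AEEqFun.coeFn_add h k] with s hs
  rw [hs, Pi.add_apply, mul_add]

theorem avgOn_smul (c : ℝ) (h : L0) : avgOn σ P (c • h) = c * avgOn σ P h := by
  rw [avgOn, avgOn, mul_left_comm, ← integral_const_mul c]
  congr 1
  refine integral_congr_ae (ae_restrict_of_ae ?_)
  filter_upwards [AEEqFun.coeFn_smul c h] with s hs
  rw [hs, Pi.smul_apply, smul_eq_mul]
  ring

theorem enorm_avgOn_le (hσ1 : ∀ s, |σ s| ≤ 1) (hP : halfLine P < ∞) (h : L0) :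
    ‖avgOn σ P h‖ₑ ≤ (∫⁻ s in P, ‖h s‖ₑ ∂halfLine) / halfLine P := by
  rcases eq_or_ne (halfLine P) 0 with h0 | h0
  · simp [avgOn, h0]
  · rw [avgOn, enorm_mul, enorm_inv (ENNReal.toReal_pos h0 hP.ne).ne',
      Real.enorm_eq_ofReal ENNReal.toReal_nonneg, ENNReal.ofReal_toReal hP.ne, mul_comm,
      ENNReal.div_eq_inv_mul, mul_comm]
    gcongr
    refine (enorm_integral_le_lintegral_enorm _).trans (lintegral_mono fun s => ?_)
    rw [enorm_mul]
    refine mul_le_of_le_one_left zero_le ?_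
    rw [Real.enorm_eq_ofReal_abs, ENNReal.ofReal_le_one]
    exact hσ1 s

theorem enorm_avgOn_le_of_ae (hσ1 : ∀ s, |σ s| ≤ 1) (hP : halfLine P < ∞) {h : L0} {C : ℝ≥0∞}
    (hC : ∀ᵐ s ∂halfLine.restrict P, ‖h s‖ₑ ≤ C) : ‖avgOn σ P h‖ₑ ≤ C := by
  refine (enorm_avgOn_le hσ1 hP h).trans (ENNReal.div_le_of_le_mul ?_)
  refine (lintegral_mono_ae hC).trans ?_
  rw [setLIntegral_const]

theorem le_avgOn (hσ : AEStronglyMeasurable σ halfLine) (hσ1 : ∀ s, |σ s| ≤ 1) {h : L0}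
    (hh : h ∈ coupleL.sum) (hP : halfLine P < ∞) (hP0 : 0 < halfLine P) {c : ℝ}
    (hc : ∀ᵐ s ∂halfLine.restrict P, c ≤ σ s * h s) : c ≤ avgOn σ P h := by
  have hpos : 0 < (halfLine P).toReal := ENNReal.toReal_pos hP0.ne' hP.ne
  rw [avgOn, ← div_eq_inv_mul, le_div_iff₀ hpos]
  have := setIntegral_mono_ae_restrict (μ := halfLine) (s := P) (f := fun _ => c)
    (integrableOn_const hP.ne) (integrableOn_mul hσ hσ1 hh hP) hc
  rwa [setIntegral_const, smul_eq_mul, measureReal_def, mul_comm] at this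

/-- The operator taking `h` to the function equal to the average of `σ h` over `P i` on
`κ ⁻¹' {i}`. -/
def stepLin (X : BanachCouple L0) (hX : X.sum ≤ coupleL.sum) (κ : ℝ → ℕ) (hκ : Measurable κ)
    (P : ℕ → Set ℝ) (hP : ∀ i, halfLine (P i) < ∞) (σ : ℝ → ℝ)
    (hσ : AEStronglyMeasurable σ halfLine) (hσ1 : ∀ s, |σ s| ≤ 1) : X.sum →ₗ[ℝ] L0 :=
  linOfRep (V := X.sum) (fun h s => avgOn σ (P (κ s)) h)
    (fun h => ((measurable_from_top (f := fun i => avgOn σ (P i) h)).comp hκ).aestronglyMeasurable)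
    (fun h k => Eventually.of_forall fun _ => avgOn_add hσ hσ1 (hX h.2) (hX k.2) (hP _))
    (fun c h => Eventually.of_forall fun _ => avgOn_smul c (h : L0))

theorem stepLin_ae {X : BanachCouple L0} {hX : X.sum ≤ coupleL.sum} {κ : ℝ → ℕ}
    {hκ : Measurable κ} {P : ℕ → Set ℝ} {hP : ∀ i, halfLine (P i) < ∞} {σ : ℝ → ℝ}
    {hσ : AEStronglyMeasurable σ halfLine} {hσ1 : ∀ s, |σ s| ≤ 1} (h : X.sum) :
    stepLin X hX κ hκ P hP σ hσ hσ1 h =ᵐ[halfLine] fun s => avgOn σ (P (κ s)) h :=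
  linOfRep_ae _ _ _ _ h

theorem nrm_top_stepLin_le {X : BanachCouple L0} {hX : X.sum ≤ coupleL.sum} {κ : ℝ → ℕ}
    {hκ : Measurable κ} {P : ℕ → Set ℝ} {hP : ∀ i, halfLine (P i) < ∞} {σ : ℝ → ℝ}
    {hσ : AEStronglyMeasurable σ halfLine} {hσ1 : ∀ s, |σ s| ≤ 1} (h : X.sum) :
    (lebesgue ∞).nrm (stepLin X hX κ hκ P hP σ hσ hσ1 h) ≤ (lebesgue ∞).nrm h := by
  refine nrm_top_le ?_
  filter_upwards [stepLin_ae (hκ := hκ) (hP := hP) (hσ := hσ) (hσ1 := hσ1) (hX := hX) h] with s hs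
  rw [hs]
  exact enorm_avgOn_le_of_ae hσ1 (hP _) (ae_restrict_of_ae (ae_le_nrm_top _))

/-- The sign of `f`. -/
def signOf (f : L0) (s : ℝ) : ℝ := f s / |f s|

theorem aestronglyMeasurable_signOf (f : L0) : AEStronglyMeasurable (signOf f) halfLine :=
  (f.measurable.div f.measurable.abs).aestronglyMeasurable

theorem abs_signOf_le (f : L0) (s : ℝ) : |signOf f s| ≤ 1 := by
  rw [signOf, abs_div, abs_abs]
  exact div_self_le_one _

theorem signOf_mul (f : L0) (s : ℝ) : signOf f s * f s = |f s| := by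
  rw [signOf]
  rcases eq_or_ne (f s) 0 with h | h
  · simp [h]
  · field_simp
    exact (sq_abs _).symm

end StepOperators

/-! ### The least decreasing majorant is in the orbit of a function -/

section Majorant

/-- Cut at height `c`: the excess over `c` is again decreasing, so integrability puts it in L̃¹, and
what is left is bounded by `c`. -/
theorem mem_tilde_sum_of_antitone {u : L0} {q : ℝ → ℝ≥0∞} (hq : Antitone q)
    (hu : ∀ᵐ s ∂halfLine, u s = (q s).toReal) (hfin : ∀ s, 0 < s → q s < ∞) {c : ℝ≥0∞}
    (hc : c < ∞) (hint : ∫⁻ s, (q s - c) ∂halfLine < ∞) : u ∈ coupleTildeL.sum := by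
  have hm := hq.measurable
  have m0 : Measurable fun x => (q x - c).toReal := (hm.sub_const c).ennreal_toReal
  have m1 : Measurable fun x => (min (q x) c).toReal := (hm.min measurable_const).ennreal_toReal
  refine Submodule.mem_sup.2 ⟨AEEqFun.mk _ m0.aestronglyMeasurable, ?_,
    AEEqFun.mk _ m1.aestronglyMeasurable, ?_, AEEqFun.ext ?_⟩
  · refine lt_of_le_of_lt (tildeNorm_le_of_antitoneOn (q := fun s => q s - c) ?_ ?_) hint
    · exact Antitone.antitoneOn (fun s t hst => tsub_le_tsub_right (hq hst) c) _
    · filter_upwards [AEEqFun.coeFn_mk (μ := halfLine) _ m0.aestronglyMeasurable] with s hs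
      rw [hs, Real.enorm_eq_ofReal ENNReal.toReal_nonneg]
      exact ENNReal.ofReal_toReal_le
  · refine lt_of_le_of_lt (nrm_top_le (C := c) ?_) hc
    filter_upwards [AEEqFun.coeFn_mk (μ := halfLine) _ m1.aestronglyMeasurable] with s hs
    rw [hs, Real.enorm_eq_ofReal ENNReal.toReal_nonneg]
    exact ENNReal.ofReal_toReal_le.trans (min_le_right _ _)
  · filter_upwards [AEEqFun.coeFn_mk (μ := halfLine) _ m0.aestronglyMeasurable,
      AEEqFun.coeFn_mk (μ := halfLine) _ m1.aestronglyMeasurable, hu, AEEqFun.coeFn_add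
        (AEEqFun.mk (μ := halfLine) _ m0.aestronglyMeasurable)
        (AEEqFun.mk (μ := halfLine) _ m1.aestronglyMeasurable),
      ae_restrict_mem measurableSet_Ioi] with s h0 h1 h2 h3 h4
    have hx := hfin s h4
    rw [h3, Pi.add_apply, h0, h1, h2,
      ← ENNReal.toReal_add (tsub_le_self.trans_lt hx).ne ((min_le_left _ _).trans_lt hx).ne]
    congr 1
    rcases le_total (q s) c with h | h
    · rw [min_eq_left h, tsub_eq_zero_of_le h, zero_add]
    · rw [min_eq_right h, tsub_add_cancel_of_le h]

theorem ldm_ae (f : L0) : ldm f =ᵐ[halfLine] fun s => (ldmE f s).toReal :=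
  AEEqFun.coeFn_mk _ _

theorem ldm_mem_tilde_sum {f : L0} (hf : f ∈ coupleTildeL.sum) : ldm f ∈ coupleTildeL.sum := by
  obtain ⟨f₀, h₀, f₁, h₁, e⟩ := Submodule.mem_sup.1 hf
  refine mem_tilde_sum_of_antitone (ldmE_antitone f) (ldm_ae f) (fun s hs => ldmE_lt_top hf hs)
    (c := (lebesgue ∞).nrm f₁) h₁ (lt_of_le_of_lt (lintegral_mono fun x => ?_)
      (show tildeNorm f₀ < ∞ from h₀))
  rw [tsub_le_iff_right, ← e]
  exact (ldmE_add_le f₀ f₁ x).trans (by gcongr; exact ldmE_le_nrm_top f₁ x)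

/-- These are the sets over which averages of |f| are nearly f̃(t). An essential supremum need not
be attained, hence `θ < 1`; finite measure makes the averages meaningful. -/
theorem exists_subset_near_ldmE (f : L0) {t : ℝ} (ht : 0 < t) (hf : ldmE f t < ∞) {θ : ℝ≥0∞}
    (hθ : θ < 1) : ∃ P ⊆ Ici t, MeasurableSet P ∧ 0 < halfLine P ∧ halfLine P < ∞ ∧
      ∀ s ∈ P, θ * ldmE f t ≤ ‖f s‖ₑ := by
  have hD : MeasurableSet (Ici t ∩ {s | θ * ldmE f t ≤ ‖f s‖ₑ}) :=
    measurableSet_Ici.inter (measurableSet_le measurable_const f.measurable.enorm)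
  have hpos : 0 < halfLine (Ici t ∩ {s | θ * ldmE f t ≤ ‖f s‖ₑ}) := by
    rw [pos_iff_ne_zero]
    intro h0
    have h1 : ldmE f t ≤ θ * ldmE f t := by
      refine essSup_le_of_ae_le _ ?_
      rw [EventuallyLE, ae_restrict_iff' measurableSet_Ici]
      filter_upwards [measure_eq_zero_iff_ae_notMem.1 h0] with s hs hst
      by_contra hlt
      exact hs ⟨hst, (not_le.1 hlt).le⟩
    -- If the set were null then f̃(t) ≤ θ f̃(t), so f̃(t) = 0. But then the set is all of [t, ∞),
    -- which is not null.
    have h2 : ldmE f t = 0 := by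
      by_contra hne
      have h3 := ENNReal.mul_lt_mul_left hne hf.ne hθ
      rw [one_mul] at h3
      exact absurd h1 h3.not_ge
    rw [h2, mul_zero] at h0
    have h3 : halfLine (Ioc t (t + 1)) ≤ 0 := by
      rw [← h0]
      exact measure_mono fun s hs => ⟨hs.1.le, by simp⟩
    rw [halfLine_Ioc ht.le] at h3
    simp at h3
  obtain ⟨P, hPm, hPs, hP0, hPt⟩ := Measure.exists_subset_measure_lt_top hD hpos
  exact ⟨P, hPs.trans inter_subset_left, hPm, hP0, hPt, fun s hs => (hPs hs).2⟩

/-- On a cell with right end r, put the average of sign(f)·h over a subset of [r, ∞) where |f| is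
nearly f̃(r). For h = f the value is nearly f̃(r). For any h it is at most h̃(r), hence at most h̃
on the cell, so h̃ itself majorizes the image. The sets may overlap and have any measure, so nothing
similar is claimed on L¹. -/
theorem orbit_ldm (f : coupleTildeL.sum) : Orbit coupleTildeL coupleTildeL f (ldm f) := by
  set θ : ℕ → ℝ := fun n => 1 - 1 / ((n : ℝ) + 1) with hθ
  have hθ0 : ∀ n, 0 ≤ θ n := fun n => by
    have : 1 / ((n : ℝ) + 1) ≤ 1 := by
      rw [div_le_one (by positivity)]
      linarith [(n.cast_nonneg : (0 : ℝ) ≤ n)]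
    simp only [hθ]
    linarith
  have hθ1 : ∀ n, θ n < 1 := fun n => by
    have : 0 < 1 / ((n : ℝ) + 1) := by positivity
    simp only [hθ]
    linarith
  have hθlim : Tendsto θ atTop (𝓝 1) := by
    have := (tendsto_const_nhds (x := (1 : ℝ))).sub
      (tendsto_one_div_add_atTop_nhds_zero_nat (𝕜 := ℝ))
    rwa [sub_zero] at this
  have hex : ∀ n i : ℕ, ∃ P ⊆ Ici ((i : ℝ) / (n + 1 : ℕ)), MeasurableSet P ∧ halfLine P < ∞ ∧
      (0 < i → 0 < halfLine P ∧ ∀ s ∈ P,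
        ENNReal.ofReal (θ n) * ldmE f ((i : ℝ) / (n + 1 : ℕ)) ≤ ‖(f : L0) s‖ₑ) := by
    intro n i
    rcases Nat.eq_zero_or_pos i with rfl | hi
    -- Index 0 is never met on (0, ∞), so any set will do.
    · exact ⟨∅, empty_subset _, MeasurableSet.empty, by simp, fun h => absurd h (lt_irrefl 0)⟩
    · have ht : 0 < (i : ℝ) / (n + 1 : ℕ) := by positivity
      obtain ⟨P, h1, h2, h3, h4, h5⟩ := exists_subset_near_ldmE f ht (ldmE_lt_top f.2 ht)
        (θ := ENNReal.ofReal (θ n)) (by simpa using hθ1 n)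
      exact ⟨P, h1, h2, h4, fun _ => ⟨h3, h5⟩⟩
  choose P hPs hPm hPt hP using hex
  let T : ℕ → coupleTildeL.sum →ₗ[ℝ] L0 := fun n =>
    stepLin coupleTildeL tilde_sum_le (fun s => ⌈s * (n + 1 : ℕ)⌉₊) (measurable_comp_ceil (n + 1) id)
      (P n) (hPt n) (signOf f) (aestronglyMeasurable_signOf f) (abs_signOf_le f)
  have hTae : ∀ n h, T n h =ᵐ[halfLine] fun s => avgOn (signOf f) (P n ⌈s * (n + 1 : ℕ)⌉₊) h :=
    fun n h => stepLin_ae h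
  refine orbit_of_approx isFunctionCouple_coupleTildeL (T := T) (fun n => ⟨fun h => ?_, fun h => ?_⟩)
    (ldm_mem_tilde_sum f.2) (w := fun n s => θ n * (ldmE f (gridUp (n + 1) s)).toReal)
    (fun n => ?_) (fun n => ?_) (fun n => ?_) ?_
  · refine tildeNorm_le_of_antitoneOn ((ldmE_antitone h).antitoneOn _) ?_
    filter_upwards [hTae n h] with s hs
    rw [hs]
    refine (enorm_avgOn_le_of_ae (abs_signOf_le f) (hPt n _) ?_).trans
      (ldmE_antitone h (le_gridUp n.succ_pos s))
    have h1 : ∀ᵐ y ∂halfLine.restrict (Ici (gridUp (n + 1) s)),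
        ‖(h : L0) y‖ₑ ≤ ldmE h (gridUp (n + 1) s) := ENNReal.ae_le_essSup _
    exact ae_mono (Measure.restrict_mono (hPs n _) le_rfl) h1
  · exact nrm_top_stepLin_le h
  · exact ((measurable_comp_ceil (n + 1) fun i =>
      (ldmE f ((i : ℝ) / (n + 1 : ℕ))).toReal).const_mul _).aestronglyMeasurable
  · filter_upwards [hTae n f, ae_restrict_mem measurableSet_Ioi] with s hs hs0
    rw [hs]
    have hi : 0 < ⌈s * (n + 1 : ℕ)⌉₊ := Nat.ceil_pos.2 (mul_pos hs0 (by positivity))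
    have hg : 0 < gridUp (n + 1) s := lt_of_lt_of_le hs0 (le_gridUp n.succ_pos s)
    refine le_avgOn (aestronglyMeasurable_signOf f) (abs_signOf_le f) (tilde_sum_le f.2) (hPt n _)
      (hP n _ hi).1 (ae_restrict_of_forall_mem (hPm n _) fun y hy => ?_)
    have := (hP n _ hi).2 y hy
    rw [signOf_mul, ← ENNReal.ofReal_le_ofReal_iff (abs_nonneg _), ← Real.enorm_eq_ofReal_abs,
      ENNReal.ofReal_mul (hθ0 n), ENNReal.ofReal_toReal (ldmE_lt_top f.2 hg).ne]
    exact this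
  · filter_upwards [ldm_ae f, ae_restrict_mem measurableSet_Ioi] with s hs hs0
    rw [hs, abs_of_nonneg (mul_nonneg (hθ0 n) ENNReal.toReal_nonneg),
      abs_of_nonneg ENNReal.toReal_nonneg]
    exact (mul_le_of_le_one_left ENNReal.toReal_nonneg (hθ1 n).le).trans
      (ENNReal.toReal_mono (ldmE_lt_top f.2 hs0).ne (ldmE_antitone _ (le_gridUp n.succ_pos s)))
  · filter_upwards [ldm_ae f, ae_restrict_mem measurableSet_Ioi,
      ae_tendsto_comp_gridUp (ldmE_antitone f)] with s hs hs0 hlim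
    rw [hs, abs_of_nonneg ENNReal.toReal_nonneg]
    have h1 := (ENNReal.tendsto_toReal (ldmE_lt_top f.2 hs0).ne).comp
      (hlim.comp (tendsto_add_atTop_nat 1))
    simpa using hθlim.mul h1

end Majorant

/-! ### Averaging over an interval -/

section Averaging

/-- Replace `h` by its average on `(a, b]`. -/
def avgFun (a b : ℝ) (h : L0) (s : ℝ) : ℝ :=
  open Classical in if s ∈ Ioc a b then avgOn (fun _ => 1) (Ioc a b) h else h s

/-- Replace `q` by its average on `(a, b]`. -/
def avgE (a b : ℝ) (q : ℝ → ℝ≥0∞) (s : ℝ) : ℝ≥0∞ :=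
  open Classical in
  if s ∈ Ioc a b then (∫⁻ y in Ioc a b, q y ∂halfLine) / ENNReal.ofReal (b - a) else q s

variable {a b : ℝ}

theorem halfLine_Ioc_lt_top (ha : 0 ≤ a) (b : ℝ) : halfLine (Ioc a b) < ∞ := by
  rw [halfLine_Ioc ha]
  exact ENNReal.ofReal_lt_top

theorem lintegral_avgE_le (ha : 0 ≤ a) (hab : a < b) (q : ℝ → ℝ≥0∞) :
    ∫⁻ s, avgE a b q s ∂halfLine ≤ ∫⁻ s, q s ∂halfLine := by
  have h0 : ENNReal.ofReal (b - a) ≠ 0 := by simpa using hab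
  rw [← lintegral_add_compl _ (measurableSet_Ioc (a := a) (b := b)),
    ← lintegral_add_compl q (measurableSet_Ioc (a := a) (b := b))]
  refine add_le_add ?_ ?_
  · rw [setLIntegral_congr_fun (f := avgE a b q) (g := fun _ => (∫⁻ y in Ioc a b, q y ∂halfLine) /
      ENNReal.ofReal (b - a)) measurableSet_Ioc fun s hs => if_pos hs, setLIntegral_const,
      halfLine_Ioc ha, ENNReal.div_mul_cancel h0 ENNReal.ofReal_ne_top]
  · exact le_of_eq (setLIntegral_congr_fun measurableSet_Ioc.compl fun s hs => if_neg hs)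

/-- The average over (a, b] lies between the values of `q` to the left and to the right of the
interval. -/
theorem antitoneOn_avgE (ha : 0 ≤ a) (hab : a < b) {q : ℝ → ℝ≥0∞} (hq : Antitone q) :
    AntitoneOn (avgE a b q) (Ioi 0) := by
  have h0 : ENNReal.ofReal (b - a) ≠ 0 := by simpa using hab
  intro s _ t _ hst
  by_cases h1 : s ∈ Ioc a b <;> by_cases h2 : t ∈ Ioc a b
  · simp [avgE, h1, h2]
  · have hb : b < t := by
      by_contra hle
      exact h2 ⟨h1.1.trans_le hst, not_lt.1 hle⟩
    simp only [avgE, h1, h2, if_true, if_false]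
    rw [ENNReal.le_div_iff_mul_le (Or.inl h0) (Or.inl ENNReal.ofReal_ne_top), ← halfLine_Ioc ha,
      ← setLIntegral_const]
    exact setLIntegral_mono hq.measurable fun y hy => hq (hy.2.trans hb.le)
  · have hb : s ≤ a := by
      by_contra hle
      exact h1 ⟨not_le.1 hle, hst.trans h2.2⟩
    simp only [avgE, h1, h2, if_true, if_false]
    refine ENNReal.div_le_of_le_mul ?_
    rw [← halfLine_Ioc ha, ← setLIntegral_const]
    exact setLIntegral_mono measurable_const fun y hy => hq (hb.trans hy.1.le)
  · simpa [avgE, h1, h2] using hq hst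

theorem avgE_mono {q r : ℝ → ℝ≥0∞} (h : ∀ᵐ s ∂halfLine, q s ≤ r s) :
    ∀ᵐ s ∂halfLine, avgE a b q s ≤ avgE a b r s := by
  filter_upwards [h] with s hs
  unfold avgE
  split_ifs
  · exact ENNReal.div_le_div_right (lintegral_mono_ae (ae_restrict_of_ae h)) _
  · exact hs

theorem enorm_avgFun_le (ha : 0 ≤ a) (h : L0) (s : ℝ) :
    ‖avgFun a b h s‖ₑ ≤ avgE a b (fun y => ‖h y‖ₑ) s := by
  unfold avgFun avgE
  split_ifs
  · rw [← halfLine_Ioc ha]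
    exact enorm_avgOn_le (fun _ => by simp) (halfLine_Ioc_lt_top ha b) h
  · exact le_rfl

theorem measurable_avgFun (h : L0) : Measurable (avgFun a b h) :=
  open Classical in Measurable.ite measurableSet_Ioc measurable_const h.measurable

/-- Averaging over an interval, as an operator. -/
theorem exists_avgLin {Y : BanachCouple L0} (hY : IsFunctionCouple Y) (ha : 0 ≤ a) :
    ∃ T : Y.sum →ₗ[ℝ] L0, ∀ h, T h =ᵐ[halfLine] avgFun a b h := by
  refine ⟨linOfRep (V := Y.sum) (fun h => avgFun a b h)
    (fun h => (measurable_avgFun _).aestronglyMeasurable) (fun h k => ?_) (fun c h => ?_),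
    fun h => linOfRep_ae _ _ _ _ h⟩
  · filter_upwards [AEEqFun.coeFn_add (h : L0) k] with s hs
    rw [Submodule.coe_add, Pi.add_apply]
    unfold avgFun
    split_ifs
    · exact avgOn_add aestronglyMeasurable_const (fun _ => by simp) (hY.sum_le h.2)
        (hY.sum_le k.2) (halfLine_Ioc_lt_top ha b)
    · exact hs
  · filter_upwards [AEEqFun.coeFn_smul c (h : L0)] with s hs
    rw [Submodule.coe_smul, Pi.smul_apply]
    unfold avgFun
    split_ifs
    · exact avgOn_smul c _
    · exact hs

/-- The couple is invariant under averaging over intervals. -/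
def AveragingContracts (Y : BanachCouple L0) : Prop :=
  ∀ a b : ℝ, 0 ≤ a → a < b → ∀ h k : L0, k =ᵐ[halfLine] avgFun a b h → Y.X₀.nrm k ≤ Y.X₀.nrm h

theorem averagingContracts_coupleL : AveragingContracts coupleL := by
  intro a b ha hab h k hk
  show (lebesgue 1).nrm k ≤ (lebesgue 1).nrm h
  rw [nrm_one_eq, nrm_one_eq]
  refine (lintegral_mono_ae ?_).trans (lintegral_avgE_le ha hab _)
  filter_upwards [hk] with s hs
  rw [hs]
  exact enorm_avgFun_le ha h s

/-- Averaging h̃ in place of |h| gives a decreasing majorant of the image, and averaging does not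
increase the integral. -/
theorem averagingContracts_coupleTildeL : AveragingContracts coupleTildeL := by
  intro a b ha hab h k hk
  refine (tildeNorm_le_of_antitoneOn (antitoneOn_avgE ha hab (ldmE_antitone h)) ?_).trans
    (lintegral_avgE_le ha hab _)
  filter_upwards [hk, avgE_mono (a := a) (b := b) (ae_le_ldmE h)] with s hs hs'
  rw [hs]
  exact (enorm_avgFun_le ha h s).trans hs'

theorem exists_avg_isContraction {Y : BanachCouple L0} (hY : IsFunctionCouple Y)
    (hA : AveragingContracts Y) (ha : 0 ≤ a) (hab : a < b) :
    ∃ T : Y.sum →ₗ[ℝ] L0, IsContraction Y Y T ∧ ∀ h, T h =ᵐ[halfLine] avgFun a b h := by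
  obtain ⟨T, hT⟩ := exists_avgLin (b := b) hY ha
  refine ⟨T, ⟨fun h => hA a b ha hab _ _ (hT h), fun h => ?_⟩, hT⟩
  rw [hY.top]
  refine nrm_top_le ?_
  filter_upwards [hT h, ae_le_nrm_top (h : L0)] with s hs hs'
  rw [hs]
  unfold avgFun
  split_ifs
  · exact enorm_avgOn_le_of_ae (fun _ => by simp) (halfLine_Ioc_lt_top ha b)
      (ae_restrict_of_ae (ae_le_nrm_top _))
  · exact hs'

end Averaging

/-! ### Antitone functions with ordered primitives -/

section Antitone

theorem intervalIntegrable_of_mem_sum {U : L0} (hU : U ∈ coupleL.sum) {u : ℝ → ℝ}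
    (h : U =ᵐ[halfLine] u) {a b : ℝ} (ha : 0 ≤ a) (hb : 0 ≤ b) :
    IntervalIntegrable u volume a b := by
  have key : ∀ {a b : ℝ}, 0 ≤ a → IntegrableOn u (Ioc a b) volume := fun {a b} ha => by
    rw [IntegrableOn, ← halfLine_restrict_Ioc ha]
    exact (integrableOn_of_mem_sum hU (halfLine_Ioc_lt_top ha b)).congr (ae_restrict_of_ae h)
  exact ⟨key ha, key hb⟩

/-- Either `u` stays above `c` beyond `a`, or some interval `(a, b]` with `b ≥ d` has average `c`. -/
theorem le_or_exists_average_eq {u : ℝ → ℝ} {a d c : ℝ} (ha : 0 ≤ a) (had : a < d)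
    (hu : AntitoneOn u (Ioi 0))
    (hui : ∀ a b : ℝ, 0 ≤ a → 0 ≤ b → IntervalIntegrable u volume a b)
    (h : c * (d - a) ≤ ∫ s in a..d, u s) :
    (∀ s, a < s → c ≤ u s) ∨ ∃ b, d ≤ b ∧ ∫ s in a..b, u s = c * (b - a) := by
  by_cases hex : ∃ b, d ≤ b ∧ ∫ s in a..b, u s = c * (b - a)
  · exact Or.inr hex
  refine Or.inl fun s hs => ?_
  by_contra hlt
  rw [not_le] at hlt
  refine hex ?_
  -- The excess of ∫ u over (a, x] above that of the constant c is nonnegative at d. If u drops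
  -- below c at s, the excess decreases at least linearly beyond s, hence becomes nonpositive, and
  -- the intermediate value theorem gives b.
  set ψ : ℝ → ℝ := fun x => (∫ y in a..x, u y) - c * (x - a) with hψ
  have hs0 : 0 < s := ha.trans_lt hs
  have hdecr : ∀ x, s ≤ x → ψ x ≤ ψ s + (u s - c) * (x - s) := by
    intro x hx
    have h1 := intervalIntegral.integral_add_adjacent_intervals (hui a s ha hs0.le)
      (hui s x hs0.le (hs0.le.trans hx))
    have h2 : ∫ y in s..x, u y ≤ ∫ _ in s..x, u s := by
      refine intervalIntegral.integral_mono_on hx (hui s x hs0.le (hs0.le.trans hx))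
        intervalIntegrable_const fun y hy => hu hs0 (hs0.trans_le hy.1) hy.1
    rw [intervalIntegral.integral_const, smul_eq_mul] at h2
    simp only [hψ]
    rw [← h1]
    nlinarith
  set x := max d (s + (|ψ s| + 1) / (c - u s)) with hx
  have hcu : 0 < c - u s := sub_pos.2 hlt
  have hq : 0 ≤ (|ψ s| + 1) / (c - u s) := by positivity
  have hsx : s ≤ x := le_trans (by linarith) (le_max_right _ _)
  have hneg : ψ x ≤ 0 := by
    refine (hdecr x hsx).trans ?_
    have h1 : (|ψ s| + 1) / (c - u s) ≤ x - s := by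
      have := le_max_right d (s + (|ψ s| + 1) / (c - u s))
      linarith
    rw [div_le_iff₀ hcu] at h1
    nlinarith [le_abs_self (ψ s)]
  have hdx : d ≤ x := le_max_left _ _
  have hcont : ContinuousOn ψ (Icc d x) := by
    have h1 := intervalIntegral.continuousOn_primitive_interval' (a := a)
      (hui a x ha (hs0.le.trans hsx)) left_mem_uIcc
    rw [uIcc_of_le (had.le.trans hdx)] at h1
    exact (h1.mono (Icc_subset_Icc_left had.le)).sub (by fun_prop)
  obtain ⟨b, hb, hb0⟩ := intermediate_value_Icc' hdx hcont
    (show (0 : ℝ) ∈ Icc (ψ x) (ψ d) from ⟨hneg, by simp only [hψ]; linarith⟩)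
  refine ⟨b, hb.1, ?_⟩
  simp only [hψ] at hb0
  linarith

/-- Averages of an antitone function separate its values on both sides. -/
theorem antitoneOn_ite_average {u : ℝ → ℝ} {a b c : ℝ} (ha : 0 ≤ a) (hab : a < b)
    (hu : AntitoneOn u (Ioi 0))
    (hui : ∀ a b : ℝ, 0 ≤ a → 0 ≤ b → IntervalIntegrable u volume a b)
    (hc : ∫ s in a..b, u s = c * (b - a)) :
    AntitoneOn (open Classical in fun s => if s ∈ Ioc a b then c else u s) (Ioi 0) := by
  have hint := hui a b ha (ha.trans hab.le)
  have hle : ∀ s, 0 < s → s ≤ a → c ≤ u s := by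
    intro s hs hsa
    have h2 : ∫ y in a..b, u y ≤ ∫ _ in a..b, u s := by
      refine intervalIntegral.integral_mono_on_of_le_Ioo hab.le hint intervalIntegrable_const
        fun y hy => hu hs (hs.trans_le (hsa.trans hy.1.le)) (hsa.trans hy.1.le)
    rw [intervalIntegral.integral_const, smul_eq_mul, hc, mul_comm] at h2
    exact le_of_mul_le_mul_left h2 (sub_pos.2 hab)
  have hge : ∀ t, b < t → u t ≤ c := by
    intro t ht
    have h2 : ∫ _ in a..b, u t ≤ ∫ y in a..b, u y := by
      refine intervalIntegral.integral_mono_on_of_le_Ioo hab.le intervalIntegrable_const hint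
        fun y hy => hu (ha.trans_lt hy.1) (ha.trans_lt (hab.trans ht)) (hy.2.le.trans ht.le)
    rw [intervalIntegral.integral_const, smul_eq_mul, hc, mul_comm c] at h2
    exact le_of_mul_le_mul_left h2 (sub_pos.2 hab)
  intro s hs t ht hst
  by_cases h1 : s ∈ Ioc a b <;> by_cases h2 : t ∈ Ioc a b
  · simp [h1, h2]
  · simp only [h1, h2, if_true, if_false]
    refine hge t ?_
    by_contra hle'
    exact h2 ⟨h1.1.trans_le hst, not_lt.1 hle'⟩
  · simp only [h1, h2, if_true, if_false]
    refine hle s hs ?_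
    by_contra hle'
    exact h1 ⟨not_le.1 hle', hst.trans h2.2⟩
  · simpa [h1, h2] using hu hs ht hst

/-- Finitely many averages move an antitone function with larger primitive above a step function
on a bounded interval. -/
theorem exists_isContraction_step_le {Y : BanachCouple L0} (hY : IsFunctionCouple Y)
    (hA : AveragingContracts Y) {U : Y.sum} {u w : ℝ → ℝ} (hu : AntitoneOn u (Ioi 0))
    (hu0 : ∀ s, 0 < s → 0 ≤ u s) (hU : (U : L0) =ᵐ[halfLine] u) {c : ℕ → ℝ} {δ : ℝ} (hδ : 0 < δ)
    (hw : ∀ i : ℕ, ∀ s ∈ Ioc (i * δ) ((i + 1) * δ), w s = c i)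
    (hw' : ∀ i : ℕ, ∀ s, i * δ < s → w s ≤ c i) (hc0 : ∀ i, 0 ≤ c i)
    (hwi : ∀ a b : ℝ, 0 ≤ a → 0 ≤ b → IntervalIntegrable w volume a b)
    (h : ∀ t, 0 ≤ t → ∫ s in (0 : ℝ)..t, w s ≤ ∫ s in (0 : ℝ)..t, u s) (i : ℕ) :
    ∃ T : Y.sum →ₗ[ℝ] L0, IsContraction Y Y T ∧ ∃ u' : ℝ → ℝ, AntitoneOn u' (Ioi 0) ∧
      (∀ s, 0 < s → 0 ≤ u' s) ∧ T U =ᵐ[halfLine] u' ∧ (∀ s ∈ Ioc 0 (i * δ), w s ≤ u' s) ∧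
      ∀ t, i * δ ≤ t → ∫ s in (i * δ)..t, w s ≤ ∫ s in (i * δ)..t, u' s := by
  -- Invariant: the current function is above `w` on the first i cells, and its primitive started at
  -- iδ dominates that of `w`.
  induction i with
  | zero =>
    refine ⟨Y.sum.subtype, ⟨fun _ => le_rfl, fun _ => le_rfl⟩, u, hu, hu0, hU, fun s hs => ?_, ?_⟩
    · simp only [Nat.cast_zero, zero_mul, Ioc_self] at hs
      exact absurd hs (notMem_empty _)
    · simpa using h
  | succ i ih =>
    obtain ⟨T, hT, u', hu', hu0', hTU, hle, hint⟩ := ih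
    push_cast
    set a : ℝ := i * δ with hadef
    set d : ℝ := (i + 1) * δ with hd
    have ha : 0 ≤ a := by positivity
    have had : a < d := by rw [hadef, hd]; nlinarith
    have hd0 : 0 ≤ d := ha.trans had.le
    have hui : ∀ a b : ℝ, 0 ≤ a → 0 ≤ b → IntervalIntegrable u' volume a b := fun a b ha hb =>
      intervalIntegrable_of_mem_sum (hY.sum_le (hT.mem_sum U)) hTU ha hb
    have hwad : ∫ s in a..d, w s = c i * (d - a) := by
      rw [intervalIntegral.integral_of_le had.le, setIntegral_congr_fun measurableSet_Ioc
        (g := fun _ => c i) (hw i), ← intervalIntegral.integral_of_le had.le,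
        intervalIntegral.integral_const, smul_eq_mul, mul_comm]
    have hmono : ∀ {f : ℝ → ℝ} {s t : ℝ}, d ≤ s → s ≤ t → IntervalIntegrable f volume s t →
        (∀ y ∈ Ioo s t, c i ≤ f y) → ∫ y in s..t, w y ≤ ∫ y in s..t, f y := by
      intro f s t hds hst hf hcf
      exact intervalIntegral.integral_mono_on_of_le_Ioo hst
        (hwi s t (hd0.trans hds) (hd0.trans (hds.trans hst))) hf
        fun y hy => (hw' i y (had.trans_le (hds.trans hy.1.le))).trans (hcf y hy)
    -- If the current function stays above `c i`, nothing has to be done. Otherwise flatten it to `c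
    -- i` on some (a, b] that contains the cell (a, d]: this equals `w` on the cell and still
    -- dominates it up to `b`.
    rcases le_or_exists_average_eq ha had hu' hui (hwad ▸ hint d had.le) with hc | ⟨b, hdb, hb⟩
    · refine ⟨T, hT, u', hu', hu0', hTU, fun s hs => ?_, fun t ht => ?_⟩
      · rcases le_or_gt s a with hsa | hsa
        · exact hle s ⟨hs.1, hsa⟩
        · rw [hw i s ⟨hsa, hs.2⟩]
          exact hc s hsa
      · exact hmono le_rfl ht (hui d t hd0 (hd0.trans ht)) fun y hy => hc y (had.trans hy.1)
    · have hab : a < b := had.trans_le hdb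
      have hb0 : 0 ≤ b := ha.trans hab.le
      obtain ⟨S, hS, hSa⟩ := exists_avg_isContraction hY hA ha hab
      set u'' : ℝ → ℝ := open Classical in fun s => if s ∈ Ioc a b then c i else u' s with hu''
      have hin : ∀ s ∈ Ioc a b, u'' s = c i := fun s hs => if_pos hs
      have hout : ∀ s, s ∉ Ioc a b → u'' s = u' s := fun s hs => if_neg hs
      have havg : avgOn (fun _ => 1) (Ioc a b) (T U) = c i := by
        rw [avgOn, halfLine_Ioc ha, ENNReal.toReal_ofReal (sub_nonneg.2 hab.le),
          setIntegral_congr_ae (g := u') measurableSet_Ioc (by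
            filter_upwards [hTU] with s hs _
            rw [hs, one_mul]), halfLine_restrict_Ioc ha,
          ← intervalIntegral.integral_of_le hab.le, hb]
        have := sub_pos.2 hab
        field_simp
      have hae : S.comp (T.codRestrict Y.sum hT.mem_sum) U =ᵐ[halfLine] u'' := by
        filter_upwards [hSa ⟨T U, hT.mem_sum U⟩, hTU] with s h1 h2
        refine h1.trans ?_
        by_cases hs : s ∈ Ioc a b
        · rw [hin s hs, avgFun, if_pos hs, havg]
        · rw [hout s hs, avgFun, if_neg hs, h2]
      have hui' : ∀ a b : ℝ, 0 ≤ a → 0 ≤ b → IntervalIntegrable u'' volume a b := fun a b ha hb =>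
        intervalIntegrable_of_mem_sum (hY.sum_le ((hT.comp hS).mem_sum U)) hae ha hb
      refine ⟨_, hT.comp hS, u'', antitoneOn_ite_average ha hab hu' hui hb, fun s hs => ?_, hae,
        fun s hs => ?_, fun t ht => ?_⟩
      · by_cases hs' : s ∈ Ioc a b
        · rw [hin s hs']
          exact hc0 i
        · rw [hout s hs']
          exact hu0' s hs
      · rcases le_or_gt s a with hsa | hsa
        · rw [hout s fun hs' => absurd hs'.1 hsa.not_gt]
          exact hle s ⟨hs.1, hsa⟩
        · rw [hw i s ⟨hsa, hs.2⟩, hin s ⟨hsa, hs.2.trans hdb⟩]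
      · rcases le_or_gt t b with htb | htb
        · exact hmono le_rfl ht (hui' d t hd0 (hd0.trans ht)) fun y hy =>
            (hin y ⟨had.trans hy.1, hy.2.le.trans htb⟩).ge
        -- Beyond `b` the total over (a, t] is unchanged by the averaging, and both functions equal
        -- `c i` on (a, d], so the old inequality from `a` gives the new one from `d`.
        · have ht0 : 0 ≤ t := hd0.trans ht
          have e1 := intervalIntegral.integral_add_adjacent_intervals (hwi a d ha hd0)
            (hwi d t hd0 ht0)
          have e2 := intervalIntegral.integral_add_adjacent_intervals (hui a b ha hb0)
            (hui b t hb0 ht0)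
          have e3 := intervalIntegral.integral_add_adjacent_intervals (hui' d b hd0 hb0)
            (hui' b t hb0 ht0)
          have e4 : ∫ s in b..t, u'' s = ∫ s in b..t, u' s := by
            rw [intervalIntegral.integral_of_le htb.le, intervalIntegral.integral_of_le htb.le]
            exact setIntegral_congr_fun measurableSet_Ioc fun s hs =>
              hout s fun hs' => absurd hs'.2 hs.1.not_ge
          have e5 : ∫ s in d..b, u'' s = c i * (b - d) := by
            rw [intervalIntegral.integral_of_le hdb, setIntegral_congr_fun measurableSet_Ioc
              (g := fun _ => c i) fun s hs => hin s ⟨had.trans hs.1, hs.2⟩,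
              ← intervalIntegral.integral_of_le hdb, intervalIntegral.integral_const, smul_eq_mul,
              mul_comm]
          have e6 := hint t (had.le.trans ht)
          linarith

theorem setLIntegral_ne_top_of_mem_sum {U : L0} (hU : U ∈ coupleL.sum) {p : ℝ → ℝ≥0∞}
    (h : U =ᵐ[halfLine] fun s => (p s).toReal) (hfin : ∀ s, 0 < s → p s < ∞) (t : ℝ) :
    ∫⁻ s in Ioc 0 t, p s ∂halfLine ≠ ∞ := by
  have h1 := (integrableOn_of_mem_sum hU (halfLine_Ioc_lt_top le_rfl t)).congr
    (ae_restrict_of_ae h)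
  refine ne_top_of_le_ne_top h1.lintegral_lt_top.ne (lintegral_mono_ae ?_)
  filter_upwards [ae_restrict_of_ae (ae_restrict_mem measurableSet_Ioi)] with s hs
  rw [ENNReal.ofReal_toReal (hfin s hs).ne]

/-- For antitone functions, ordered primitives give an operator. -/
theorem orbit_of_antitone {Y : BanachCouple L0} (hY : IsFunctionCouple Y)
    (hA : AveragingContracts Y) {p q : ℝ → ℝ≥0∞} (hp : Antitone p) (hq : Antitone q)
    (hpf : ∀ s, 0 < s → p s < ∞) (hqf : ∀ s, 0 < s → q s < ∞) {U : Y.sum} {V : L0}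
    (hV : V ∈ Y.sum) (hUp : (U : L0) =ᵐ[halfLine] fun s => (p s).toReal)
    (hVq : V =ᵐ[halfLine] fun s => (q s).toReal)
    (h : ∀ t, 0 < t → ∫⁻ s in Ioc 0 t, q s ∂halfLine ≤ ∫⁻ s in Ioc 0 t, p s ∂halfLine) :
    Orbit Y Y U V := by
  have hanti : ∀ {r : ℝ → ℝ≥0∞}, Antitone r → (∀ s, 0 < s → r s < ∞) →
      AntitoneOn (fun s => (r s).toReal) (Ioi 0) := fun hr hf s hs t _ hst =>
    ENNReal.toReal_mono (hf s hs).ne (hr hst)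
  have hint : ∀ {r : ℝ → ℝ≥0∞}, Antitone r → (∀ s, 0 < s → r s < ∞) → ∀ t : ℝ, 0 ≤ t →
      ∫ s in (0 : ℝ)..t, (r s).toReal = (∫⁻ s in Ioc 0 t, r s ∂halfLine).toReal := by
    intro r hr hf t ht
    rw [intervalIntegral.integral_of_le ht, ← halfLine_restrict_Ioc le_rfl]
    refine integral_toReal hr.measurable.aemeasurable ?_
    filter_upwards [ae_restrict_of_ae (ae_restrict_mem measurableSet_Ioi)] with s hs
    exact hf s hs
  have hvi : ∀ a b : ℝ, 0 ≤ a → 0 ≤ b → IntervalIntegrable (fun s => (q s).toReal) volume a b :=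
    fun a b ha hb => intervalIntegrable_of_mem_sum (hY.sum_le hV) hVq ha hb
  have hgrid : ∀ (n : ℕ) (s : ℝ), 0 < s → (q (gridUp (n + 1) s)).toReal ≤ (q s).toReal :=
    fun n s hs => ENNReal.toReal_mono (hqf s hs).ne (hq (le_gridUp n.succ_pos s))
  have hgm : ∀ n : ℕ, Measurable fun s => (q (gridUp (n + 1) s)).toReal := fun n =>
    measurable_comp_ceil (n + 1) fun i => (q ((i : ℝ) / (n + 1 : ℕ))).toReal
  have hstep : ∀ n : ℕ, ∃ T : Y.sum →ₗ[ℝ] L0, IsContraction Y Y T ∧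
      ∀ᵐ s ∂halfLine, (Iic ((n : ℝ) + 1)).indicator (fun s => (q (gridUp (n + 1) s)).toReal) s ≤
        T U s := by
    intro n
    have hn : (0 : ℝ) < ((n + 1 : ℕ) : ℝ) := by positivity
    have hwi : ∀ a b : ℝ, 0 ≤ a → 0 ≤ b →
        IntervalIntegrable (fun s => (q (gridUp (n + 1) s)).toReal) volume a b := by
      intro a b ha hb
      refine (hvi a b ha hb).mono_fun (hgm n).aestronglyMeasurable ?_
      filter_upwards [ae_restrict_mem measurableSet_uIoc] with s hs
      have hs0 : 0 < s := (le_min ha hb).trans_lt hs.1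
      rw [Real.norm_of_nonneg ENNReal.toReal_nonneg, Real.norm_of_nonneg ENNReal.toReal_nonneg]
      exact hgrid n s hs0
    -- Sampling q at the right ends of cells of length 1/(n+1) gives a step function below q, so
    -- primitives remain ordered. Cell i ends at (i+1)/(n+1), and (n+1)² cells cover (0, n+1].
    obtain ⟨T, hT, u', -, hu0, hTU, hle, -⟩ := exists_isContraction_step_le hY hA (U := U)
      (u := fun s => (p s).toReal) (w := fun s => (q (gridUp (n + 1) s)).toReal)
      (c := fun i => (q (((i + 1 : ℕ) : ℝ) / (n + 1 : ℕ))).toReal) (δ := 1 / ((n + 1 : ℕ) : ℝ))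
      (hanti hp hpf) (fun _ _ => ENNReal.toReal_nonneg) hUp (by positivity)
      (fun i s hs => by
        have h1 : ⌈s * (n + 1 : ℕ)⌉₊ = i + 1 := by
          rw [mul_one_div, mul_one_div, mem_Ioc, div_lt_iff₀ hn, le_div_iff₀ hn] at hs
          rw [Nat.ceil_eq_iff (by simp)]
          push_cast at hs ⊢
          simpa using hs
        simp only [gridUp, h1])
      (fun i s hs => by
        rw [mul_one_div, div_lt_iff₀ hn] at hs
        have h1 : i + 1 ≤ ⌈s * (n + 1 : ℕ)⌉₊ := Nat.lt_ceil.2 hs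
        refine ENNReal.toReal_mono (hqf _ (by positivity)).ne (hq ?_)
        rw [gridUp]
        gcongr)
      (fun _ => ENNReal.toReal_nonneg) hwi
      (fun t ht => by
        refine (intervalIntegral.integral_mono_on_of_le_Ioo ht (hwi 0 t le_rfl ht)
          (hvi 0 t le_rfl ht) fun s hs => hgrid n s hs.1).trans ?_
        rw [hint hq hqf t ht, hint hp hpf t ht]
        rcases ht.eq_or_lt with rfl | ht'
        · simp
        · exact ENNReal.toReal_mono
            (setLIntegral_ne_top_of_mem_sum (hY.sum_le U.2) hUp hpf t) (h t ht'))
      ((n + 1) * (n + 1))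
    refine ⟨T, hT, ?_⟩
    filter_upwards [hTU, ae_restrict_mem measurableSet_Ioi] with s hs hs0
    rw [hs]
    by_cases hsn : s ∈ Iic ((n : ℝ) + 1)
    · rw [indicator_of_mem hsn]
      refine hle s ⟨hs0, hsn.trans (le_of_eq ?_)⟩
      push_cast
      field_simp
    · rw [indicator_of_notMem hsn]
      exact hu0 s hs0
  choose T hT hTU using hstep
  refine orbit_of_approx hY hT hV (fun n =>
    ((hgm n).indicator measurableSet_Iic).aestronglyMeasurable) hTU (fun n => ?_) ?_
  · filter_upwards [hVq, ae_restrict_mem measurableSet_Ioi] with s hs hs0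
    rw [hs]
    refine abs_le_abs_of_nonneg (indicator_nonneg (fun _ _ => ENNReal.toReal_nonneg) s) ?_
    exact (indicator_le_self' (fun _ _ => ENNReal.toReal_nonneg) s).trans (hgrid n s hs0)
  · filter_upwards [hVq, ae_restrict_mem measurableSet_Ioi, ae_tendsto_comp_gridUp hq]
      with s hs hs0 hlim
    rw [hs, abs_of_nonneg ENNReal.toReal_nonneg]
    refine ((ENNReal.tendsto_toReal (hqf s hs0).ne).comp
      (hlim.comp (tendsto_add_atTop_nat 1))).congr' ?_
    obtain ⟨N, hN⟩ := exists_nat_ge s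
    filter_upwards [eventually_ge_atTop N] with n hn
    have : s ∈ Iic ((n : ℝ) + 1) := by
      have : (N : ℝ) ≤ n := by exact_mod_cast hn
      rw [mem_Iic]
      linarith
    rw [indicator_of_mem this]
    rfl

end Antitone

/-! ### Functions with ordered distribution functions -/

section Transfer

/-- The measure of D ∩ (0, r] is 1-Lipschitz in r, so it takes all intermediate values. -/
theorem exists_subset_measure_eq {D : Set ℝ} (hD : MeasurableSet D) {m : ℝ≥0∞}
    (hm : m ≤ halfLine D) (hm' : m < ∞) : ∃ P ⊆ D, MeasurableSet P ∧ halfLine P = m := by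
  rcases hm.eq_or_lt with rfl | hlt
  · exact ⟨D, Subset.rfl, hD, rfl⟩
  have hfin : ∀ r : ℝ, halfLine (D ∩ Iic r) ≠ ∞ := fun r =>
    ne_top_of_le_ne_top (halfLine_Iic_lt_top r).ne (measure_mono inter_subset_right)
  set F : ℝ → ℝ := fun r => (halfLine (D ∩ Iic r)).toReal with hF
  have hLip : LipschitzWith 1 F := by
    refine LipschitzWith.of_le_add fun x y => ?_
    rcases le_total x y with hxy | hxy
    · refine (ENNReal.toReal_mono (hfin y) (measure_mono
        (inter_subset_inter_right D (Iic_subset_Iic.2 hxy)))).trans ?_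
      exact le_add_of_nonneg_right dist_nonneg
    · have h1 : halfLine (D ∩ Iic x) ≤ halfLine (D ∩ Iic y) + ENNReal.ofReal (x - y) := by
        calc halfLine (D ∩ Iic x) ≤ halfLine ((D ∩ Iic y) ∪ Ioc y x) := measure_mono fun s hs => by
              rcases le_or_gt s y with h | h
              · exact Or.inl ⟨hs.1, h⟩
              · exact Or.inr ⟨h, hs.2⟩
          _ ≤ halfLine (D ∩ Iic y) + halfLine (Ioc y x) := measure_union_le _ _
          _ ≤ halfLine (D ∩ Iic y) + ENNReal.ofReal (x - y) := by
              gcongr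
              rw [← Real.volume_Ioc]
              exact Measure.restrict_le_self _
      have h2 := ENNReal.toReal_mono (ENNReal.add_lt_top.2
        ⟨(hfin y).lt_top, ENNReal.ofReal_lt_top⟩).ne h1
      rw [ENNReal.toReal_add (hfin y) ENNReal.ofReal_ne_top,
        ENNReal.toReal_ofReal (sub_nonneg.2 hxy)] at h2
      rwa [Real.dist_eq, abs_of_nonneg (sub_nonneg.2 hxy)]
  have hU : D = ⋃ n : ℕ, D ∩ Iic (n : ℝ) := by
    rw [← inter_iUnion, inter_eq_left.2]
    intro s _
    exact mem_iUnion.2 (exists_nat_ge s)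
  have hdir : Monotone fun n : ℕ => D ∩ Iic (n : ℝ) := fun i j hij =>
    inter_subset_inter_right D (Iic_subset_Iic.2 (by exact_mod_cast hij))
  rw [hU, hdir.measure_iUnion] at hlt
  obtain ⟨n, hn⟩ := lt_iSup_iff.1 hlt
  have h0 : F 0 = 0 := by
    have : halfLine (D ∩ Iic 0) ≤ 0 :=
      (measure_mono inter_subset_right).trans (by rw [halfLine_Iic]; simp)
    simp only [hF]
    rw [le_antisymm this zero_le, ENNReal.toReal_zero]
  obtain ⟨r, -, hr⟩ := intermediate_value_Icc (n.cast_nonneg : (0 : ℝ) ≤ n)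
    hLip.continuous.continuousOn (show m.toReal ∈ Icc (F 0) (F n) from
      ⟨h0.le.trans ENNReal.toReal_nonneg, ENNReal.toReal_mono (hfin n) hn.le⟩)
  exact ⟨D ∩ Iic r, inter_subset_left, hD.inter measurableSet_Iic,
    (ENNReal.toReal_eq_toReal_iff' (hfin r) hm'.ne).1 hr⟩

/-- Disjoint subsets of prescribed measures. -/
theorem exists_disjoint_subsets {D : ℕ → Set ℝ} (hD : ∀ i, MeasurableSet (D i)) {m : ℕ → ℝ≥0∞}
    (N : ℕ) (hm : ∀ i < N, m i < ∞)
    (h : ∀ i < N, ∑ j ∈ Finset.range (i + 1), m j ≤ halfLine (D i)) :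
    ∃ P : ℕ → Set ℝ, (∀ i, MeasurableSet (P i)) ∧ (∀ i < N, P i ⊆ D i ∧ halfLine (P i) = m i) ∧
      (∀ i, N ≤ i → P i = ∅) ∧ Pairwise (Function.onFun Disjoint P) := by
  induction N with
  | zero =>
    exact ⟨fun _ => ∅, fun _ => MeasurableSet.empty, fun i hi => absurd hi (Nat.not_lt_zero i),
      fun _ _ => rfl, fun _ _ _ => disjoint_bot_left⟩
  | succ N ih =>
    obtain ⟨P, hPm, hP, hP0, hPd⟩ := ih (fun i hi => hm i (hi.trans N.lt_succ_self))
      (fun i hi => h i (hi.trans N.lt_succ_self))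
    have hUm : MeasurableSet (⋃ i ∈ Finset.range N, P i) :=
      Finset.measurableSet_biUnion _ fun i _ => hPm i
    -- Greedy choice: the earlier pieces use at most the sum of the earlier `m j`, so enough of `D
    -- N` is left.
    have hle : m N ≤ halfLine (D N \ ⋃ i ∈ Finset.range N, P i) := by
      refine le_trans ?_ le_measure_sdiff
      have h1 : halfLine (⋃ i ∈ Finset.range N, P i) ≤ ∑ j ∈ Finset.range N, m j :=
        (measure_biUnion_finset_le _ _).trans (Finset.sum_le_sum fun i hi =>
          (hP i (Finset.mem_range.1 hi)).2.le)
      have h2 := h N N.lt_succ_self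
      rw [Finset.sum_range_succ, add_comm] at h2
      refine le_trans ?_ (tsub_le_tsub_left h1 _)
      refine ENNReal.le_sub_of_add_le_right ?_ h2
      exact (ENNReal.sum_lt_top.2 fun i hi =>
        hm i ((Finset.mem_range.1 hi).trans N.lt_succ_self)).ne
    obtain ⟨Q, hQs, hQm, hQ⟩ := exists_subset_measure_eq ((hD N).diff hUm) hle
      (hm N N.lt_succ_self)
    have hdisj : ∀ i, i ≠ N → Disjoint Q (P i) := by
      intro i hi
      rcases lt_or_gt_of_ne hi with hi | hi
      · refine disjoint_left.2 fun s hs hs' => (hQs hs).2 ?_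
        exact mem_iUnion₂.2 ⟨i, Finset.mem_range.2 hi, hs'⟩
      · rw [hP0 i hi.le]
        exact disjoint_bot_right
    refine ⟨Function.update P N Q, fun i => ?_, fun i hi => ?_, fun i hi => ?_, fun i j hij => ?_⟩
    · rcases eq_or_ne i N with rfl | hne
      · simpa using hQm
      · simpa [hne] using hPm i
    · rcases eq_or_ne i N with rfl | hne
      · rw [Function.update_self]
        exact ⟨fun s hs => (hQs hs).1, hQ⟩
      · simpa [hne] using hP i (lt_of_le_of_ne (Nat.lt_succ_iff.1 hi) hne)
    · have hne : i ≠ N := (Nat.lt_of_succ_le hi).ne'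
      simpa [hne] using hP0 i (Nat.le_of_succ_le hi)
    · rw [Function.onFun]
      rcases eq_or_ne i N with rfl | hi
      · simpa [hij.symm] using hdisj j hij.symm
      · rcases eq_or_ne j N with rfl | hj
        · simpa [hi] using (hdisj i hi).symm
        · simpa [hi, hj] using hPd hij

/-- Spreading the average over `P i` onto a set no larger than `P i` costs at most ∫ |h| over `P i`,
and these sets are disjoint. The empty alternative is for the remainder index, whose level set may
have infinite measure. -/
theorem nrm_one_stepLin_le {κ : ℝ → ℕ} {hκ : Measurable κ} {P : ℕ → Set ℝ}
    {hP : ∀ i, halfLine (P i) < ∞} {σ : ℝ → ℝ} {hσ : AEStronglyMeasurable σ halfLine}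
    {hσ1 : ∀ s, |σ s| ≤ 1} (hPm : ∀ i, MeasurableSet (P i))
    (hPd : Pairwise (Function.onFun Disjoint P))
    (hPκ : ∀ i, P i = ∅ ∨ halfLine (κ ⁻¹' {i}) ≤ halfLine (P i)) (h : coupleL.sum) :
    (lebesgue 1).nrm (stepLin coupleL le_rfl κ hκ P hP σ hσ hσ1 h) ≤ (lebesgue 1).nrm h := by
  rw [nrm_one_eq, nrm_one_eq]
  have h1 := lintegral_map (μ := halfLine) (f := fun i : ℕ => ‖avgOn σ (P i) h‖ₑ)
    measurable_from_top hκ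
  rw [lintegral_countable'] at h1
  calc ∫⁻ s, ‖stepLin coupleL le_rfl κ hκ P hP σ hσ hσ1 h s‖ₑ ∂halfLine
      = ∫⁻ s, ‖avgOn σ (P (κ s)) h‖ₑ ∂halfLine := by
        refine lintegral_congr_ae ?_
        filter_upwards [stepLin_ae (hX := le_refl coupleL.sum) (hκ := hκ) (hP := hP) (hσ := hσ)
          (hσ1 := hσ1) h] with s hs
        rw [hs]
    _ = ∑' i, ‖avgOn σ (P i) h‖ₑ * Measure.map κ halfLine {i} := h1.symm
    _ ≤ ∑' i, ∫⁻ s in P i, ‖(h : L0) s‖ₑ ∂halfLine := by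
        refine ENNReal.tsum_le_tsum fun i => ?_
        rw [Measure.map_apply hκ (measurableSet_singleton i)]
        rcases hPκ i with h0 | h0
        · simp [h0, avgOn]
        · calc _ ≤ (∫⁻ s in P i, ‖(h : L0) s‖ₑ ∂halfLine) / halfLine (P i) * halfLine (P i) :=
                mul_le_mul' (enorm_avgOn_le hσ1 (hP i) _) h0
            _ ≤ _ := by
                rw [ENNReal.div_eq_inv_mul, mul_comm, ← mul_assoc]
                exact mul_le_of_le_one_left zero_le (ENNReal.mul_inv_le_one _)
    _ = ∫⁻ s in ⋃ i, P i, ‖(h : L0) s‖ₑ ∂halfLine := (lintegral_iUnion hPm hPd _).symm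
    _ ≤ ∫⁻ s, ‖(h : L0) s‖ₑ ∂halfLine := lintegral_mono' Measure.restrict_le_self le_rfl

/-- The index of the level set of `|y|` at scale `1 / N`, counted from above; the value `N * N`
stands for points at which `|y|` is small or large or which are beyond `N`. -/
def levelIndex (y : L0) (N : ℕ) (s : ℝ) : ℕ :=
  open Classical in
  if s ≤ N ∧ ⌊|y s| * N⌋₊ ≤ N * N then N * N - ⌊|y s| * N⌋₊ else N * N

theorem measurable_levelIndex (y : L0) (N : ℕ) : Measurable (levelIndex y N) := by
  have h1 : Measurable fun s => ⌊|y s| * N⌋₊ :=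
    Nat.measurable_floor.comp (y.measurable.abs.mul_const _)
  classical
  refine Measurable.ite ?_ (measurable_const.sub h1) measurable_const
  exact (measurableSet_Iic (a := (N : ℝ))).inter (measurableSet_le h1 measurable_const)

theorem levelIndex_lt {y : L0} {N : ℕ} {s : ℝ} (h : levelIndex y N s < N * N) :
    s ≤ N ∧ ⌊|y s| * N⌋₊ ≤ N * N ∧ 0 < ⌊|y s| * N⌋₊ ∧
      levelIndex y N s = N * N - ⌊|y s| * N⌋₊ := by
  unfold levelIndex at h ⊢
  split_ifs at h ⊢ with h1
  · exact ⟨h1.1, h1.2, by omega, rfl⟩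
  · exact absurd h (lt_irrefl _)

/-- The value at scale `1 / N` attached to an index. -/
def levelValue (N i : ℕ) : ℝ := ((N * N - 1 - i : ℕ) : ℝ) / N

/-- The value lies one grid unit below the floor, which makes the inequality strict, as in a
distribution function. Indices count downwards from the top, so smaller indices belong to larger
|y|. -/
theorem levelValue_lt {y : L0} {N : ℕ} (hN : 0 < N) {s : ℝ} {i : ℕ} (hi : i < N * N)
    (h : levelIndex y N s ≤ i) : levelValue N i < |y s| := by
  obtain ⟨-, h2, h3, h4⟩ := levelIndex_lt (h.trans_lt hi)
  have hN' : (0 : ℝ) < N := by exact_mod_cast hN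
  rw [levelValue, div_lt_iff₀ hN']
  refine lt_of_lt_of_le ?_ (Nat.floor_le (by positivity : 0 ≤ |y s| * N))
  exact_mod_cast (by omega : N * N - 1 - i < ⌊|y s| * N⌋₊)

/-- The floor and the extra unit in the value lose at most 1/N each. At the remainder index
truncated subtraction makes the value 0. -/
theorem le_levelValue {y : L0} {N : ℕ} (hN : 0 < N) {s : ℝ} (hs : s ≤ N) (hy : |y s| ≤ N) :
    |y s| - 2 / N ≤ levelValue N (levelIndex y N s) := by
  have hN' : (0 : ℝ) < N := by exact_mod_cast hN
  have h1 : ⌊|y s| * N⌋₊ ≤ N * N := by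
    refine Nat.floor_le_of_le ?_
    push_cast
    gcongr
  have h2 : levelIndex y N s = N * N - ⌊|y s| * N⌋₊ := if_pos ⟨hs, h1⟩
  have h3 := Nat.lt_floor_add_one (|y s| * N)
  have h4 : ⌊|y s| * N⌋₊ ≤ N * N - 1 - levelIndex y N s + 1 := by omega
  have h5 : (⌊|y s| * N⌋₊ : ℝ) ≤ ((N * N - 1 - levelIndex y N s : ℕ) : ℝ) + 1 := by
    exact_mod_cast h4
  rw [levelValue, le_div_iff₀ hN', sub_mul, div_mul_cancel₀ _ hN'.ne']
  linarith

/-- The level sets of y with index at most i lie where |y| exceeds the i-th value, so their total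
measure is at most that of the set where |x| exceeds it. Hence there are disjoint sets P i on which
|x| exceeds the i-th value, with the measures of the level sets; average sign(x)·h over P i and
place the result on the i-th level set. -/
theorem exists_transfer_step {x y : coupleL.sum}
    (h : ∀ c : ℝ, 0 ≤ c →
      halfLine {s | c < |(y : L0) s|} ≤ halfLine {s | c < |(x : L0) s|}) {N : ℕ} (hN : 0 < N) :
    ∃ T : coupleL.sum →ₗ[ℝ] L0, IsContraction coupleL coupleL T ∧
      ∀ᵐ s ∂halfLine, levelValue N (levelIndex y N s) ≤ T x s := by
  have hκ := measurable_levelIndex (y : L0) N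
  have hDm : ∀ i, MeasurableSet {s | levelValue N i < |(x : L0) s|} := fun i =>
    measurableSet_lt measurable_const (x : L0).measurable.abs
  have hval : ∀ i, 0 ≤ levelValue N i := fun i => by unfold levelValue; positivity
  obtain ⟨P, hPm, hP, hP0, hPd⟩ := exists_disjoint_subsets hDm
    (m := fun i => halfLine (levelIndex y N ⁻¹' {i})) (N * N)
    (fun i hi => lt_of_le_of_lt (measure_mono fun s (hs : levelIndex y N s = i) =>
      (levelIndex_lt (hs ▸ hi)).1) (halfLine_Iic_lt_top N))
    (fun i hi => by
      rw [← measure_biUnion_finset (fun a _ b _ hab => disjoint_left.2 fun s hs hs' =>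
        hab (by rw [← show levelIndex y N s = a from hs, show levelIndex y N s = b from hs']))
        (fun j _ => hκ (measurableSet_singleton j))]
      refine le_trans (measure_mono fun s hs => ?_) (h (levelValue N i) (hval i))
      obtain ⟨j, hj, hs⟩ := mem_iUnion₂.1 hs
      exact levelValue_lt hN hi ((show levelIndex y N s = j from hs).le.trans
        (Nat.lt_succ_iff.1 (Finset.mem_range.1 hj))))
  have hPt : ∀ i, halfLine (P i) < ∞ := fun i => by
    rcases lt_or_ge i (N * N) with hi | hi
    · rw [(hP i hi).2]
      exact lt_of_le_of_lt (measure_mono fun s (hs : levelIndex y N s = i) =>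
        (levelIndex_lt (hs ▸ hi)).1) (halfLine_Iic_lt_top N)
    · simp [hP0 i hi]
  refine ⟨stepLin coupleL le_rfl _ hκ P hPt (signOf x) (aestronglyMeasurable_signOf x)
    (abs_signOf_le x), ⟨fun k => nrm_one_stepLin_le hPm hPd (fun i => ?_) k,
      fun k => nrm_top_stepLin_le k⟩, ?_⟩
  · rcases lt_or_ge i (N * N) with hi | hi
    · exact Or.inr (hP i hi).2.ge
    · exact Or.inl (hP0 i hi)
  -- For a null level set the set P i is null too and its average is 0 by convention; such points
  -- are discarded.
  · have hnull : ∀ i, ∀ᵐ s ∂halfLine, halfLine (levelIndex y N ⁻¹' {i}) = 0 →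
        levelIndex y N s ≠ i := by
      intro i
      by_cases h0 : halfLine (levelIndex y N ⁻¹' {i}) = 0
      · filter_upwards [measure_eq_zero_iff_ae_notMem.1 h0] with s hs _ using hs
      · exact Eventually.of_forall fun s h1 => absurd h1 h0
    filter_upwards [ae_all_iff.2 hnull, stepLin_ae (hX := le_refl coupleL.sum) (hκ := hκ)
      (hP := hPt) (hσ := aestronglyMeasurable_signOf x) (hσ1 := abs_signOf_le x) x] with s hs hs'
    rw [hs']
    rcases lt_or_ge (levelIndex y N s) (N * N) with hi | hi
    · refine le_avgOn (aestronglyMeasurable_signOf x) (abs_signOf_le x) x.2 (hPt _) ?_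
        (ae_restrict_of_forall_mem (hPm _) fun r hr => ?_)
      · rw [(hP _ hi).2, pos_iff_ne_zero]
        exact fun h0 => hs _ h0 rfl
      · rw [signOf_mul]
        exact le_of_lt ((hP _ hi).1 hr)
    · rw [hP0 _ hi, levelValue, Nat.sub_eq_zero_of_le (by omega)]
      simp [avgOn]

/-- A function with smaller distribution function is in the orbit. -/
theorem orbit_of_distribution_le {x y : coupleL.sum}
    (h : ∀ c : ℝ, 0 ≤ c →
      halfLine {s | c < |(y : L0) s|} ≤ halfLine {s | c < |(x : L0) s|}) :
    Orbit coupleL coupleL x y := by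
  choose T hT hTx using fun n : ℕ => exists_transfer_step h n.succ_pos
  have hle : ∀ n : ℕ, ∀ s,
      |levelValue (n + 1) (levelIndex y (n + 1) s)| ≤ |(y : L0) s| := fun n s => by
    rw [abs_of_nonneg (by unfold levelValue; positivity)]
    rcases lt_or_ge (levelIndex (y : L0) (n + 1) s) ((n + 1) * (n + 1)) with hi | hi
    · exact (levelValue_lt n.succ_pos hi le_rfl).le
    · rw [levelValue, Nat.sub_eq_zero_of_le (by omega)]
      simp
  refine orbit_of_approx isFunctionCouple_coupleL hT y.2
    (w := fun n s => levelValue (n + 1) (levelIndex y (n + 1) s))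
    (fun n => ((measurable_from_top (f := levelValue (n + 1))).comp
      (measurable_levelIndex (y : L0) (n + 1))).aestronglyMeasurable) hTx
    (fun n => Eventually.of_forall (hle n)) (Eventually.of_forall fun s => ?_)
  have hlim : Tendsto (fun n : ℕ => |(y : L0) s| - 2 / ((n + 1 : ℕ) : ℝ)) atTop
      (𝓝 (|(y : L0) s| - 0)) :=
    tendsto_const_nhds.sub ((tendsto_const_div_atTop_nhds_zero_nat 2).comp
      (tendsto_add_atTop_nat 1))
  rw [sub_zero] at hlim
  refine tendsto_of_tendsto_of_tendsto_of_le_of_le' hlim tendsto_const_nhds ?_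
    (Eventually.of_forall fun n => (le_abs_self _).trans (hle n s))
  obtain ⟨M, hM⟩ := exists_nat_ge (max s |(y : L0) s|)
  filter_upwards [eventually_ge_atTop M] with n hn
  have hMn : (M : ℝ) ≤ ((n + 1 : ℕ) : ℝ) := by exact_mod_cast hn.trans n.le_succ
  exact le_levelValue n.succ_pos (((le_max_left _ _).trans hM).trans hMn)
    (((le_max_right _ _).trans hM).trans hMn)

end Transfer

/-! ### The decreasing rearrangement -/

section Rearrangement

/-- The decreasing rearrangement of `x`. -/
def rearr (x : L0) (s : ℝ) : ℝ≥0∞ :=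
  sInf {c : ℝ≥0∞ | halfLine {y | c < ‖x y‖ₑ} ≤ ENNReal.ofReal s}

theorem antitone_rearr (x : L0) : Antitone (rearr x) := fun _ _ hst =>
  sInf_le_sInf fun _ hc => le_trans hc (ENNReal.ofReal_le_ofReal hst)

/-- The nontrivial direction is right continuity of the distribution function: if the measure at
level c exceeds s, it still does at a slightly higher level. -/
theorem lt_rearr_iff {x : L0} {c : ℝ≥0∞} {s : ℝ} :
    c < rearr x s ↔ ENNReal.ofReal s < halfLine {y | c < ‖x y‖ₑ} := by
  constructor
  · intro h
    by_contra hle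
    exact absurd (show rearr x s ≤ c from sInf_le (not_lt.1 hle)) h.not_ge
  · intro h
    have hc : c < ∞ := by
      rw [lt_top_iff_ne_top]
      rintro rfl
      simp at h
    obtain ⟨v, hv, hvm, hvt⟩ := exists_seq_strictAnti_tendsto' hc
    have hU : {y | c < ‖x y‖ₑ} = ⋃ n, {y | v n < ‖x y‖ₑ} := by
      ext y
      simp only [mem_ofPred_eq, mem_iUnion]
      constructor
      · intro hy
        exact (hvt.eventually (gt_mem_nhds hy)).exists
      · rintro ⟨n, hn⟩
        exact (hvm n).1.trans hn
    have hmono : Monotone fun n => {y | v n < ‖x y‖ₑ} := fun i j hij y hy =>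
      lt_of_le_of_lt (hv.antitone hij) hy
    rw [hU, hmono.measure_iUnion] at h
    obtain ⟨n, hn⟩ := lt_iSup_iff.1 h
    refine (hvm n).1.trans_le (le_sInf fun d hd => ?_)
    by_contra hlt
    refine absurd (hn.trans_le (measure_mono fun y hy => ?_)) (not_lt.2 hd)
    exact lt_trans (not_le.1 hlt) hy

theorem halfLine_setOf_ofReal_lt (d : ℝ≥0∞) : halfLine {s | ENNReal.ofReal s < d} = d := by
  rcases eq_or_ne d ∞ with rfl | hd
  · simp
  · have h : {s | ENNReal.ofReal s < d} ∩ Ioi 0 = Ioo 0 d.toReal := by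
      ext s
      simp only [mem_inter_iff, mem_ofPred_eq, mem_Ioi, mem_Ioo]
      rw [and_comm, and_congr_right_iff]
      intro hs
      rw [ENNReal.ofReal_lt_iff_lt_toReal hs.le hd]
    rw [Measure.restrict_apply (measurableSet_lt ENNReal.measurable_ofReal measurable_const), h,
      Real.volume_Ioo, sub_zero, ENNReal.ofReal_toReal hd]

theorem halfLine_lt_rearr (x : L0) (c : ℝ≥0∞) :
    halfLine {s | c < rearr x s} = halfLine {y | c < ‖x y‖ₑ} := by
  simp only [lt_rearr_iff]
  exact halfLine_setOf_ofReal_lt _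

theorem lintegral_enorm_sub_le (a b : L0) :
    ∫⁻ s, (‖(a + b : L0) s‖ₑ - (lebesgue ∞).nrm b) ∂halfLine ≤ (lebesgue 1).nrm a := by
  rw [nrm_one_eq]
  refine lintegral_mono_ae ?_
  filter_upwards [AEEqFun.coeFn_add a b, ae_le_nrm_top b] with s h1 h2
  rw [tsub_le_iff_right, h1, Pi.add_apply]
  exact (enorm_add_le _ _).trans (by gcongr)

theorem rearr_lt_top {x : L0} (hx : x ∈ coupleL.sum) {s : ℝ} (hs : 0 < s) : rearr x s < ∞ := by
  obtain ⟨a, ha, b, hb, rfl⟩ := Submodule.mem_sup.1 hx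
  have ha' : (lebesgue 1).nrm a < ∞ := ha
  have hb' : (lebesgue ∞).nrm b < ∞ := hb
  have hs0 : ENNReal.ofReal s ≠ 0 := by simpa using hs
  -- Chebyshev for the excess of |a + b| over ‖b‖: this ε makes ‖a‖ / ε at most s, and the added 1
  -- keeps ε nonzero.
  set ε := ((lebesgue 1).nrm a + 1) / ENNReal.ofReal s with hε
  have hε0 : ε ≠ 0 := ENNReal.div_ne_zero.2 ⟨by simp, ENNReal.ofReal_ne_top⟩
  have hεt : ε ≠ ∞ := ENNReal.div_ne_top (by simpa using ha'.ne) hs0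
  refine lt_of_le_of_lt (sInf_le (show halfLine {y | (lebesgue ∞).nrm b + ε < ‖(a + b : L0) y‖ₑ} ≤
    ENNReal.ofReal s from ?_)) (ENNReal.add_lt_top.2 ⟨hb', hεt.lt_top⟩)
  calc halfLine {y | (lebesgue ∞).nrm b + ε < ‖(a + b : L0) y‖ₑ}
      ≤ halfLine {y | ε ≤ ‖(a + b : L0) y‖ₑ - (lebesgue ∞).nrm b} := measure_mono fun y hy =>
        ENNReal.le_sub_of_add_le_left hb'.ne (le_of_lt hy)
    _ ≤ (∫⁻ s, (‖(a + b : L0) s‖ₑ - (lebesgue ∞).nrm b) ∂halfLine) / ε :=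
        meas_ge_le_lintegral_div
          ((AEEqFun.measurable (a + b : L0)).enorm.sub_const _).aemeasurable hε0 hεt
    _ ≤ ENNReal.ofReal s := by
        refine ENNReal.div_le_of_le_mul ((lintegral_enorm_sub_le a b).trans ?_)
        rw [hε, ENNReal.mul_div_cancel hs0 ENNReal.ofReal_ne_top]
        exact le_self_add

/-- Functions with the same distribution function have the same integral above any level. -/
theorem lintegral_sub_eq_of_distribution {F G : ℝ → ℝ≥0∞} (hF : Measurable F) (hG : Measurable G)
    (hFt : ∀ᵐ s ∂halfLine, F s < ∞) (hGt : ∀ᵐ s ∂halfLine, G s < ∞)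
    (h : ∀ c, halfLine {s | c < F s} = halfLine {s | c < G s}) (c : ℝ≥0∞) :
    ∫⁻ s, (F s - c) ∂halfLine = ∫⁻ s, (G s - c) ∂halfLine := by
  have key : ∀ {F : ℝ → ℝ≥0∞}, Measurable F → (∀ᵐ s ∂halfLine, F s < ∞) →
      ∫⁻ s, (F s - c) ∂halfLine =
        ∫⁻ t in Ioi (0 : ℝ), halfLine {s | ENNReal.ofReal t + c < F s} := by
    intro F hF hFt
    have h1 := lintegral_eq_lintegral_meas_lt halfLine (f := fun s => (F s - c).toReal)
      (Eventually.of_forall fun s => ENNReal.toReal_nonneg)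
      (hF.sub_const c).ennreal_toReal.aemeasurable
    calc ∫⁻ s, (F s - c) ∂halfLine = ∫⁻ s, ENNReal.ofReal (F s - c).toReal ∂halfLine := by
          refine lintegral_congr_ae ?_
          filter_upwards [hFt] with s hs
          rw [ENNReal.ofReal_toReal (tsub_le_self.trans_lt hs).ne]
      _ = _ := h1
      _ = _ := by
          refine setLIntegral_congr_fun measurableSet_Ioi fun t ht => measure_congr ?_
          filter_upwards [hFt] with s hs
          refine propext ?_
          show t < (F s - c).toReal ↔ ENNReal.ofReal t + c < F s
          rw [← ENNReal.ofReal_lt_iff_lt_toReal (le_of_lt ht) (tsub_le_self.trans_lt hs).ne,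
            lt_tsub_iff_right]
  rw [key hF hFt, key hG hGt]
  simp only [h]

theorem ae_rearr_lt_top {x : L0} (hx : x ∈ coupleL.sum) : ∀ᵐ s ∂halfLine, rearr x s < ∞ := by
  filter_upwards [ae_restrict_mem measurableSet_Ioi] with s hs using rearr_lt_top hx hs

theorem lintegral_rearr_sub {x : L0} (hx : x ∈ coupleL.sum) (c : ℝ≥0∞) :
    ∫⁻ s, (rearr x s - c) ∂halfLine = ∫⁻ s, (‖x s‖ₑ - c) ∂halfLine :=
  lintegral_sub_eq_of_distribution (antitone_rearr x).measurable x.measurable.enorm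
    (ae_rearr_lt_top hx) (Eventually.of_forall fun _ => enorm_lt_top) (halfLine_lt_rearr x) c

/-- The decreasing rearrangement as an element of `L0`. -/
def rearrFun (x : L0) : L0 :=
  AEEqFun.mk (fun s => (rearr x s).toReal)
    (antitone_rearr x).measurable.ennreal_toReal.aestronglyMeasurable

theorem rearrFun_ae (x : L0) : rearrFun x =ᵐ[halfLine] fun s => (rearr x s).toReal :=
  AEEqFun.coeFn_mk _ _

/-- Excesses over a level have equal integrals for x and x*, and x* is decreasing, so x* lies even
in L̃¹ + L^∞. This lets the orbit in the smaller couple reach g* in (b). -/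
theorem rearrFun_mem_tilde_sum {x : L0} (hx : x ∈ coupleL.sum) :
    rearrFun x ∈ coupleTildeL.sum := by
  obtain ⟨a, ha, b, hb, e⟩ := Submodule.mem_sup.1 hx
  refine mem_tilde_sum_of_antitone (antitone_rearr x) (rearrFun_ae x)
    (fun s hs => rearr_lt_top hx hs) (c := (lebesgue ∞).nrm b) hb ?_
  rw [lintegral_rearr_sub hx, ← e]
  exact (lintegral_enorm_sub_le a b).trans_lt ha

theorem distribution_rearrFun {x : L0} (hx : x ∈ coupleL.sum) (c : ℝ) (hc : 0 ≤ c) :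
    halfLine {s | c < |rearrFun x s|} = halfLine {s | c < |x s|} := by
  have h1 : halfLine {s | c < |rearrFun x s|} = halfLine {s | ENNReal.ofReal c < rearr x s} := by
    refine measure_congr ?_
    filter_upwards [rearrFun_ae x, ae_rearr_lt_top hx] with s h1 h2
    refine propext ?_
    show c < |rearrFun x s| ↔ ENNReal.ofReal c < rearr x s
    rw [h1, abs_of_nonneg ENNReal.toReal_nonneg, ENNReal.ofReal_lt_iff_lt_toReal hc h2.ne]
  rw [h1, halfLine_lt_rearr]
  congr 1
  ext s
  simp only [mem_ofPred_eq]
  rw [Real.enorm_eq_ofReal_abs, ENNReal.ofReal_lt_ofReal_iff_of_nonneg hc]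

end Rearrangement

/-! ### The `K`-functionals -/

section KFunctional

variable {X : BanachCouple L0}

theorem K_le {t : ℝ≥0} {x x₀ x₁ : L0} (h₀ : X.X₀.nrm x₀ < ∞) (h₁ : X.X₁.nrm x₁ < ∞)
    (e : x₀ + x₁ = x) : X.K t x ≤ X.X₀.nrm x₀ + t * X.X₁.nrm x₁ :=
  iInf_le_of_le x₀ <| iInf_le_of_le x₁ <| iInf_le_of_le h₀ <| iInf_le_of_le h₁ <|
    iInf_le_of_le e le_rfl

theorem le_K {t : ℝ≥0} {x : L0} {C : ℝ≥0∞} (h : ∀ x₀ x₁ : L0, X.X₀.nrm x₀ < ∞ → X.X₁.nrm x₁ < ∞ →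
    x₀ + x₁ = x → C ≤ X.X₀.nrm x₀ + t * X.X₁.nrm x₁) : C ≤ X.K t x :=
  le_iInf fun x₀ => le_iInf fun x₁ => le_iInf fun h₀ => le_iInf fun h₁ => le_iInf fun e =>
    h x₀ x₁ h₀ h₁ e

/-- Clamp x to [-c, c]. With c = x*(t), respectively c = x̃(t), this decomposition attains the
K-functional of the corresponding couple. -/
theorem exists_truncation (x : L0) {c : ℝ≥0∞} (hc : c < ∞) : ∃ x₀ x₁ : L0, x₀ + x₁ = x ∧
    (∀ᵐ s ∂halfLine, ‖x₀ s‖ₑ ≤ ‖x s‖ₑ - c) ∧ (lebesgue ∞).nrm x₁ ≤ c := by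
  set r := c.toReal with hr
  have hr0 : 0 ≤ r := ENNReal.toReal_nonneg
  have hcr : c = ENNReal.ofReal r := (ENNReal.ofReal_toReal hc.ne).symm
  have hm : Measurable fun s => max (-r) (min r (x s)) :=
    measurable_const.max (measurable_const.min x.measurable)
  set x₁ : L0 := AEEqFun.mk _ hm.aestronglyMeasurable with hx₁
  have h₁ : x₁ =ᵐ[halfLine] fun s => max (-r) (min r (x s)) := AEEqFun.coeFn_mk _ _
  refine ⟨x - x₁, x₁, sub_add_cancel _ _, ?_, nrm_top_le ?_⟩
  · filter_upwards [AEEqFun.coeFn_sub x x₁, h₁] with s h2 h3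
    rw [h2, Pi.sub_apply, h3, Real.enorm_eq_ofReal_abs, Real.enorm_eq_ofReal_abs, hcr,
      ← ENNReal.ofReal_sub _ hr0]
    refine ENNReal.ofReal_le_ofReal_iff'.2 ?_
    rcases le_total r (x s) with h | h
    · left
      rw [min_eq_left h, max_eq_right (by linarith), abs_of_nonneg (by linarith),
        abs_of_nonneg (by linarith)]
    · rw [min_eq_right h]
      rcases le_total (x s) (-r) with h' | h'
      · left
        rw [max_eq_left h', abs_of_nonpos (by linarith), abs_of_nonpos (by linarith)]
        linarith
      · right
        rw [max_eq_right h']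
        simp
  · filter_upwards [h₁] with s h3
    rw [h3, Real.enorm_eq_ofReal_abs, hcr]
    refine ENNReal.ofReal_le_ofReal (abs_le.2 ⟨le_max_left _ _, max_le (by linarith) ?_⟩)
    exact min_le_left _ _

/-- A decreasing function exceeds its value at t only on (0, t]. By `setLIntegral_le_sub_add` no
other truncation level is cheaper. -/
theorem lintegral_sub_add_eq {q : ℝ → ℝ≥0∞} (hq : Antitone q) (t : ℝ) :
    ∫⁻ s, (q s - q t) ∂halfLine + ENNReal.ofReal t * q t =
      ∫⁻ s in Ioc 0 t, q s ∂halfLine := by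
  have h1 : ∫⁻ s, (q s - q t) ∂halfLine = ∫⁻ s in Ioc 0 t, (q s - q t) ∂halfLine := by
    rw [← lintegral_add_compl _ (measurableSet_Ioc (a := (0 : ℝ)) (b := t))]
    have h2 : ∫⁻ s in (Ioc 0 t)ᶜ, (q s - q t) ∂halfLine = 0 := by
      rw [lintegral_eq_zero_iff (hq.measurable.sub_const _)]
      filter_upwards [ae_restrict_mem measurableSet_Ioc.compl,
        ae_restrict_of_ae (ae_restrict_mem measurableSet_Ioi)] with s hs hs0
      refine tsub_eq_zero_of_le (hq ?_)
      by_contra hlt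
      exact hs ⟨hs0, (not_le.1 hlt).le⟩
    rw [h2, add_zero]
  have h3 : ENNReal.ofReal t * q t = ∫⁻ _ in Ioc 0 t, q t ∂halfLine := by
    rw [setLIntegral_const, halfLine_Ioc le_rfl, sub_zero, mul_comm]
  rw [h1, h3, ← lintegral_add_right _ measurable_const]
  exact setLIntegral_congr_fun measurableSet_Ioc fun s hs => tsub_add_cancel_of_le (hq hs.2)

theorem setLIntegral_le_sub_add (q : ℝ → ℝ≥0∞) (t : ℝ≥0) (c : ℝ≥0∞) :
    ∫⁻ s in Ioc (0 : ℝ) t, q s ∂halfLine ≤ ∫⁻ s, (q s - c) ∂halfLine + t * c := by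
  calc ∫⁻ s in Ioc (0 : ℝ) t, q s ∂halfLine ≤ ∫⁻ s in Ioc (0 : ℝ) t, ((q s - c) + c) ∂halfLine :=
        lintegral_mono fun s => le_tsub_add
    _ = ∫⁻ s in Ioc (0 : ℝ) t, (q s - c) ∂halfLine + t * c := by
        rw [lintegral_add_right _ measurable_const, setLIntegral_const, halfLine_Ioc le_rfl,
          sub_zero, ENNReal.ofReal_coe_nnreal, mul_comm c]
    _ ≤ _ := by
        gcongr
        exact Measure.restrict_le_self

theorem K_coupleL_le {x : L0} (hx : x ∈ coupleL.sum) {t : ℝ≥0} (ht : 0 < t) :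
    coupleL.K t x ≤ ∫⁻ s in Ioc (0 : ℝ) t, rearr x s ∂halfLine := by
  have ht' : (0 : ℝ) < t := ht
  have hc := rearr_lt_top hx ht'
  obtain ⟨x₀, x₁, e, h₀, h₁⟩ := exists_truncation x hc
  have hn : coupleL.X₀.nrm x₀ + t * coupleL.X₁.nrm x₁ ≤
      ∫⁻ s in Ioc (0 : ℝ) t, rearr x s ∂halfLine := by
    rw [← lintegral_sub_add_eq (antitone_rearr x), ENNReal.ofReal_coe_nnreal,
      lintegral_rearr_sub hx]
    refine add_le_add ?_ (mul_le_mul' le_rfl h₁)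
    show (lebesgue 1).nrm x₀ ≤ _
    rw [nrm_one_eq]
    exact lintegral_mono_ae h₀
  have hfin := (setLIntegral_ne_top_of_mem_sum (tilde_sum_le (rearrFun_mem_tilde_sum hx))
    (rearrFun_ae x) (fun s hs => rearr_lt_top hx hs) t).lt_top
  exact (K_le (le_self_add.trans_lt (hn.trans_lt hfin)) (h₁.trans_lt hc) e).trans hn

theorem le_K_coupleL {x : L0} (hx : x ∈ coupleL.sum) (t : ℝ≥0) :
    ∫⁻ s in Ioc (0 : ℝ) t, rearr x s ∂halfLine ≤ coupleL.K t x := by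
  refine le_K fun x₀ x₁ h₀ h₁ e => ?_
  refine (setLIntegral_le_sub_add _ t ((lebesgue ∞).nrm x₁)).trans ?_
  rw [lintegral_rearr_sub hx, ← e]
  exact add_le_add (lintegral_enorm_sub_le x₀ x₁) le_rfl

theorem K_coupleTildeL_le {x : L0} (hx : x ∈ coupleTildeL.sum) {t : ℝ≥0} (ht : 0 < t) :
    coupleTildeL.K t x ≤ ∫⁻ s in Ioc (0 : ℝ) t, ldmE x s ∂halfLine := by
  have ht' : (0 : ℝ) < t := ht
  have hc := ldmE_lt_top hx ht'
  obtain ⟨x₀, x₁, e, h₀, h₁⟩ := exists_truncation x hc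
  have hn : coupleTildeL.X₀.nrm x₀ + t * coupleTildeL.X₁.nrm x₁ ≤
      ∫⁻ s in Ioc (0 : ℝ) t, ldmE x s ∂halfLine := by
    rw [← lintegral_sub_add_eq (ldmE_antitone x), ENNReal.ofReal_coe_nnreal]
    refine add_le_add (tildeNorm_le_of_antitoneOn
      (Antitone.antitoneOn (fun s r hsr => tsub_le_tsub_right (ldmE_antitone x hsr) _) _) ?_)
      (mul_le_mul' le_rfl h₁)
    filter_upwards [h₀, ae_le_ldmE x] with s h2 h3
    exact h2.trans (tsub_le_tsub_right h3 _)
  have hfin := (setLIntegral_ne_top_of_mem_sum (ldm_mem_sum hx) (ldm_ae x)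
    (fun s hs => ldmE_lt_top hx hs) t).lt_top
  exact (K_le (le_self_add.trans_lt (hn.trans_lt hfin)) (h₁.trans_lt hc) e).trans hn

theorem le_K_coupleTildeL (x : L0) (t : ℝ≥0) :
    ∫⁻ s in Ioc (0 : ℝ) t, ldmE x s ∂halfLine ≤ coupleTildeL.K t x := by
  refine le_K fun x₀ x₁ h₀ h₁ e => ?_
  refine (setLIntegral_le_sub_add _ t ((lebesgue ∞).nrm x₁)).trans ?_
  refine add_le_add (lintegral_mono fun s => ?_) le_rfl
  rw [tsub_le_iff_right, ← e]
  exact (ldmE_add_le x₀ x₁ s).trans (by gcongr; exact ldmE_le_nrm_top x₁ s)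

/-- Sufficient for the example in (d): there g is already decreasing, so its rearrangement need not
be computed. -/
theorem setLIntegral_enorm_le_K_coupleL (x : L0) (t : ℝ≥0) :
    ∫⁻ s in Ioc (0 : ℝ) t, ‖x s‖ₑ ∂halfLine ≤ coupleL.K t x := by
  refine le_K fun x₀ x₁ h₀ h₁ e => ?_
  rw [← e]
  refine (lintegral_add_le_of_mem _).trans (le_of_eq ?_)
  rw [halfLine_Ioc le_rfl, sub_zero, ENNReal.ofReal_coe_nnreal, mul_comm]
  rfl

end KFunctional

/-! ### The constant `4` is admissible -/

section Dyadic

/-- An enumeration of the powers of `2`. -/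
def dyadic (n : ℕ) : ℝ := (2 : ℝ) ^ (Equiv.intEquivNat.symm n)

theorem dyadic_pos (n : ℕ) : 0 < dyadic n := by
  unfold dyadic
  positivity

/-- The index of the dyadic interval that contains `s`. -/
def dyadicIndex (s : ℝ) : ℕ := Equiv.intEquivNat ⌈Real.logb 2 s⌉

theorem measurable_dyadicIndex : Measurable dyadicIndex :=
  (measurable_from_top (f := Equiv.intEquivNat)).comp
    (Int.measurable_ceil.comp (Real.measurable_log.div_const _))

theorem mem_dyadic {s : ℝ} (hs : 0 < s) :
    dyadic (dyadicIndex s) / 2 < s ∧ s ≤ dyadic (dyadicIndex s) := by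
  have h1 : dyadic (dyadicIndex s) = (2 : ℝ) ^ ((⌈Real.logb 2 s⌉ : ℤ) : ℝ) := by
    rw [Real.rpow_intCast]
    simp [dyadic, dyadicIndex]
  rw [h1]
  refine ⟨?_, (Real.logb_le_iff_le_rpow one_lt_two hs).1 (Int.le_ceil _)⟩
  have h2 : (2 : ℝ) ^ ((⌈Real.logb 2 s⌉ : ℤ) : ℝ) / 2 =
      (2 : ℝ) ^ (((⌈Real.logb 2 s⌉ : ℤ) : ℝ) - 1) := by
    rw [Real.rpow_sub two_pos, Real.rpow_one]
  rw [h2, ← Real.lt_logb_iff_rpow_lt one_lt_two hs]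
  linarith [Int.ceil_lt_add_one (Real.logb 2 s)]

/-- Dyadic intervals with right end `dyadic n / 2`. -/
def dyadicIoc (n : ℕ) : Set ℝ := Ioc (dyadic n / 4) (dyadic n / 2)

theorem disjoint_dyadicIoc : Pairwise (Function.onFun Disjoint dyadicIoc) := by
  have key : ∀ i j : ℤ, i < j →
      Disjoint (Ioc ((2 : ℝ) ^ i / 4) ((2 : ℝ) ^ i / 2)) (Ioc ((2 : ℝ) ^ j / 4) ((2 : ℝ) ^ j / 2)) := by
    intro i j hij
    refine disjoint_left.2 fun s hs hs' => ?_
    have h1 : (2 : ℝ) ^ (i + 1) ≤ 2 ^ j := zpow_le_zpow_right₀ one_le_two hij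
    rw [zpow_add_one₀ two_ne_zero] at h1
    have := hs.2
    have := hs'.1
    linarith
  intro n m hnm
  have hne : Equiv.intEquivNat.symm n ≠ Equiv.intEquivNat.symm m := fun h =>
    hnm (Equiv.intEquivNat.symm.injective h)
  rcases lt_or_gt_of_ne hne with h | h
  · exact key _ _ h
  · exact (key _ _ h).symm

theorem halfLine_dyadicIoc (n : ℕ) : halfLine (dyadicIoc n) = ENNReal.ofReal (dyadic n / 4) := by
  have := dyadic_pos n
  rw [dyadicIoc, halfLine_Ioc (by positivity)]
  congr 1
  ring

theorem halfLine_dyadicIoc_lt_top (n : ℕ) : halfLine (dyadicIoc n) < ∞ := by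
  rw [halfLine_dyadicIoc]
  exact ENNReal.ofReal_lt_top

/-- The operator that takes `h` on each dyadic interval to the average of `h` over the previous
one. -/
def dyadicShift : coupleL.sum →ₗ[ℝ] L0 :=
  stepLin coupleL le_rfl dyadicIndex measurable_dyadicIndex dyadicIoc halfLine_dyadicIoc_lt_top
    (fun _ => 1) aestronglyMeasurable_const (fun _ => by simp)

theorem dyadicShift_ae (h : coupleL.sum) :
    dyadicShift h =ᵐ[halfLine] fun s => avgOn (fun _ => 1) (dyadicIoc (dyadicIndex s)) h :=
  stepLin_ae h

/-- The value c taken on (d/2, d] is extended to all of (0, d], and the sum of these functions is a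
decreasing majorant. Since c is at most the average of |h| over (d/4, d/2], of length d/4, each term
costs 4 times ∫ |h| over that interval, and these intervals are disjoint. -/
theorem tildeNorm_dyadicShift_le (h : coupleL.sum) :
    tildeNorm (dyadicShift h) ≤ 4 * (lebesgue 1).nrm h := by
  set c : ℕ → ℝ≥0∞ := fun n =>
    (∫⁻ s in dyadicIoc n, ‖(h : L0) s‖ₑ ∂halfLine) / halfLine (dyadicIoc n) with hc
  refine (tildeNorm_le_of_antitoneOn
    (q := fun s => ∑' n, (Iic (dyadic n)).indicator (fun _ => c n) s) ?_ ?_).trans ?_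
  · refine Antitone.antitoneOn (fun s t hst => ENNReal.tsum_le_tsum fun n => ?_) _
    by_cases ht : t ∈ Iic (dyadic n)
    · rw [indicator_of_mem ht, indicator_of_mem (show s ∈ Iic (dyadic n) from hst.trans ht)]
    · rw [indicator_of_notMem ht]
      exact zero_le
  · filter_upwards [dyadicShift_ae h, ae_restrict_mem measurableSet_Ioi] with s hs hs0
    rw [hs]
    refine le_trans ?_ (ENNReal.le_tsum (dyadicIndex s))
    rw [indicator_of_mem (show s ∈ Iic (dyadic (dyadicIndex s)) from (mem_dyadic hs0).2)]
    exact enorm_avgOn_le (fun _ => by simp) (halfLine_dyadicIoc_lt_top _) _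
  · rw [lintegral_tsum fun n => (measurable_const.indicator measurableSet_Iic).aemeasurable]
    have h1 : ∀ n, ∫⁻ s, (Iic (dyadic n)).indicator (fun _ => c n) s ∂halfLine =
        4 * ∫⁻ s in dyadicIoc n, ‖(h : L0) s‖ₑ ∂halfLine := by
      intro n
      have hp := dyadic_pos n
      have h0 : halfLine (dyadicIoc n) ≠ 0 := by
        rw [halfLine_dyadicIoc]
        simpa using hp
      have h4 : ENNReal.ofReal (dyadic n) = 4 * halfLine (dyadicIoc n) := by
        rw [halfLine_dyadicIoc, ← ENNReal.ofReal_ofNat, ← ENNReal.ofReal_mul (by norm_num)]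
        congr 1
        ring
      rw [lintegral_indicator measurableSet_Iic, setLIntegral_const, halfLine_Iic, h4,
        mul_left_comm, ENNReal.div_mul_cancel h0 (halfLine_dyadicIoc_lt_top n).ne]
    simp only [h1]
    rw [ENNReal.tsum_mul_left, nrm_one_eq]
    gcongr
    rw [← lintegral_iUnion (s := dyadicIoc) (fun n => measurableSet_Ioc) disjoint_dyadicIoc]
    exact lintegral_mono' Measure.restrict_le_self le_rfl

/-- The source interval lies to the left of s, where g̃ is at least g̃(s). This is why the average
is taken over the preceding interval. -/
theorem ae_le_dyadicShift_majorant (g : coupleTildeL.sum) :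
    ∀ᵐ s ∂halfLine, |(g : L0) s| ≤ dyadicShift (majorant g) s := by
  filter_upwards [dyadicShift_ae (majorant g), ae_restrict_mem measurableSet_Ioi, ae_le_ldmE g]
    with s hs hs0 hgs
  have hp := dyadic_pos (dyadicIndex s)
  have hfin := ldmE_lt_top g.2 hs0
  rw [Real.enorm_eq_ofReal_abs, ENNReal.ofReal_le_iff_le_toReal hfin.ne] at hgs
  rw [hs]
  refine hgs.trans (le_avgOn aestronglyMeasurable_const (fun _ => by simp) (majorant g).2
    (halfLine_dyadicIoc_lt_top _) ?_ ?_)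
  · rw [halfLine_dyadicIoc]
    simpa using hp
  · filter_upwards [ae_restrict_of_ae (ldm_ae g), ae_restrict_mem measurableSet_Ioc] with r hr hr'
    rw [one_mul]
    refine le_of_le_of_eq ?_ hr.symm
    have hr0 : 0 < r := lt_trans (by positivity) hr'.1
    exact ENNReal.toReal_mono (ldmE_lt_top g.2 hr0).ne
      (ldmE_antitone _ (hr'.2.trans (mem_dyadic hs0).1.le))

theorem isMajorantConstant_four : IsMajorantConstant 4 := by
  intro g
  obtain ⟨S, hS, hle⟩ := exists_mul_eq (x := dyadicShift (majorant g)) (y := g) (by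
    filter_upwards [ae_le_dyadicShift_majorant g] with s hs
    rw [Real.enorm_eq_ofReal_abs, Real.enorm_eq_ofReal_abs]
    exact ENNReal.ofReal_le_ofReal (hs.trans (le_abs_self _)))
  obtain ⟨M, hM, hMS⟩ := exists_coupleMap (X := coupleL) (Y := coupleTildeL) (c := 4)
    (T := S.comp dyadicShift)
    (fun h _ => (isFunctionCouple_coupleTildeL.mono _ _ (hle _)).trans
      (tildeNorm_dyadicShift_le h))
    (fun h _ => (isFunctionCouple_coupleTildeL.mono_top (hle _)).trans
      ((nrm_top_stepLin_le h).trans (le_mul_of_one_le_left zero_le (by norm_num))))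
  exact ⟨M, hM, Subtype.ext ((hMS _).trans hS)⟩

end Dyadic

/-! ### Operators from inequalities between `K`-functionals -/

section Pairs

/-- Common part of (a) and (b): since K(t, f) is at most ∫₀ᵗ f̃, the path f → f̃ → q is open to any
decreasing q with primitive below K. -/
theorem orbit_ldm_of_K_le (f : coupleTildeL.sum) {q : ℝ → ℝ≥0∞} (hq : Antitone q)
    (hqf : ∀ s, 0 < s → q s < ∞) {V : L0} (hV : V ∈ coupleTildeL.sum)
    (hVq : V =ᵐ[halfLine] fun s => (q s).toReal)
    (h : ∀ t : ℝ≥0, 0 < t → ∫⁻ s in Ioc (0 : ℝ) t, q s ∂halfLine ≤ coupleTildeL.K t f) :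
    Orbit coupleTildeL coupleTildeL f V := by
  refine (orbit_ldm f).trans (ldm_mem_tilde_sum f.2) ?_
  refine orbit_of_antitone isFunctionCouple_coupleTildeL averagingContracts_coupleTildeL
    (ldmE_antitone f) hq (fun s hs => ldmE_lt_top f.2 hs) hqf hV (ldm_ae f) hVq fun t ht => ?_
  lift t to ℝ≥0 using ht.le
  exact (h t ht).trans (K_coupleTildeL_le f.2 ht)

theorem isExactCouple_coupleTildeL : IsExactCouple coupleTildeL := by
  intro f g hK
  refine Orbit.exists_coupleMap ?_
  refine (orbit_ldm_of_K_le f (ldmE_antitone g) (fun s hs => ldmE_lt_top g.2 hs)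
    (ldm_mem_tilde_sum g.2) (ldm_ae g) fun t ht => (le_K_coupleTildeL _ t).trans (hK t ht)).trans
    (ldm_mem_tilde_sum g.2) (orbit_of_ae_le isFunctionCouple_coupleTildeL _ ?_)
  filter_upwards [ldm_ae g, ae_le_ldmE g, ae_restrict_mem measurableSet_Ioi] with s h1 h2 h3
  rw [h1, Real.enorm_eq_ofReal ENNReal.toReal_nonneg, ENNReal.ofReal_toReal (ldmE_lt_top g.2 h3).ne]
  exact h2

/-- Work in the smaller couple until g* is reached, pass to (L¹, L^∞) by inclusion, and only there
rearrange g* into g. -/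
theorem isExactRelativePair_tilde : IsExactRelativePair coupleTildeL coupleL := by
  intro f g hK
  refine Orbit.exists_coupleMap ?_
  have hr := rearrFun_mem_tilde_sum g.2
  have h1 : Orbit coupleTildeL coupleTildeL f (rearrFun g) :=
    orbit_ldm_of_K_le f (antitone_rearr g) (fun s hs => rearr_lt_top g.2 hs) hr (rearrFun_ae g)
      fun t ht => (le_K_coupleL g.2 t).trans (hK t ht)
  have h2 : Orbit coupleTildeL coupleL ⟨rearrFun g, hr⟩ (rearrFun g) :=
    ⟨coupleTildeL.sum.subtype, ⟨fun h => nrm_one_le_tildeNorm _, fun _ => le_rfl⟩, rfl⟩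
  exact (h1.trans hr h2).trans (tilde_sum_le hr)
    (orbit_of_distribution_le fun c hc => (distribution_rearrFun g.2 c hc).ge)

/-- Everything up to ỹ is a contraction of (L¹, L^∞); the constant comes only from the final
operator taking ỹ to y. -/
theorem isUniformRelativePair_of_isMajorantConstant {m : ℝ≥0} (hm : IsMajorantConstant m) :
    IsUniformRelativePair m coupleL coupleTildeL := by
  intro x y hK
  have hr := tilde_sum_le (rearrFun_mem_tilde_sum x.2)
  have h1 : Orbit coupleL coupleL x (rearrFun x) :=
    orbit_of_distribution_le (y := ⟨rearrFun x, hr⟩) fun c hc =>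
      (distribution_rearrFun x.2 c hc).le
  have h2 : Orbit coupleL coupleL x (ldm y) := by
    refine h1.trans hr (orbit_of_antitone isFunctionCouple_coupleL averagingContracts_coupleL
      (antitone_rearr x) (ldmE_antitone y) (fun s hs => rearr_lt_top x.2 hs)
      (fun s hs => ldmE_lt_top y.2 hs) (ldm_mem_sum y.2) (rearrFun_ae x) (ldm_ae y)
      fun t ht => ?_)
    lift t to ℝ≥0 using ht.le
    exact ((le_K_coupleTildeL _ t).trans (hK t ht)).trans (K_coupleL_le x.2 ht)
  obtain ⟨T, hT, hTx⟩ := h2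
  obtain ⟨M, hM, hMy⟩ := hm y
  let T' : coupleL.sum →ₗ[ℝ] coupleL.sum := T.codRestrict coupleL.sum hT.mem_sum
  obtain ⟨S, hS, hSM⟩ := exists_coupleMap (X := coupleL) (Y := coupleTildeL) (c := m)
    (T := (coupleTildeL.sum.subtype.comp M.toLin).comp T')
    (fun h hh => (M.bound₀ hM (T' h) ((hT.1 h).trans_lt hh)).trans (mul_le_mul' le_rfl (hT.1 h)))
    (fun h hh => (M.bound₁ hM (T' h) ((hT.2 h).trans_lt hh)).trans (mul_le_mul' le_rfl (hT.2 h)))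
  refine ⟨S, hS, Subtype.ext ((hSM x).trans ?_)⟩
  have h3 : T' x = majorant y := Subtype.ext hTx
  show ((M.toLin (T' x) : coupleTildeL.sum) : L0) = y
  rw [h3, hMy]

end Pairs

/-! ### A function for which the norm is at least `9 / 8` -/

section LowerBound

/-- The indicator function of `(a, b]`. -/
def indIoc (a b : ℝ) : L0 :=
  AEEqFun.mk ((Ioc a b).indicator fun _ => (1 : ℝ))
    (measurable_const.indicator measurableSet_Ioc).aestronglyMeasurable

theorem indIoc_ae (a b : ℝ) : indIoc a b =ᵐ[halfLine] (Ioc a b).indicator fun _ => (1 : ℝ) :=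
  AEEqFun.coeFn_mk _ _

theorem enorm_indicator_one (a b s : ℝ) :
    ‖(Ioc a b).indicator (fun _ => (1 : ℝ)) s‖ₑ = (Ioc a b).indicator (fun _ => (1 : ℝ≥0∞)) s := by
  by_cases h : s ∈ Ioc a b <;> simp [h]

theorem nrm_one_indIoc {a : ℝ} (ha : 0 ≤ a) (b : ℝ) :
    (lebesgue 1).nrm (indIoc a b) = ENNReal.ofReal (b - a) := by
  rw [nrm_one_eq, lintegral_congr_ae (g := (Ioc a b).indicator fun _ => 1) (by
    filter_upwards [indIoc_ae a b] with s hs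
    rw [hs, enorm_indicator_one]), lintegral_indicator measurableSet_Ioc, setLIntegral_const,
    one_mul, halfLine_Ioc ha]

/-- `1_{(a, b]}` as an element of `L¹ + L^∞`. -/
def indSum (a b : ℝ) (ha : 0 ≤ a) : coupleL.sum :=
  ⟨indIoc a b, Submodule.mem_sup_left (show (lebesgue 1).nrm (indIoc a b) < ∞ by
    rw [nrm_one_indIoc ha]; exact ENNReal.ofReal_lt_top)⟩

/-- The function `2 · 1_{(0, 1]} + 1_{(1, 3]}`. -/
def twoStep : L0 := (2 : ℝ) • indIoc 0 1 + indIoc 1 3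

/-- The values of `twoStep`. -/
def twoStepE (s : ℝ) : ℝ≥0∞ :=
  (Iic (1 : ℝ)).indicator (fun _ => 1) s + (Iic (3 : ℝ)).indicator (fun _ => 1) s

theorem antitone_twoStepE : Antitone twoStepE := by
  have key : ∀ c : ℝ, Antitone ((Iic c).indicator fun _ => (1 : ℝ≥0∞)) := by
    intro c s t hst
    by_cases ht : t ∈ Iic c
    · rw [indicator_of_mem ht, indicator_of_mem (show s ∈ Iic c from hst.trans ht)]
    · rw [indicator_of_notMem ht]
      exact zero_le
  exact (key 1).add (key 3)

theorem twoStepE_lt_top (s : ℝ) : twoStepE s < ∞ := by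
  refine ENNReal.add_lt_top.2 ⟨?_, ?_⟩ <;>
  · refine lt_of_le_of_lt (indicator_le_self' (fun _ _ => zero_le) s) ENNReal.one_lt_top

theorem twoStep_ae : ∀ᵐ s ∂halfLine, twoStep s = (twoStepE s).toReal := by
  filter_upwards [AEEqFun.coeFn_add ((2 : ℝ) • indIoc 0 1) (indIoc 1 3),
    AEEqFun.coeFn_smul (2 : ℝ) (indIoc 0 1), indIoc_ae 0 1, indIoc_ae 1 3,
    ae_restrict_mem measurableSet_Ioi] with s h1 h2 h3 h4 h5
  rw [mem_Ioi] at h5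
  rw [twoStep, h1, Pi.add_apply, h2, Pi.smul_apply, h3, h4, twoStepE]
  rcases le_or_gt s 1 with hs | hs
  · have hs3 : s ≤ 3 := by linarith
    simp [indicator, h5, hs, hs3, hs.not_gt]
    norm_num
  · rcases le_or_gt s 3 with hs3 | hs3
    · simp [indicator, hs, hs3, hs.not_ge]
    · simp [indicator, hs.not_ge, hs3.not_ge]

theorem enorm_twoStep_ae : ∀ᵐ s ∂halfLine, ‖twoStep s‖ₑ = twoStepE s := by
  filter_upwards [twoStep_ae] with s hs
  rw [hs, Real.enorm_eq_ofReal ENNReal.toReal_nonneg, ENNReal.ofReal_toReal (twoStepE_lt_top s).ne]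

theorem ldmE_twoStep_ae : ∀ᵐ s ∂halfLine, ldmE twoStep s = twoStepE s := by
  filter_upwards [enorm_twoStep_ae, ae_le_ldmE twoStep, ae_restrict_mem measurableSet_Ioi]
    with s h1 h2 h3
  refine le_antisymm (ldmE_le_of_antitoneOn (antitone_twoStepE.antitoneOn _) ?_ h3) (h1 ▸ h2)
  filter_upwards [enorm_twoStep_ae] with r hr using hr.le

theorem ldm_twoStep : ldm twoStep = twoStep := by
  refine AEEqFun.ext ?_
  filter_upwards [ldm_ae twoStep, ldmE_twoStep_ae, twoStep_ae] with s h1 h2 h3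
  rw [h1, h2, h3]

theorem tildeNorm_twoStep_lt_top : tildeNorm twoStep < ∞ := by
  refine lt_of_le_of_lt (tildeNorm_le_of_antitoneOn (antitone_twoStepE.antitoneOn _)
    (by filter_upwards [enorm_twoStep_ae] with s hs using hs.le)) ?_
  unfold twoStepE
  rw [lintegral_add_left (measurable_const.indicator measurableSet_Iic),
    lintegral_indicator measurableSet_Iic, lintegral_indicator measurableSet_Iic,
    setLIntegral_const, setLIntegral_const, halfLine_Iic, halfLine_Iic]
  simp

theorem nrm_top_twoStep_lt_top : (lebesgue ∞).nrm twoStep < ∞ := by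
  refine lt_of_le_of_lt (nrm_top_le (C := 2) ?_) (by simp)
  filter_upwards [enorm_twoStep_ae] with s hs
  rw [hs, ← one_add_one_eq_two]
  exact add_le_add (indicator_le_self' (fun _ _ => zero_le) s)
    (indicator_le_self' (fun _ _ => zero_le) s)

/-- `twoStep` as an element of `L̃¹ + L^∞`. -/
def twoStepSum : coupleTildeL.sum :=
  ⟨twoStep, Submodule.mem_sup_left (show tildeNorm twoStep < ∞ from tildeNorm_twoStep_lt_top)⟩

theorem majorant_twoStepSum :
    majorant twoStepSum = (2 : ℝ) • indSum 0 1 le_rfl + indSum 1 3 zero_le_one :=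
  Subtype.ext ldm_twoStep

theorem setIntegral_le_toReal {f : L0} {P : Set ℝ} {C : ℝ≥0∞} (hC : C ≠ ∞)
    (h : ∫⁻ s in P, ‖f s‖ₑ ∂halfLine ≤ C) : ∫ s in P, f s ∂halfLine ≤ C.toReal := by
  rw [← ENNReal.ofReal_le_iff_le_toReal hC]
  refine le_trans (ENNReal.ofReal_le_ofReal (le_abs_self _)) ?_
  rw [← Real.enorm_eq_ofReal_abs]
  exact (enorm_integral_le_lintegral_enorm _).trans h

/-- Mass on (1, 3] is charged twice in L̃¹: it is at most 2B̃(1), hence at most 2∫ B̃ over (0, 1],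
and also at most ∫ B̃ over (1, 3]. -/
theorem setLIntegral_Ioc_add_le (B : L0) :
    ∫⁻ s in Ioc (1 : ℝ) 3, ‖B s‖ₑ ∂halfLine + 2 * ∫⁻ s in Ioc (1 : ℝ) 3, ‖B s‖ₑ ∂halfLine ≤
      2 * tildeNorm B := by
  have h1 : ∫⁻ s in Ioc (1 : ℝ) 3, ‖B s‖ₑ ∂halfLine ≤ 2 * ldmE B 1 := by
    calc ∫⁻ s in Ioc (1 : ℝ) 3, ‖B s‖ₑ ∂halfLine ≤ ∫⁻ _ in Ioc (1 : ℝ) 3, ldmE B 1 ∂halfLine := by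
          refine lintegral_mono_ae ?_
          filter_upwards [ae_restrict_of_ae (ae_le_ldmE B), ae_restrict_mem measurableSet_Ioc]
            with s hs hs'
          exact hs.trans (ldmE_antitone B hs'.1.le)
      _ = 2 * ldmE B 1 := by
          rw [setLIntegral_const, halfLine_Ioc zero_le_one, mul_comm]
          norm_num
  have h2 : ldmE B 1 ≤ ∫⁻ s in Ioc (0 : ℝ) 1, ldmE B s ∂halfLine := by
    calc ldmE B 1 = ∫⁻ _ in Ioc (0 : ℝ) 1, ldmE B 1 ∂halfLine := by
          rw [setLIntegral_const, halfLine_Ioc le_rfl]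
          norm_num
      _ ≤ _ := setLIntegral_mono (measurable_ldmE B) fun s hs => ldmE_antitone B hs.2
  have h3 : ∫⁻ s in Ioc (1 : ℝ) 3, ‖B s‖ₑ ∂halfLine ≤ ∫⁻ s in Ioc (1 : ℝ) 3, ldmE B s ∂halfLine :=
    lintegral_mono_ae (ae_restrict_of_ae (ae_le_ldmE B))
  have h4 : ∫⁻ s in Ioc (0 : ℝ) 1, ldmE B s ∂halfLine + ∫⁻ s in Ioc (1 : ℝ) 3, ldmE B s ∂halfLine ≤
      tildeNorm B := by
    rw [← lintegral_union measurableSet_Ioc (Ioc_disjoint_Ioc_of_le le_rfl)]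
    exact lintegral_mono' Measure.restrict_le_self le_rfl
  calc _ ≤ 2 * ldmE B 1 + 2 * ∫⁻ s in Ioc (1 : ℝ) 3, ldmE B s ∂halfLine := by gcongr
    _ ≤ 2 * (∫⁻ s in Ioc (0 : ℝ) 1, ldmE B s ∂halfLine +
        ∫⁻ s in Ioc (1 : ℝ) 3, ldmE B s ∂halfLine) := by
        rw [mul_add]
        gcongr
    _ ≤ _ := by gcongr

theorem nine_eighths_le_norm (M : CoupleMap coupleL coupleTildeL)
    (hM : M.toLin (majorant twoStepSum) = twoStepSum) : 9 / 8 ≤ M.norm := by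
  rcases eq_or_ne M.norm ∞ with htop | hN
  · rw [htop]
    exact le_top
  set n := M.norm.toReal with hn
  set A : L0 := (M.toLin (indSum 0 1 le_rfl) : coupleTildeL.sum).1 with hA
  set B : L0 := (M.toLin (indSum 1 3 zero_le_one) : coupleTildeL.sum).1 with hB
  have hsum : (2 : ℝ) • A + B = twoStep := by
    rw [majorant_twoStepSum, map_add, map_smul] at hM
    exact congrArg Subtype.val hM
  have hAt : tildeNorm A ≤ M.norm := by
    have h := M.bound₀ le_rfl (indSum 0 1 le_rfl) (by
      show (lebesgue 1).nrm (indIoc 0 1) < ∞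
      rw [nrm_one_indIoc le_rfl]; exact ENNReal.ofReal_lt_top)
    refine h.trans (le_of_eq ?_)
    show M.norm * (lebesgue 1).nrm (indIoc 0 1) = M.norm
    rw [nrm_one_indIoc le_rfl]
    simp
  have hBt : tildeNorm B ≤ M.norm * 2 := by
    have h := M.bound₀ le_rfl (indSum 1 3 zero_le_one) (by
      show (lebesgue 1).nrm (indIoc 1 3) < ∞
      rw [nrm_one_indIoc zero_le_one]; exact ENNReal.ofReal_lt_top)
    refine h.trans (le_of_eq ?_)
    show M.norm * (lebesgue 1).nrm (indIoc 1 3) = M.norm * 2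
    rw [nrm_one_indIoc zero_le_one]
    norm_num
  have hone : (lebesgue ∞).nrm (indIoc 0 1 + indIoc 1 3) ≤ 1 := by
    refine nrm_top_le ?_
    filter_upwards [AEEqFun.coeFn_add (indIoc 0 1) (indIoc 1 3), indIoc_ae 0 1, indIoc_ae 1 3]
      with s h1 h2 h3
    rw [h1, Pi.add_apply, h2, h3]
    rcases le_or_gt s 1 with hs | hs
    · rw [indicator_of_notMem (s := Ioc 1 3) fun h => absurd h.1 hs.not_gt, add_zero,
        enorm_indicator_one]
      exact indicator_le_self' (fun _ _ => zero_le) s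
    · rw [indicator_of_notMem (s := Ioc 0 1) fun h => absurd h.2 hs.not_ge, zero_add,
        enorm_indicator_one]
      exact indicator_le_self' (fun _ _ => zero_le) s
  have hABt : (lebesgue ∞).nrm (A + B) ≤ M.norm := by
    have h := M.bound₁ le_rfl (indSum 0 1 le_rfl + indSum 1 3 zero_le_one)
      (lt_of_le_of_lt hone ENNReal.one_lt_top)
    rw [map_add] at h
    exact h.trans (mul_le_of_le_one_right zero_le hone)
  have hAs : A ∈ coupleL.sum := tilde_sum_le (M.toLin _).2
  have hBs : B ∈ coupleL.sum := tilde_sum_le (M.toLin _).2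
  have hAi : ∀ {a : ℝ} (b : ℝ), 0 ≤ a → IntegrableOn A (Ioc a b) halfLine := fun b ha =>
    integrableOn_of_mem_sum hAs (halfLine_Ioc_lt_top ha b)
  have hBi : ∀ {a : ℝ} (b : ℝ), 0 ≤ a → IntegrableOn B (Ioc a b) halfLine := fun b ha =>
    integrableOn_of_mem_sum hBs (halfLine_Ioc_lt_top ha b)
  have hval : ∀ᵐ s ∂halfLine, 2 * A s + B s = twoStep s := by
    filter_upwards [AEEqFun.coeFn_add ((2 : ℝ) • A) B, AEEqFun.coeFn_smul (2 : ℝ) A] with s h1 h2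
    rw [← hsum, h1, Pi.add_apply, h2, Pi.smul_apply, smul_eq_mul]
  have e1 : 2 * ∫ s in Ioc (0 : ℝ) 1, A s ∂halfLine + ∫ s in Ioc (0 : ℝ) 1, B s ∂halfLine = 2 := by
    rw [← integral_const_mul, ← integral_add ((hAi 1 le_rfl).const_mul 2) (hBi 1 le_rfl),
      setIntegral_congr_ae (g := fun _ => (2 : ℝ)) measurableSet_Ioc (by
        filter_upwards [hval, twoStep_ae] with s h1 h2 hs
        have hs3 : s ≤ 3 := hs.2.trans (by norm_num)
        rw [h1, h2, twoStepE]
        simp [indicator, hs.2, hs3]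
        norm_num), setIntegral_const, measureReal_def, halfLine_Ioc le_rfl]
    norm_num
  have e2 : 2 * ∫ s in Ioc (1 : ℝ) 3, A s ∂halfLine + ∫ s in Ioc (1 : ℝ) 3, B s ∂halfLine = 2 := by
    rw [← integral_const_mul, ← integral_add ((hAi 3 zero_le_one).const_mul 2)
      (hBi 3 zero_le_one), setIntegral_congr_ae (g := fun _ => (1 : ℝ)) measurableSet_Ioc (by
        filter_upwards [hval, twoStep_ae] with s h1 h2 hs
        rw [h1, h2, twoStepE]
        simp [indicator, hs.2, hs.1.not_ge]), setIntegral_const, measureReal_def,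
      halfLine_Ioc zero_le_one]
    norm_num
  have i1 : ∫ s in Ioc (0 : ℝ) 1, A s ∂halfLine + ∫ s in Ioc (0 : ℝ) 1, B s ∂halfLine ≤ n := by
    rw [← integral_add (hAi 1 le_rfl) (hBi 1 le_rfl)]
    refine le_of_eq_of_le
      (integral_congr_ae (ae_restrict_of_ae (AEEqFun.coeFn_add A B).symm)) ?_
    refine setIntegral_le_toReal hN ?_
    refine (lintegral_mono_ae (ae_restrict_of_ae (ae_le_nrm_top (A + B)))).trans ?_
    rw [setLIntegral_const, halfLine_Ioc le_rfl]
    simpa using hABt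
  have i2 : ∫ s in Ioc (0 : ℝ) 1, A s ∂halfLine + ∫ s in Ioc (1 : ℝ) 3, A s ∂halfLine ≤ n := by
    rw [← setIntegral_union (Ioc_disjoint_Ioc_of_le le_rfl) measurableSet_Ioc (hAi 1 le_rfl)
      (hAi 3 zero_le_one)]
    refine setIntegral_le_toReal hN (le_trans ?_ hAt)
    refine le_trans ?_ (nrm_one_le_tildeNorm A)
    rw [eLpNorm_one_eq_lintegral_enorm]
    exact lintegral_mono' Measure.restrict_le_self le_rfl
  have i3 : 3 * ∫ s in Ioc (1 : ℝ) 3, B s ∂halfLine ≤ 4 * n := by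
    have h1 := setLIntegral_Ioc_add_le B
    set b := ∫⁻ s in Ioc (1 : ℝ) 3, ‖B s‖ₑ ∂halfLine with hb
    have h2 : b + 2 * b ≤ 2 * (M.norm * 2) := h1.trans (by gcongr)
    have hfin : 2 * (M.norm * 2) ≠ ∞ := by finiteness
    have hbt : b ≠ ∞ := ne_top_of_le_ne_top hfin (le_self_add.trans h2)
    have h3 := ENNReal.toReal_mono hfin h2
    rw [ENNReal.toReal_add hbt (by finiteness), ENNReal.toReal_mul, ENNReal.toReal_mul,
      ENNReal.toReal_mul, ENNReal.toReal_ofNat] at h3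
    have h4 := setIntegral_le_toReal (f := B) (P := Ioc (1 : ℝ) 3) hbt le_rfl
    linarith
  -- Let a₁, b₁ be the integrals of A, B over (0, 1] and a₂, b₂ those over (1, 3]. Adding `i1` and
  -- `i2` and using `e1` gives 2 + a₂ ≤ 2n, while `e2` and `i3` give a₂ = 1 - b₂/2 ≥ 1 - 2n/3. Hence
  -- 3 ≤ 8n/3.
  have hfinal : 9 / 8 ≤ n := by linarith
  rw [← ENNReal.ofReal_toReal hN]
  refine le_trans (le_of_eq ?_) (ENNReal.ofReal_le_ofReal hfinal)
  rw [ENNReal.ofReal_div_of_pos (by norm_num)]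
  norm_num

theorem not_isExactRelativePair : ¬ IsExactRelativePair coupleL coupleTildeL := by
  intro h
  obtain ⟨T, hT, hTg⟩ := h (majorant twoStepSum) twoStepSum fun t ht => by
    -- As g̃ = g = |g|, the K-functional of g is at most ∫₀ᵗ |g|, hence at most that of g̃. An exact
    -- pair would then give an operator of norm at most 1 < 9/8.
    refine (K_coupleTildeL_le twoStepSum.2 ht).trans
      (le_trans (le_of_eq ?_) (setLIntegral_enorm_le_K_coupleL _ t))
    refine lintegral_congr_ae (ae_restrict_of_ae ?_)
    filter_upwards [ldmE_twoStep_ae, enorm_twoStep_ae] with s h1 h2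
    show ldmE twoStep s = ‖ldm twoStep s‖ₑ
    rw [ldm_twoStep, h1, h2]
  have h1 := (nine_eighths_le_norm T hTg).trans hT
  rw [ENNReal.div_le_iff (by norm_num) (by norm_num)] at h1
  norm_num at h1

end LowerBound

end

end CalderonMityagin

open CalderonMityagin
theorem theorem3p1 :
    -- `m = 4` is an admissible constant
    IsMajorantConstant 4 ∧
    ∀ m : NNReal, IsMajorantConstant m →
      -- (a)
      IsExactCouple coupleTildeL ∧
      -- (b)
      IsExactRelativePair coupleTildeL coupleL ∧
      -- (c)
      IsUniformRelativePair m coupleL coupleTildeL ∧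
      -- (d), with the quantitative form of the failure
      ¬ IsExactRelativePair coupleL coupleTildeL ∧
      ∃ g : coupleTildeL.sum, (g : L0) ∈ tildeL1.carrier ⊓ (lebesgue ⊤).carrier ∧
        ∀ M : CoupleMap coupleL coupleTildeL, M.toLin (majorant g) = g → 9 / 8 ≤ M.norm := by
  refine ⟨isMajorantConstant_four, fun m hm => ⟨isExactCouple_coupleTildeL,
    isExactRelativePair_tilde, isUniformRelativePair_of_isMajorantConstant hm,
    not_isExactRelativePair, twoStepSum, ⟨tildeNorm_twoStep_lt_top, nrm_top_twoStep_lt_top⟩,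
    nine_eighths_le_norm⟩⟩
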